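/- **Setting.** Let $k$ be a constant and let $m(\cdot),B(\cdot),g(\cdot),p(\cdot),s(\cdot)$ be polynomials. For $n\ge 2$ let $H=\sum_{j=1}^{m}H_j-\hat\lambda I$ be a real symmetric $2^n\times 2^n$ matrix, where $m\le m(n)$, each $H_j$ acts nontrivially on at most $k$ of the $n$ qubits, $\|H\|\le B(n)$, and $\hat\lambda$ and all entries of the matrices describing the $H_j$ are *represented by $p(n)$ bits*, i.e. are of the form $N_1/N_2$ with integers $|N_1|,|N_2|\le 2^{p(n)}$. ($\hat\lambda$ is the claimed ground energy of $\sum_j H_j$.) Write $\lambda(H)$ for the least eigenvalue. * $H$ is a *Yes instance* if $H\neq0$, $\lambda(H)=0$ and some normalized real ground state $\psi$ of $H$ is succinct: a Boolean circuit $C$ of size at most $s(n)$ computes $C(x)=c\,\langle x|\psi\rangle$ for all $x\in\{0,1\}^n$, for some constant $c>0$, and all values $C(x)$ are represented by $p(n)$ bits. * $H$ is a *No instance* if $\lambda(H)\ge\epsilon$, where $\epsilon\ge 1/g(n)$, $g(n)>0$. A witness is a pair $(\phi,x_{in})$: a vector $\phi\in\mathbb Q^{2^n}$ given by a Boolean circuit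 $C_\phi$ with $\langle x|\phi\rangle=C_\phi(x)$ (a fraction in binary; the value is read as $0$ if the denominator is $0$), and a string $x_{in}\in\{0,1\}^n$. Let $S=\{x:\langle x|\phi\rangle\ne0\}$, and let $H_S,\phi_S$ be the restrictions of $H,\phi$ to $S$. With $S^+=\{(x,y)\in S^2: x\ne y,\ \langle\phi|x\rangle\langle x|H|y\rangle\langle y|\phi\rangle>0\}$, the fixed node Hamiltonian $F$ on $\mathbb R^{S}$ has $\langle x|F|y\rangle=0$ if $(x,y)\in S^+$, $\langle x|F|y\rangle=\langle x|H|y\rangle$ if $x\neq y$ and $(x,y)\notin S^+$, and $\langle x|F|x\rangle=\langle x|H|x\rangle+\sum_{z:(x,z)\in S^+}\langle x|H|z\rangle\frac{\langle z|\phi\rangle}{\langle x|\phi\rangle}$. Put $\langle y|G|x\rangle=-\langle y|F|x\rangle\frac{\langle y|\phi\rangle}{\langle x|\phi\rangle}$. **Protocol.** Let $p',t$ be positive integers, $\delta=2^{-200p't}$, $K=\lceil 2t/\delta\rceil$, $M=2^k m n^3 t\|H\|$. For $\lambda>0$ let $\mathcal D_{K,\delta,\lambda}$ be the distribution on $\{i\delta:0\le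 i\le K\}$ with $\Pr(i\delta)=e^{-\lambda i\delta}-e^{-\lambda(i+1)\delta}$ for $i<K$ and $\Pr(K\delta)=e^{-\lambda K\delta}$. If $x_{in}\notin S$, reject. Otherwise start with $x=x_{in}$, $\tau=0$ and a transition counter equal to $0$. While $\tau<t$: reject if $C_\phi(x)$ is not represented by $p(n)$ bits; reject if $\sum_{z\in S}\langle z|G|x\rangle\ne0$ or $\langle y|G|x\rangle<0$ for some $y\in S$, $y\neq x$; reject if the counter is at least $M$; if $\langle x|G|x\rangle=0$, set $\tau=t$; otherwise add to $\tau$ a sample of $\mathcal D_{K,\delta,|\langle x|G|x\rangle|}$, replace $x$ by a random $y\in S\setminus\{x\}$ chosen with probability $\langle y|G|x\rangle/|\langle x|G|x\rangle|$, and increase the counter by $1$. When the loop ends with $\tau\ge t$, accept. **Theorem 4.** There are polynomials $p_0,t_0$ (depending only on $k,m(\cdot),B(\cdot),g(\cdot),p(\cdot),s(\cdot)$) such that for all integer-valued polynomials $p'=p'(n)\ge p_0(n)$ and $t=t(n)\ge t_0(n)$ (with natural-number coefficients) the following holds for all $n\geq 2$ and all $H$ as above. 1. *Running time.* Assume that exact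 samples of $\mathcal D_{K,\delta,\lambda}$ with $\lambda\in\mathbb Q$, and of explicitly listed finite distributions with rational weights, can be drawn in time polynomial in $n$ and the bit length of $\lambda$, respectively of the list. Then for every witness with $C_\phi$ of size at most $s(n)$ the protocol, implemented with bit-cost accounting of all its operations and with the integer $\lceil M\rceil$ given, always halts within $T(n)$ steps, where $T$ is a polynomial that does not depend on $H$ or the witness. 2. *Completeness.* If $H$ is a Yes instance, then there are a witness circuit $C_\phi$ of size at most $s(n)$ and an $x_{in}$ such that the protocol accepts with probability at least $1/2$. 3. *Soundness.* If $H$ is a No instance, then for every witness $(\phi,x_{in})$ the protocol rejects with probability at least $1-2^{-n}$. -/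

import Mathlib

open scoped ENNReal

namespace FixedNodeMC

/-! ### Bit strings, numbers, local Hamiltonians -/

/-- Computational basis states of `n` qubits. -/
abbrev BitStr (n : ℕ) : Type := Fin n → Bool

/-- The real value `q` is represented by `p` bits: it is a quotient of two integers of absolute value
at most `2 ^ p` (it suffices to test the quotient in lowest terms). -/
def FitsBits (p : ℕ) (q : ℚ) : Prop := q.num.natAbs ≤ 2 ^ p ∧ q.den ≤ 2 ^ p

instance (p : ℕ) (q : ℚ) : Decidable (FitsBits p q) := by unfold FitsBits; infer_instance

/-- A real operator acting nontrivially on at most `k` of the `n` qubits: the positions of the qubits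
(repetitions allowed) and a `2 ^ k × 2 ^ k` matrix. -/
structure LocalTerm (n k : ℕ) where
  qubits : Fin k → Fin n
  mat : Matrix (BitStr k) (BitStr k) ℚ

/-- The entry `⟨x|A|y⟩`, where `A` acts as the identity on the qubits outside the chosen positions. -/
def LocalTerm.entry {n k : ℕ} (A : LocalTerm n k) (x y : BitStr n) : ℚ :=
  if ∀ i, (∀ a, A.qubits a ≠ i) → x i = y i then
    A.mat (fun a => x (A.qubits a)) (fun a => y (A.qubits a))
  else 0

/-- The Hamiltonian `H = ∑ j, H_j - shift • 1` with `m` terms `H_j`, each acting on at most `k` qubits;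
`shift` is the claimed ground energy of `∑ j, H_j`. -/
structure Hamiltonian (n k m : ℕ) where
  terms : Fin m → LocalTerm n k
  shift : ℚ
  symm : ∀ x y, ∑ j, (terms j).entry x y = ∑ j, (terms j).entry y x

/-- The matrix of the Hamiltonian. -/
def Hamiltonian.matrix {n k m : ℕ} (H : Hamiltonian n k m) : Matrix (BitStr n) (BitStr n) ℚ :=
  fun x y => (∑ j, (H.terms j).entry x y) - if x = y then H.shift else 0

/-- The same matrix with real entries. -/
noncomputable def Hamiltonian.realMatrix {n k m : ℕ} (H : Hamiltonian n k m) :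
    Matrix (BitStr n) (BitStr n) ℝ := H.matrix.map (fun q => (q : ℝ))

/-- All the numbers describing the Hamiltonian are represented by `p` bits. -/
def Hamiltonian.FitsBits {n k m : ℕ} (H : Hamiltonian n k m) (p : ℕ) : Prop :=
  (∀ j a b, FixedNodeMC.FitsBits p ((H.terms j).mat a b)) ∧ FixedNodeMC.FitsBits p H.shift

/-- The spectral norm `‖H‖`. -/
noncomputable def Hamiltonian.opNorm {n k m : ℕ} (H : Hamiltonian n k m) : ℝ :=
  ‖Matrix.toEuclideanCLM (𝕜 := ℝ) H.realMatrix‖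

/-- The ground energy `λ(A)` of a real symmetric matrix: its least eigenvalue. -/
noncomputable def groundEnergy {ι : Type*} [Fintype ι] [DecidableEq ι] (A : Matrix ι ι ℝ) : ℝ :=
  sInf {μ : ℝ | Module.End.HasEigenvalue (Matrix.toLin' A) μ}

/-! ### Boolean circuits and succinct states -/

/-- A gate reading from `w` already computed wires. -/
inductive Gate (w : ℕ) where
  | const (b : Bool)
  | not (i : Fin w)
  | and (i j : Fin w)
  | or (i j : Fin w)

/-- The output of a gate. -/
def Gate.eval {w : ℕ} (v : Fin w → Bool) : Gate w → Bool
  | .const b => b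
  | .not i => !(v i)
  | .and i j => v i && v j
  | .or i j => v i || v j

/-- Boolean circuits with `n` input wires and `w` wires altogether (inputs and gates). -/
inductive Circuit (n : ℕ) : ℕ → Type where
  | inputs : Circuit n n
  | add {w : ℕ} (c : Circuit n w) (g : Gate w) : Circuit n (w + 1)

/-- The values on all the wires. -/
def Circuit.eval {n : ℕ} : {w : ℕ} → Circuit n w → BitStr n → (Fin w → Bool)
  | _, .inputs, x => x
  | _, .add c g, x => Fin.snoc (α := fun _ => Bool) (c.eval x) (g.eval (c.eval x))

/-- A circuit that outputs a rational number: a sign bit and the binary digits (least significant first)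
of a numerator and a denominator. -/
structure AmpCircuit (n : ℕ) where
  wires : ℕ
  circ : Circuit n wires
  sign : Fin wires
  num : List (Fin wires)
  den : List (Fin wires)

/-- The number of wires plus the number of output bits. -/
def AmpCircuit.size {n : ℕ} (C : AmpCircuit n) : ℕ := C.wires + C.num.length + C.den.length

/-- The output `C(x)`. -/
def AmpCircuit.value {n : ℕ} (C : AmpCircuit n) (x : BitStr n) : ℚ :=
  let v := C.circ.eval x
  (if v C.sign then -1 else 1) * (Nat.ofDigits 2 (C.num.map fun i => (v i).toNat) : ℚ) /
    (Nat.ofDigits 2 (C.den.map fun i => (v i).toNat) : ℚ)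

/-- The circuit `C` succinctly represents the state `ψ`: up to a common positive factor it computes the
amplitudes, exactly, with values that are represented by `p` bits. -/
def AmpCircuit.Represents {n : ℕ} (C : AmpCircuit n) (p : ℕ) (ψ : EuclideanSpace ℝ (BitStr n)) : Prop :=
  (∃ c : ℝ, 0 < c ∧ ∀ x, (C.value x : ℝ) = c * ψ x) ∧ ∀ x, FitsBits p (C.value x)

/-- Yes instance: `λ(H) = 0`, and some normalized ground state has a circuit of size at most `s` with
`p`-bit values. (The trivial Hamiltonian `H = 0` is excluded.) -/
def Hamiltonian.IsYes {n k m : ℕ} (H : Hamiltonian n k m) (p s : ℕ) : Prop :=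
  H.matrix ≠ 0 ∧ groundEnergy H.realMatrix = 0 ∧
    ∃ ψ : EuclideanSpace ℝ (BitStr n), ‖ψ‖ = 1 ∧
      Matrix.toEuclideanCLM (𝕜 := ℝ) H.realMatrix ψ = groundEnergy H.realMatrix • ψ ∧
      ∃ C : AmpCircuit n, C.size ≤ s ∧ C.Represents p ψ

/-- No instance: `λ(H) ≥ ε`. -/
def Hamiltonian.IsNo {n k m : ℕ} (H : Hamiltonian n k m) (ε : ℝ) : Prop :=
  ε ≤ groundEnergy H.realMatrix

/-! ### The fixed node Hamiltonian and the generator -/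

section FixedNode

variable {ι : Type*} [Fintype ι] [DecidableEq ι]

/-- `(x, y) ∈ S⁺`. -/
def SPlus (H : Matrix ι ι ℚ) (φ : ι → ℚ) (x y : ι) : Prop := x ≠ y ∧ 0 < φ x * H x y * φ y

instance (H : Matrix ι ι ℚ) (φ : ι → ℚ) (x y : ι) : Decidable (SPlus H φ x y) := by
  unfold SPlus; infer_instance

/-- The fixed node Hamiltonian `F^{H,φ}`. -/
def fixedNode (H : Matrix ι ι ℚ) (φ : ι → ℚ) : Matrix ι ι ℚ := fun x y =>
  if x = y then H x x + ∑ z with SPlus H φ x z, H x z * (φ z / φ x)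
  else if SPlus H φ x y then 0
  else H x y

/-- The generator `G^{H,φ}`; `generator H φ y x` is `⟨y|G|x⟩`, the rate of jumping from `x` to `y`. -/
def generator (H : Matrix ι ι ℚ) (φ : ι → ℚ) : Matrix ι ι ℚ := fun y x =>
  -(fixedNode H φ y x * (φ y / φ x))

end FixedNode

/-- The support `S` of a vector. -/
abbrev Supp {n : ℕ} (φ : BitStr n → ℚ) : Type := {x : BitStr n // φ x ≠ 0}

/-- The generator `G^{H_S,φ_S}` of the restrictions of `H` and `φ` to the support `S` of `φ`. -/
def suppGenerator {n k m : ℕ} (H : Hamiltonian n k m) (φ : BitStr n → ℚ) :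
    Matrix (Supp φ) (Supp φ) ℚ :=
  generator (H.matrix.submatrix Subtype.val Subtype.val) (fun x => φ x.1)

/-! ### The random choices -/

lemma truncExp_sum (K : ℕ) (δ lam : ℝ) (hδ : 0 ≤ δ) (hlam : 0 ≤ lam) :
    ∑ k : Fin (K + 1), ENNReal.ofReal
      (if (k : ℕ) < K then Real.exp (-(lam * k * δ)) - Real.exp (-(lam * ((k : ℕ) + 1) * δ))
        else Real.exp (-(lam * k * δ))) = 1 := by
  rw [← ENNReal.ofReal_sum_of_nonneg]
  · rw [Fin.sum_univ_castSucc]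
    have h : ∑ i : Fin K, (Real.exp (-(lam * (i : ℕ) * δ)) - Real.exp (-(lam * ((i : ℕ) + 1) * δ)))
        = 1 - Real.exp (-(lam * K * δ)) := by
      rw [Fin.sum_univ_eq_sum_range
        (fun i => Real.exp (-(lam * (i : ℕ) * δ)) - Real.exp (-(lam * ((i : ℕ) + 1) * δ))) K]
      have := Finset.sum_range_sub' (fun i : ℕ => Real.exp (-(lam * (i : ℕ) * δ))) K
      simpa using this
    simp [h]
  · intro k _
    split_ifs
    · rw [sub_nonneg, Real.exp_le_exp]
      nlinarith [mul_nonneg hlam hδ]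
    · positivity

/-- The truncated discretized exponential distribution `D_{K,δ,lam}` on `{k δ : k = 0, …, K}`; the
outcome `k` stands for the value `k δ`. -/
noncomputable def truncExp (K : ℕ) (δ lam : ℝ) (hδ : 0 ≤ δ) (hlam : 0 ≤ lam) : PMF (Fin (K + 1)) :=
  PMF.ofFintype _ (truncExp_sum K δ lam hδ hlam)

/-- The distribution with weights `w`, if these add up to one (otherwise, which does not happen in the
protocol, the point mass at `x`). -/
noncomputable def weighted {α : Type*} [Fintype α] (w : α → ℚ) (x : α) : PMF α :=
  open Classical in
  if h : ∑ y, ENNReal.ofReal (w y) = 1 then PMF.ofFintype (fun y => ENNReal.ofReal (w y)) h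
  else PMF.pure x

/-- The time unit `δ = 2 ^ (-200 p' t)`. -/
def delta (p' t : ℕ) : ℚ := (1 / 2) ^ (200 * p' * t)

lemma delta_nonneg (p' t : ℕ) : (0 : ℝ) ≤ (delta p' t : ℝ) := by
  unfold delta; push_cast; positivity

/-- The truncation `K = ⌈2 t / δ⌉`. -/
def truncK (p' t : ℕ) : ℕ := ⌈2 * (t : ℚ) / delta p' t⌉₊

/-- A sample of `D_{K,δ,|g|}`. -/
noncomputable def waitingTime (p' t : ℕ) (g : ℚ) : PMF (Fin (truncK p' t + 1)) :=
  truncExp (truncK p' t) (delta p' t) (|(g : ℝ)|) (delta_nonneg p' t) (abs_nonneg _)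

/-! ### The checking protocol -/

/-- A configuration: either the loop is about to test `τ < t`, with `m` transitions made so far, current
string `x` and current time `τ`, or the protocol has halted with a verdict (`true` for Accept). -/
inductive Config (α : Type) where
  | run (m : ℕ) (x : α) (τ : ℚ)
  | halt (verdict : Bool)

/-- The bound `M = 2 ^ k m n ^ 3 t ‖H‖` on the number of transitions. -/
noncomputable def maxTransitions {n k m : ℕ} (H : Hamiltonian n k m) (t : ℕ) : ℝ :=
  2 ^ k * m * n ^ 3 * t * H.opNorm

open Classical in
/-- One pass through the body of the loop of the checking protocol for `(H_S, φ_S)`. (The trajectory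
`ξ` is only a record of the run and is never read.) -/
noncomputable def checkStep {n k m : ℕ} (p p' t : ℕ) (H : Hamiltonian n k m) (φ : BitStr n → ℚ) :
    Config (Supp φ) → PMF (Config (Supp φ))
  | .halt b => PMF.pure (.halt b)
  | .run c x τ =>
    let G := suppGenerator H φ
    if ¬ τ < t then PMF.pure (.halt true)
    else if ¬ FitsBits p (φ x.1) then PMF.pure (.halt false)
    else if ∑ z, G z x ≠ 0 ∨ ∃ y, y ≠ x ∧ G y x < 0 then PMF.pure (.halt false)
    else if maxTransitions H t ≤ c then PMF.pure (.halt false)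
    else if |G x x| = 0 then PMF.pure (.run c x t)
    else (waitingTime p' t (G x x)).bind fun j =>
      (weighted (fun y => if y = x then 0 else G y x / |G x x|) x).bind fun y =>
        PMF.pure (.run (c + 1) y (τ + (j : ℕ) * delta p' t))

/-- `N` passes through a loop body. -/
noncomputable def iterPMF {σ : Type} (step : σ → PMF σ) : ℕ → σ → PMF σ
  | 0, c => PMF.pure c
  | N + 1, c => (step c).bind (iterPMF step N)

/-- The first configuration: Reject if `x_in` is outside of the support. -/
def checkInit {n : ℕ} (φ : BitStr n → ℚ) (xin : BitStr n) : Config (Supp φ) :=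
  if h : φ xin ≠ 0 then .run 0 ⟨xin, h⟩ 0 else .halt false

/-- The probability that the checking protocol on `(H_S, φ_S, x_in)` halts with the given verdict. -/
noncomputable def checkProb {n k m : ℕ} (p p' t : ℕ) (H : Hamiltonian n k m) (φ : BitStr n → ℚ)
    (xin : BitStr n) (verdict : Bool) : ℝ≥0∞ :=
  ⨆ N : ℕ, iterPMF (checkStep p p' t H φ) N (checkInit φ xin) (.halt verdict)

/-! ### The protocol with a step count

The same protocol written out down to arithmetic and bit operations, every one of which is charged
(logarithmic cost model): copying, comparing or changing an `n`-bit string costs `n + 1`, rational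
arithmetic (with reduction to lowest terms) is cubic in the bit lengths of the operands. -/

/-- A value together with the number of steps spent on computing it. -/
structure Timed (α : Type) where
  val : α
  steps : ℕ

instance : Monad Timed where
  pure a := ⟨a, 0⟩
  bind a f := ⟨(f a.val).val, a.steps + (f a.val).steps⟩

/-- Spend `c` steps. -/
def charge (c : ℕ) : Timed Unit := ⟨(), c⟩

/-- The bit length of a rational number. -/
def bitLen (q : ℚ) : ℕ := Nat.size q.num.natAbs + Nat.size q.den + 1

def addT (a b : ℚ) : Timed ℚ := ⟨a + b, (bitLen a + bitLen b) ^ 3⟩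
def mulT (a b : ℚ) : Timed ℚ := ⟨a * b, (bitLen a + bitLen b) ^ 3⟩
def divT (a b : ℚ) : Timed ℚ := ⟨a / b, (bitLen a + bitLen b) ^ 3⟩
def ltT (a b : ℚ) : Timed Bool := ⟨decide (a < b), (bitLen a + bitLen b) ^ 3⟩
def negT (a : ℚ) : Timed ℚ := ⟨-a, bitLen a⟩
def absT (a : ℚ) : Timed ℚ := ⟨|a|, bitLen a⟩
def isZeroT (a : ℚ) : Timed Bool := ⟨decide (a = 0), bitLen a⟩
def fitsT (p : ℕ) (a : ℚ) : Timed Bool := ⟨decide (FitsBits p a), bitLen a + p + 1⟩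
def natLeT (a b : ℕ) : Timed Bool := ⟨decide (a ≤ b), Nat.size a + Nat.size b + 1⟩
def eqStrT {n : ℕ} (x y : BitStr n) : Timed Bool := ⟨decide (x = y), n + 1⟩

/-- Evaluating a circuit: the wires one after the other, each with a scan of the table of the previous
ones; reading off the output bits; reducing the fraction. -/
def AmpCircuit.valueT {n : ℕ} (C : AmpCircuit n) (x : BitStr n) : Timed ℚ :=
  ⟨C.value x, (C.wires + 1) * (C.size + 1) + (C.num.length + C.den.length + 1) ^ 3⟩

/-- An entry of a local term: comparing the strings outside of the chosen positions, then a scan of the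
table of the `4 ^ k` entries. -/
def LocalTerm.entryT {n k : ℕ} (A : LocalTerm n k) (x y : BitStr n) : Timed ℚ :=
  ⟨A.entry x y, (n + 1) * (k + 1) + 4 ^ k * (2 * k + 1) + bitLen (A.entry x y)⟩

section Program

variable {n k m : ℕ}

/-- The sum of the entries `⟨x|H_j|y⟩` over a list of terms, added to `acc`. -/
def sumTermsT (H : Hamiltonian n k m) (x y : BitStr n) : List (Fin m) → ℚ → Timed ℚ
  | [], acc => do
    charge 1
    pure acc
  | j :: js, acc => do
    charge 1
    let a ← (H.terms j).entryT x y
    let acc' ← addT acc a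
    sumTermsT H x y js acc'

/-- The entry `⟨x|H|y⟩`. -/
def entryT (H : Hamiltonian n k m) (x y : BitStr n) : Timed ℚ := do
  let a ← sumTermsT H x y (List.finRange m) 0
  let e ← eqStrT x y
  if e then
    let s ← negT H.shift
    addT a s
  else pure a

/-- All the strings that agree with `x` outside of the listed positions. -/
def flipsT : List (Fin n) → BitStr n → Timed (List (BitStr n))
  | [], x => do
    charge (n + 1)
    pure [x]
  | i :: is, x => do
    charge (2 * (n + 1))
    let a ← flipsT is (Function.update x i false)
    let b ← flipsT is (Function.update x i true)
    charge ((a.length + 1) * (n + 1))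
    pure (a ++ b)

/-- Search in a list of strings. -/
def memT (y : BitStr n) : List (BitStr n) → Timed Bool
  | [] => do
    charge 1
    pure false
  | z :: l => do
    let e ← eqStrT y z
    if e then pure true else memT y l

/-- Add to `acc` those strings of a list that are different from `x` and not yet in `acc`. -/
def insertAllT (x : BitStr n) : List (BitStr n) → List (BitStr n) → Timed (List (BitStr n))
  | [], acc => do
    charge 1
    pure acc
  | y :: ys, acc => do
    let seen ← memT y (x :: acc)
    charge (n + 1)
    insertAllT x ys (if seen then acc else y :: acc)

/-- The strings `y ≠ x`, without repetition, that differ from `x` only on the qubits of a single one of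
the listed terms; all `y ≠ x` with `⟨x|H|y⟩ ≠ 0` are among them if all the terms are listed. -/
def neighboursT (H : Hamiltonian n k m) (x : BitStr n) :
    List (Fin m) → List (BitStr n) → Timed (List (BitStr n))
  | [], acc => do
    charge 1
    pure acc
  | j :: js, acc => do
    charge ((k + 1) * (n + 1))
    let ys ← flipsT ((List.finRange k).map (H.terms j).qubits) x
    let acc' ← insertAllT x ys acc
    neighboursT H x js acc'

/-- Run through the possible neighbours of `x`, where `a = C(x)`: `d` accumulates the diagonal entry of
the fixed node Hamiltonian, `l` collects the off-diagonal entries `(y, ⟨y|G|x⟩)` with `y ∈ S`. -/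
def columnLoopT (H : Hamiltonian n k m) (C : AmpCircuit n) (x : BitStr n) (a : ℚ) :
    List (BitStr n) → ℚ → List (BitStr n × ℚ) → Timed (ℚ × List (BitStr n × ℚ))
  | [], d, l => do
    charge 1
    pure (d, l)
  | y :: ys, d, l => do
    let b ← C.valueT y
    let z ← isZeroT b
    if z then columnLoopT H C x a ys d l
    else
      let h ← entryT H x y
      let ah ← mulT a h
      let ahb ← mulT ah b
      let plus ← ltT 0 ahb
      let ratio ← divT b a
      let q ← mulT h ratio
      if plus then
        let d' ← addT d q
        columnLoopT H C x a ys d' l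
      else
        let g ← negT q
        charge (n + 1)
        columnLoopT H C x a ys d ((y, g) :: l)

/-- Column `x` of the generator: the diagonal entry and the list of the off-diagonal entries that may
be nonzero. -/
def columnT (H : Hamiltonian n k m) (C : AmpCircuit n) (x : BitStr n) (a : ℚ) :
    Timed (ℚ × List (BitStr n × ℚ)) := do
  let ys ← neighboursT H x (List.finRange m) []
  let d ← entryT H x x
  let r ← columnLoopT H C x a ys d []
  let g ← negT r.1
  pure (g, r.2)

/-- The sum of the weights in a list, added to `acc`. -/
def sumWeightsT : List (BitStr n × ℚ) → ℚ → Timed ℚ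
  | [], acc => do
    charge 1
    pure acc
  | e :: l, acc => do
    let acc' ← addT acc e.2
    sumWeightsT l acc'

/-- Whether some weight is negative. -/
def anyNegT : List (BitStr n × ℚ) → Timed Bool
  | [] => do
    charge 1
    pure false
  | e :: l => do
    let b ← ltT e.2 0
    if b then pure true else anyNegT l

/-- Divide all weights by `c`. -/
def scaleT (c : ℚ) : List (BitStr n × ℚ) → Timed (List (BitStr n × ℚ))
  | [] => do
    charge 1
    pure []
  | e :: l => do
    let w ← divT e.2 c
    charge (n + 1)
    let l' ← scaleT c l
    pure ((e.1, w) :: l')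

/-- What the deterministic part of the loop body decides to do next. -/
inductive Action (n : ℕ) where
  | verdict (accept : Bool)
  | finish
  | jump (g : ℚ) (l : List (BitStr n × ℚ))

/-- The deterministic part of the loop body. The number `Mc` is the threshold `⌈M⌉`; since the counter
`c` is a natural number, `c ≥ M` means `c ≥ ⌈M⌉`. -/
def examineT (p t Mc : ℕ) (H : Hamiltonian n k m) (C : AmpCircuit n) (c : ℕ) (x : BitStr n) (τ : ℚ) :
    Timed (Action n) := do
  charge 1
  let going ← ltT τ t
  if going then
    let a ← C.valueT x
    let ok ← fitsT p a
    if ok then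
      let col ← columnT H C x a
      let total ← sumWeightsT col.2 col.1
      let z ← isZeroT total
      let neg ← anyNegT col.2
      if z && !neg then
        let full ← natLeT Mc c
        if full then pure (.verdict false)
        else
          let idle ← isZeroT col.1
          if idle then pure .finish
          else
            let u ← absT col.1
            let l ← scaleT u col.2
            pure (.jump u l)
      else pure (.verdict false)
    else pure (.verdict false)
  else pure (.verdict true)

/-- The total weight that a list gives to `y`. -/
def listWeight (l : List (BitStr n × ℚ)) (y : BitStr n) : ℚ :=
  (l.map fun e => if e.1 = y then e.2 else 0).sum

/-- The length of the description of a list of weighted strings. -/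
def listLen (l : List (BitStr n × ℚ)) : ℕ := (l.map fun e => n + 1 + bitLen e.2).sum

/-- The loop body with step count: the pair consists of the configuration and the steps spent so far.
A sample of a distribution given by parameters of bit length `L` costs `r (n + L)` steps, where `r` is
the polynomial running time of the sampling routines. -/
noncomputable def timedStep (r : Polynomial ℕ) (p p' t Mc : ℕ) (H : Hamiltonian n k m)
    (C : AmpCircuit n) : Config (BitStr n) × ℕ → PMF (Config (BitStr n) × ℕ)
  | (.halt b, s) => PMF.pure (.halt b, s)
  | (.run c x τ, s) =>
    let e := examineT p t Mc H C c x τ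
    match e.val with
    | .verdict b => PMF.pure (.halt b, s + e.steps)
    | .finish => PMF.pure (.run c x t, s + e.steps + bitLen t)
    | .jump g l =>
      (waitingTime p' t g).bind fun j =>
        (weighted (listWeight l) x).bind fun y =>
          let w := do
            let Δ ← mulT (j : ℕ) (delta p' t)
            charge (n + 1 + Nat.size c + 1)
            addT τ Δ
          PMF.pure (.run (c + 1) y w.val,
            s + e.steps + r.eval (n + bitLen g) + r.eval (n + listLen l) + w.steps)

/-- The initialization with step count. -/
def timedInit (p' t Mc : ℕ) (C : AmpCircuit n) (xin : BitStr n) : Config (BitStr n) × ℕ :=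
  let e : Timed Bool := do
    charge (Nat.size t + Nat.size Mc + Nat.size (truncK p' t) + bitLen (delta p' t) + n + 1)
    let a ← C.valueT xin
    isZeroT a
  (if e.val then .halt false else .run 0 xin 0, e.steps)

/-- The distribution of the configuration and the step count after `N` passes through the loop. -/
noncomputable def timedRun (r : Polynomial ℕ) (p p' t Mc : ℕ) (H : Hamiltonian n k m)
    (C : AmpCircuit n) (xin : BitStr n) (N : ℕ) : PMF (Config (BitStr n) × ℕ) :=
  iterPMF (timedStep r p p' t Mc H C) N (timedInit p' t Mc C xin)

/-- The step-counted program is an implementation of the checking protocol on the input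
`(H_S, φ_S, x_in)` (it gives each verdict with the same probability), and all its runs halt within `T`
steps. -/
def RunsWithin (T : ℕ) (r : Polynomial ℕ) (p p' t : ℕ) (H : Hamiltonian n k m) (C : AmpCircuit n)
    (xin : BitStr n) : Prop :=
  let run := timedRun r p p' t ⌈maxTransitions H t⌉₊ H C xin
  (∀ b : Bool, ⨆ N : ℕ, (run N).toOuterMeasure {o | o.1 = .halt b} =
    checkProb p p' t H C.value xin b) ∧
  (∀ N : ℕ, ∀ o ∈ (run N).support, o.2 ≤ T ∧ (T ≤ N → ∃ b, o.1 = .halt b))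

end Program

end FixedNodeMC

open FixedNodeMC

/-!
Why the protocol works, and which lemmas carry the argument.

*The program computes the right thing.* Off the diagonal, row `x` of `H` is supported on the at most
`2 ^ k m` strings listed by `neighboursT`. Hence the list computed by `columnT` is column `x` of the
generator (`columnT_val`), and forgetting the step count turns one pass of the program into one pass
of the protocol (`timedStep_map_fst`). Every pass but possibly one increases the transition counter,
so all runs end after `⌈M⌉ + 2` passes (`OnTrack`); all numbers keep polynomial bit length, measured
by `FitsBits`, so a pass has polynomial cost (`runsWithin_totalCost`).

*Supermartingales.* Both probability estimates bound the probability of a verdict by a function of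
the configuration whose expectation does not increase during a pass (`iterPMF_apply_le`). Both
functions depend on the remaining time through an exponential, and `expect_jump_le` reduces the
supermartingale property to an inequality for the discounted waiting time, which compares the
floored and truncated exponential distribution with the exact one.

*Soundness.* With weights `φ x ^ 2` the generator satisfies detailed balance, and its quadratic form
dominates that of `H` (`quadraticForm_suppGenerator_ge`: the difference is half of a sum of
squares), hence is at least `ε`. Let `A` be the set of strings that pass the tests. For the chain
killed outside of `A` there is a function `f ≥ 1` on `A`, of size at most exponential in `n` and the
number of bits, that decays at rate `ε / 2`: it is `1` plus the solution of a linear system whose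
matrix has nonpositive off-diagonal entries and positive definite quadratic form, and thus a
nonnegative inverse (`exists_superharmonic`). So the acceptance probability is at most `exp (-ε t /
2) f x`.

*Completeness.* If `H φ = 0` the columns of the generator add up to zero and `φ ^ 2` is a stationary
measure with mean jump rate at most `2 ^ k m ‖H‖` (`sum_sq_mul_abs_suppGenerator_le`). The Laplace
transform at `s = 1 / t` of the time of the `N`-th jump then has stationary mean at most `t / N`
times that rate (`mul_sum_laplace_le`). With `N = ⌈M⌉` this is at most `1 / n ^ 3 ≤ 1 / 8`, and
flooring the waiting times costs a factor at most `exp (N δ / t)`. Some starting string does at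
least as well as the average.
-/

namespace FixedNodeMC

/-! ### Values computed by the step-counted program -/

section Values

variable {n k m : ℕ}

@[simp] lemma Timed.val_bind {α β : Type} (a : Timed α) (f : α → Timed β) :
    (a >>= f).val = (f a.val).val := rfl

@[simp] lemma Timed.steps_bind {α β : Type} (a : Timed α) (f : α → Timed β) :
    (a >>= f).steps = a.steps + (f a.val).steps := rfl

@[simp] lemma Timed.val_pure {α : Type} (a : α) : (pure a : Timed α).val = a := rfl

@[simp] lemma Timed.steps_pure {α : Type} (a : α) : (pure a : Timed α).steps = 0 := rfl

@[simp] lemma charge_steps (c : ℕ) : (charge c).steps = c := rfl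

lemma Hamiltonian.matrix_symm (H : Hamiltonian n k m) (x y : BitStr n) :
    H.matrix x y = H.matrix y x := by
  simp only [Hamiltonian.matrix, H.symm x y, eq_comm]

lemma sumTermsT_val (H : Hamiltonian n k m) (x y : BitStr n) (js : List (Fin m)) (acc : ℚ) :
    (sumTermsT H x y js acc).val = acc + (js.map fun j => (H.terms j).entry x y).sum := by
  induction js generalizing acc with
  | nil => simp [sumTermsT]
  | cons j js ih => simp [sumTermsT, ih, addT, LocalTerm.entryT, add_assoc]

lemma entryT_val (H : Hamiltonian n k m) (x y : BitStr n) :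
    (entryT H x y).val = H.matrix x y := by
  by_cases h : x = y <;>
    simp [entryT, eqStrT, sumTermsT_val, Hamiltonian.matrix, Fin.sum_univ_def, h, addT, negT,
      sub_eq_add_neg]

lemma mem_flipsT (L : List (Fin n)) (x y : BitStr n) :
    y ∈ (flipsT L x).val ↔ ∀ i, i ∉ L → y i = x i := by
  induction L generalizing x with
  | nil => simp [flipsT, funext_iff]
  | cons i L ih =>
    simp only [flipsT, Timed.val_bind, Timed.val_pure, List.mem_append, ih, List.mem_cons, not_or]
    constructor
    · rintro (h | h) j ⟨hj, hjL⟩ <;> simpa [hj] using h j hjL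
    · intro h
      have key : ∀ j, j ∉ L → y j = Function.update x i (y i) j := by
        intro j hj
        by_cases hji : j = i
        · subst hji; simp
        · simpa [hji] using h j ⟨hji, hj⟩
      cases hy : y i
      · left; simpa [hy] using key
      · right; simpa [hy] using key

lemma length_flipsT (L : List (Fin n)) (x : BitStr n) :
    (flipsT L x).val.length = 2 ^ L.length := by
  induction L generalizing x with
  | nil => simp [flipsT]
  | cons i L ih => simp [flipsT, ih, pow_succ]; ring

lemma memT_val (y : BitStr n) (l : List (BitStr n)) : (memT y l).val = decide (y ∈ l) := by
  induction l with
  | nil => simp [memT]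
  | cons z l ih => by_cases h : y = z <;> simp [memT, eqStrT, h, ih]

lemma mem_insertAllT (x y : BitStr n) (ys acc : List (BitStr n)) :
    y ∈ (insertAllT x ys acc).val ↔ y ∈ acc ∨ (y ∈ ys ∧ y ≠ x) := by
  induction ys generalizing acc with
  | nil => simp [insertAllT]
  | cons z ys ih =>
    simp only [insertAllT, Timed.val_bind, memT_val, ih, List.mem_cons]
    by_cases hz : z = x ∨ z ∈ acc
    · simp only [hz, decide_true, if_true]
      constructor
      · rintro (h | h) <;> tauto
      · rintro (h | ⟨rfl | h, h'⟩) <;> tauto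
    · simp only [hz, decide_false, Bool.false_eq_true, if_false, List.mem_cons]
      constructor
      · rintro ((rfl | h) | h) <;> tauto
      · rintro (h | ⟨rfl | h, h'⟩) <;> tauto

lemma nodup_insertAllT (x : BitStr n) (ys acc : List (BitStr n)) (h : acc.Nodup) :
    (insertAllT x ys acc).val.Nodup := by
  induction ys generalizing acc with
  | nil => simpa [insertAllT]
  | cons z ys ih =>
    simp only [insertAllT, Timed.val_bind, memT_val]
    apply ih
    by_cases hz : z ∈ x :: acc
    · simpa [hz] using h
    · have hz' := hz
      simp only [List.mem_cons, not_or] at hz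
      simp only [hz', decide_false, Bool.false_eq_true, if_false, List.nodup_cons]
      exact ⟨hz.2, h⟩

lemma length_insertAllT (x : BitStr n) (ys acc : List (BitStr n)) :
    (insertAllT x ys acc).val.length ≤ acc.length + ys.length := by
  induction ys generalizing acc with
  | nil => simp [insertAllT]
  | cons z ys ih =>
    simp only [insertAllT, Timed.val_bind]
    refine (ih _).trans ?_
    split_ifs
    · simp
    · simp; omega

lemma mem_neighboursT (H : Hamiltonian n k m) (x y : BitStr n) (js : List (Fin m))
    (acc : List (BitStr n)) :
    y ∈ (neighboursT H x js acc).val ↔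
      y ∈ acc ∨ (y ≠ x ∧ ∃ j ∈ js, ∀ i, (∀ a, (H.terms j).qubits a ≠ i) → y i = x i) := by
  induction js generalizing acc with
  | nil => simp [neighboursT]
  | cons j js ih =>
    simp only [neighboursT, Timed.val_bind, ih, mem_insertAllT, mem_flipsT, List.mem_map,
      List.mem_finRange, true_and, not_exists, List.mem_cons, exists_eq_or_imp]
    tauto

lemma nodup_neighboursT (H : Hamiltonian n k m) (x : BitStr n) (js : List (Fin m))
    (acc : List (BitStr n)) (h : acc.Nodup) : (neighboursT H x js acc).val.Nodup := by
  induction js generalizing acc with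
  | nil => simpa [neighboursT]
  | cons j js ih =>
    simp only [neighboursT, Timed.val_bind]
    exact ih _ (nodup_insertAllT _ _ _ h)

lemma length_neighboursT (H : Hamiltonian n k m) (x : BitStr n) (js : List (Fin m))
    (acc : List (BitStr n)) :
    (neighboursT H x js acc).val.length ≤ acc.length + js.length * 2 ^ k := by
  induction js generalizing acc with
  | nil => simp [neighboursT]
  | cons j js ih =>
    simp only [neighboursT, Timed.val_bind]
    refine (ih _).trans ?_
    have := length_insertAllT x
      (flipsT ((List.finRange k).map (H.terms j).qubits) x).val acc
    rw [length_flipsT] at this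
    simp only [List.length_map, List.length_finRange] at this
    simp only [List.length_cons, Nat.succ_mul]
    omega

/-- The strings `y ≠ x` that can have a nonzero matrix entry `⟨x|H|y⟩`. -/
def neighbours (H : Hamiltonian n k m) (x : BitStr n) : List (BitStr n) :=
  (neighboursT H x (List.finRange m) []).val

lemma nodup_neighbours (H : Hamiltonian n k m) (x : BitStr n) : (neighbours H x).Nodup :=
  nodup_neighboursT _ _ _ _ List.nodup_nil

lemma length_neighbours (H : Hamiltonian n k m) (x : BitStr n) :
    (neighbours H x).length ≤ m * 2 ^ k := by
  simpa [neighbours] using length_neighboursT H x (List.finRange m) []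

lemma self_notMem_neighbours (H : Hamiltonian n k m) (x : BitStr n) : x ∉ neighbours H x := by
  simp [neighbours, mem_neighboursT]

lemma matrix_eq_zero_of_notMem_neighbours (H : Hamiltonian n k m) {x y : BitStr n} (hxy : y ≠ x)
    (hy : y ∉ neighbours H x) : H.matrix x y = 0 := by
  simp only [neighbours, mem_neighboursT, List.not_mem_nil, false_or, List.mem_finRange, true_and,
    not_and, not_exists] at hy
  have h := hy hxy
  simp only [Hamiltonian.matrix, hxy.symm, if_false, sub_zero]
  refine Finset.sum_eq_zero fun j _ => ?_
  rw [LocalTerm.entry, if_neg]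
  exact fun h' => h j fun i hi => (h' i hi).symm

/-- The rate `⟨y|G|x⟩` for `y ≠ x`, as a function on all strings `y` (it vanishes when `φ y = 0`). -/
def rate (H : Hamiltonian n k m) (φ : BitStr n → ℚ) (x y : BitStr n) : ℚ :=
  if 0 < φ x * H.matrix x y * φ y then 0 else -(H.matrix x y * (φ y / φ x))

lemma rate_nonneg (H : Hamiltonian n k m) (φ : BitStr n → ℚ) (x y : BitStr n) :
    0 ≤ rate H φ x y := by
  unfold rate
  split_ifs with h
  · exact le_rfl
  · by_cases hx : φ x = 0
    · simp [hx]
    have : H.matrix x y * (φ y / φ x) = φ x * H.matrix x y * φ y / φ x ^ 2 := by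
      field_simp
    rw [this, Left.nonneg_neg_iff]
    exact div_nonpos_of_nonpos_of_nonneg (not_lt.1 h) (by positivity)

lemma rate_eq_zero_of_notMem_neighbours (H : Hamiltonian n k m) (φ : BitStr n → ℚ)
    {x y : BitStr n} (hxy : y ≠ x) (hy : y ∉ neighbours H x) : rate H φ x y = 0 := by
  simp [rate, matrix_eq_zero_of_notMem_neighbours H hxy hy]

lemma suppGenerator_of_ne (H : Hamiltonian n k m) (φ : BitStr n → ℚ) {x y : Supp φ}
    (hxy : y ≠ x) : suppGenerator H φ y x = rate H φ x.1 y.1 := by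
  have hs : SPlus (H.matrix.submatrix (Subtype.val : Supp φ → _) Subtype.val)
      (fun x => φ x.1) y x ↔ 0 < φ x.1 * H.matrix x.1 y.1 * φ y.1 := by
    simp only [SPlus, ne_eq, hxy, not_false_eq_true, true_and, Matrix.submatrix_apply]
    rw [H.matrix_symm y.1 x.1, show φ y.1 * H.matrix x.1 y.1 * φ x.1 =
      φ x.1 * H.matrix x.1 y.1 * φ y.1 by ring]
  simp only [suppGenerator, generator, fixedNode, hxy, if_false, hs, rate, Matrix.submatrix_apply]
  rw [H.matrix_symm y.1 x.1]
  split_ifs <;> simp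

lemma sum_supp {M : Type*} [AddCommMonoid M] {φ : BitStr n → ℚ} {f : BitStr n → M}
    (hf : ∀ x, φ x = 0 → f x = 0) :
    ∑ x : Supp φ, f x.1 = ∑ x, f x := by
  rw [← Finset.sum_subset (Finset.subset_univ ({x | φ x ≠ 0} : Finset (BitStr n)))]
  · exact (Finset.sum_subtype ({x | φ x ≠ 0} : Finset (BitStr n)) (by simp) f).symm
  · intro z _ hz
    exact hf z (by simpa using hz)

lemma suppGenerator_self (H : Hamiltonian n k m) (φ : BitStr n → ℚ) (x : Supp φ) :
    suppGenerator H φ x x = -(H.matrix x.1 x.1 + ((neighbours H x.1).map fun y =>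
      if 0 < φ x.1 * H.matrix x.1 y * φ y then H.matrix x.1 y * (φ y / φ x.1) else 0).sum) := by
  have hx := x.2
  simp only [suppGenerator, generator, fixedNode, if_true, Matrix.submatrix_apply, div_self hx,
    mul_one]
  congr 2
  rw [← List.sum_toFinset _ (nodup_neighbours H x.1), Finset.sum_filter]
  let f : BitStr n → ℚ := fun y => if y ≠ x.1 ∧ 0 < φ x.1 * H.matrix x.1 y * φ y then
      H.matrix x.1 y * (φ y / φ x.1) else 0
  have h1 : ∑ z : Supp φ, f z.1 = ∑ z, f z := sum_supp fun z hz => by simp [f, hz]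
  have h2 : ∑ y ∈ (neighbours H x.1).toFinset, (if 0 < φ x.1 * H.matrix x.1 y * φ y then
      H.matrix x.1 y * (φ y / φ x.1) else 0) = ∑ z, f z := by
    rw [← Finset.sum_subset (Finset.subset_univ (neighbours H x.1).toFinset)]
    · refine Finset.sum_congr rfl fun y hy => ?_
      have hyx : y ≠ x.1 := by
        rintro rfl
        exact self_notMem_neighbours H _ (List.mem_toFinset.1 hy)
      simp [f, hyx]
    · intro z _ hz
      by_cases hzx : z = x.1
      · simp [f, hzx]
      · simp [f, matrix_eq_zero_of_notMem_neighbours H hzx (by simpa using hz)]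
  rw [h2, ← h1]
  refine Finset.sum_congr rfl fun z _ => ?_
  have : SPlus (H.matrix.submatrix (Subtype.val : Supp φ → _) Subtype.val) (fun x => φ x.1) x z ↔
      z.1 ≠ x.1 ∧ 0 < φ x.1 * H.matrix x.1 z.1 * φ z.1 := by
    simp only [SPlus, Matrix.submatrix_apply]
    rw [ne_comm, ne_eq, ne_eq, Subtype.ext_iff]
  simp only [this, f]

lemma suppGenerator_nonneg (H : Hamiltonian n k m) (φ : BitStr n → ℚ) {x y : Supp φ}
    (hxy : y ≠ x) : 0 ≤ suppGenerator H φ y x := by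
  rw [suppGenerator_of_ne H φ hxy]; exact rate_nonneg _ _ _ _

lemma columnLoopT_val (H : Hamiltonian n k m) (C : AmpCircuit n) (x : BitStr n)
    (ys : List (BitStr n)) (d : ℚ) (l : List (BitStr n × ℚ)) :
    (columnLoopT H C x (C.value x) ys d l).val =
      (d + (ys.map fun y => if 0 < C.value x * H.matrix x y * C.value y then
          H.matrix x y * (C.value y / C.value x) else 0).sum,
        ((ys.filter fun y => C.value y ≠ 0 ∧ ¬ 0 < C.value x * H.matrix x y * C.value y).map
          fun y => (y, rate H C.value x y)).reverse ++ l) := by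
  induction ys generalizing d l with
  | nil => simp [columnLoopT]
  | cons y ys ih =>
    by_cases hy : C.value y = 0
    · simp [columnLoopT, AmpCircuit.valueT, isZeroT, hy, ih]
    by_cases hp : 0 < C.value x * H.matrix x y * C.value y
    · simp [columnLoopT, AmpCircuit.valueT, isZeroT, hy, ih, mulT, ltT, divT, addT, entryT_val, hp,
        add_assoc]
    · simp [columnLoopT, AmpCircuit.valueT, isZeroT, hy, ih, mulT, ltT, divT, negT, entryT_val, hp,
        rate, not_lt.1 hp]

/-- The list of weighted strings that the program computes for column `x` of the generator. -/
def columnList (H : Hamiltonian n k m) (φ : BitStr n → ℚ) (x : BitStr n) :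
    List (BitStr n × ℚ) :=
  (((neighbours H x).filter fun y => φ y ≠ 0 ∧ ¬ 0 < φ x * H.matrix x y * φ y).map
    fun y => (y, rate H φ x y)).reverse

lemma columnT_val (H : Hamiltonian n k m) (C : AmpCircuit n) (x : Supp C.value) :
    (columnT H C x.1 (C.value x.1)).val =
      (suppGenerator H C.value x x, columnList H C.value x.1) := by
  simp only [columnT, Timed.val_bind, Timed.val_pure, columnLoopT_val, entryT_val, negT,
    List.append_nil, suppGenerator_self]
  rfl

lemma listWeight_columnList (H : Hamiltonian n k m) (φ : BitStr n → ℚ) (x y : BitStr n) :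
    listWeight (columnList H φ x) y = if y = x then 0 else rate H φ x y := by
  have h0 : ¬ (φ y ≠ 0 ∧ ¬ 0 < φ x * H.matrix x y * φ y) → rate H φ x y = 0 := by
    intro h
    by_cases hy : φ y = 0
    · simp [rate, hy]
    · have : 0 < φ x * H.matrix x y * φ y := by tauto
      simp [rate, this]
  rw [listWeight, columnList, List.map_reverse, List.sum_reverse, List.map_map]
  set L := (neighbours H x).filter fun y => φ y ≠ 0 ∧ ¬ 0 < φ x * H.matrix x y * φ y with hL
  have hnd : L.Nodup := (nodup_neighbours H x).filter _
  rw [← List.sum_toFinset _ hnd]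
  simp only [Function.comp_apply, Finset.sum_ite_eq', List.mem_toFinset]
  by_cases hyx : y = x
  · have : y ∉ L := by
      rw [hL, List.mem_filter, hyx]
      exact fun h => self_notMem_neighbours H x h.1
    simp [hyx] at this ⊢
    exact fun h => absurd h this
  · rw [if_neg hyx]
    split_ifs with hy
    · rfl
    · rw [hL, List.mem_filter, not_and_or] at hy
      rcases hy with hy | hy
      · exact (rate_eq_zero_of_notMem_neighbours H φ hyx hy).symm
      · exact (h0 (by simpa using hy)).symm

lemma sum_listWeight (l : List (BitStr n × ℚ)) :
    ∑ y, listWeight l y = (l.map Prod.snd).sum := by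
  induction l with
  | nil => simp [listWeight]
  | cons e l ih =>
    have : ∀ y, listWeight (e :: l) y = (if e.1 = y then e.2 else 0) + listWeight l y := by
      simp [listWeight]
    simp [this, Finset.sum_add_distrib, ih]

lemma sum_rate_eq_sum_supp (H : Hamiltonian n k m) (φ : BitStr n → ℚ) (x : Supp φ) :
    ∑ y, (if y = x.1 then 0 else rate H φ x.1 y) =
      ∑ y : Supp φ, if y = x then 0 else suppGenerator H φ y x := by
  have h1 := sum_supp (φ := φ) (f := fun y => if y = x.1 then 0 else rate H φ x.1 y)
    fun z hz => by simp [rate, hz]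
  rw [← h1]
  refine Finset.sum_congr rfl fun y _ => ?_
  by_cases h : y = x
  · simp [h]
  · rw [if_neg h, suppGenerator_of_ne H φ h, if_neg (fun h' => h (Subtype.ext h'))]

lemma sumWeightsT_val (l : List (BitStr n × ℚ)) (acc : ℚ) :
    (sumWeightsT l acc).val = acc + (l.map Prod.snd).sum := by
  induction l generalizing acc with
  | nil => simp [sumWeightsT]
  | cons e l ih => simp [sumWeightsT, ih, addT, add_assoc]

lemma anyNegT_val (l : List (BitStr n × ℚ)) : (anyNegT l).val = decide (∃ e ∈ l, e.2 < 0) := by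
  induction l with
  | nil => simp [anyNegT]
  | cons e l ih => by_cases h : e.2 < 0 <;> simp [anyNegT, ltT, h, ih]

lemma scaleT_val (c : ℚ) (l : List (BitStr n × ℚ)) :
    (scaleT c l).val = l.map fun e => (e.1, e.2 / c) := by
  induction l with
  | nil => simp [scaleT]
  | cons e l ih => simp [scaleT, divT, ih]

lemma listWeight_scale (c : ℚ) (l : List (BitStr n × ℚ)) (y : BitStr n) :
    listWeight (l.map fun e => (e.1, e.2 / c)) y = listWeight l y / c := by
  induction l with
  | nil => simp [listWeight]
  | cons e l ih =>
    simp only [listWeight, List.map_cons, List.sum_cons] at ih ⊢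
    rw [ih, add_div]
    congr 1
    split_ifs <;> simp

lemma sum_suppGenerator (H : Hamiltonian n k m) (φ : BitStr n → ℚ) (x : Supp φ) :
    ∑ z, suppGenerator H φ z x =
      suppGenerator H φ x x + ((columnList H φ x.1).map Prod.snd).sum := by
  rw [← sum_listWeight]
  simp only [listWeight_columnList, sum_rate_eq_sum_supp]
  rw [← Finset.add_sum_erase _ _ (Finset.mem_univ x)]
  congr 1
  rw [← Finset.sum_erase_add _ _ (Finset.mem_univ x)]
  simp only [if_true, add_zero]
  exact Finset.sum_congr rfl fun z hz => by rw [if_neg (Finset.ne_of_mem_erase hz)]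

/-- The list of normalized jump probabilities out of `x`. -/
def jumpList (H : Hamiltonian n k m) (φ : BitStr n → ℚ) (x : Supp φ) : List (BitStr n × ℚ) :=
  (columnList H φ x.1).map fun e => (e.1, e.2 / |suppGenerator H φ x x|)

open Classical in
/-- The decisions of the program are those of the protocol. -/
lemma examineT_val (p t Mc : ℕ) (H : Hamiltonian n k m) (C : AmpCircuit n) (c : ℕ)
    (x : Supp C.value) (τ : ℚ) :
    (examineT p t Mc H C c x.1 τ).val =
      if ¬ τ < t then .verdict true
      else if ¬ FitsBits p (C.value x.1) then .verdict false
      else if ∑ z, suppGenerator H C.value z x ≠ 0 ∨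
          ∃ y, y ≠ x ∧ suppGenerator H C.value y x < 0 then .verdict false
      else if Mc ≤ c then .verdict false
      else if |suppGenerator H C.value x x| = 0 then .finish
      else .jump |suppGenerator H C.value x x| (jumpList H C.value x) := by
  have hneg : ¬ ∃ y, y ≠ x ∧ suppGenerator H C.value y x < 0 := by
    rintro ⟨y, hy, h⟩
    exact absurd (suppGenerator_nonneg H C.value hy) (not_le.2 h)
  have hany : ¬ ∃ e ∈ columnList H C.value x.1, e.2 < 0 := by
    rintro ⟨e, he, h⟩
    simp only [columnList, List.mem_reverse, List.mem_map] at he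
    obtain ⟨y, -, rfl⟩ := he
    exact absurd (rate_nonneg H C.value x.1 y) (not_le.2 h)
  rw [sum_suppGenerator]
  simp only [hneg, or_false]
  by_cases h1 : τ < t
  swap
  · simp [examineT, ltT, h1]
  by_cases h2 : FitsBits p (C.value x.1)
  swap
  · simp [examineT, ltT, h1, fitsT, AmpCircuit.valueT, h2]
  by_cases h3 : suppGenerator H C.value x x + ((columnList H C.value x.1).map Prod.snd).sum = 0
  swap
  · simp [examineT, ltT, h1, fitsT, AmpCircuit.valueT, h2, columnT_val, sumWeightsT_val, isZeroT,
      h3]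
  by_cases h4 : Mc ≤ c
  · simp [examineT, ltT, h1, fitsT, AmpCircuit.valueT, h2, columnT_val, sumWeightsT_val, isZeroT,
      anyNegT_val, h3, natLeT, h4, -not_exists, hany]
  by_cases h5 : suppGenerator H C.value x x = 0
  · simp only [h5, zero_add] at h3
    simp [examineT, ltT, h1, fitsT, AmpCircuit.valueT, h2, columnT_val, sumWeightsT_val, isZeroT,
      anyNegT_val, h3, natLeT, h4, -not_exists, hany, h5]
  · simp [examineT, ltT, h1, fitsT, AmpCircuit.valueT, h2, columnT_val, sumWeightsT_val, isZeroT,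
      anyNegT_val, h3, natLeT, h4, -not_exists, hany, h5, absT, scaleT_val, jumpList]

lemma listWeight_jumpList (H : Hamiltonian n k m) (φ : BitStr n → ℚ) (x : Supp φ)
    (y : BitStr n) :
    listWeight (jumpList H φ x) y =
      (if y = x.1 then 0 else rate H φ x.1 y) / |suppGenerator H φ x x| := by
  rw [jumpList, listWeight_scale, listWeight_columnList]

end Values

/-! ### Bit lengths -/

lemma FitsBits.mono {p p' : ℕ} {q : ℚ} (h : FitsBits p q) (hp : p ≤ p') : FitsBits p' q :=
  ⟨h.1.trans (Nat.pow_le_pow_right two_pos hp), h.2.trans (Nat.pow_le_pow_right two_pos hp)⟩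

lemma fitsBits_div_int {p : ℕ} (a b : ℤ) (hb : b ≠ 0) (ha : a.natAbs ≤ 2 ^ p)
    (hb' : b.natAbs ≤ 2 ^ p) : FitsBits p ((a : ℚ) / b) := by
  rw [← Rat.divInt_eq_div]
  rcases eq_or_ne a 0 with rfl | ha0
  · constructor <;> simp [Nat.one_le_two_pow]
  · refine ⟨(Nat.le_of_dvd (Int.natAbs_pos.2 ha0)
      (Int.natAbs_dvd_natAbs.2 (Rat.num_dvd a hb))).trans ha, ?_⟩
    have h := Int.natAbs_dvd_natAbs.2 (Rat.den_dvd a b)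
    rw [Int.natAbs_natCast] at h
    exact (Nat.le_of_dvd (Int.natAbs_pos.2 hb) h).trans hb'

lemma fitsBits_zero (p : ℕ) : FitsBits p 0 := by
  constructor <;> simp [Nat.one_le_two_pow]

lemma fitsBits_natCast {p a : ℕ} (h : a ≤ 2 ^ p) : FitsBits p (a : ℚ) := by
  constructor <;> simp [h, Nat.one_le_two_pow]

lemma FitsBits.add {p q : ℕ} {a b : ℚ} (ha : FitsBits p a) (hb : FitsBits q b) :
    FitsBits (p + q + 1) (a + b) := by
  have h : a + b = ((a.num * b.den + b.num * a.den : ℤ) : ℚ) / ((a.den * b.den : ℤ) : ℚ) := by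
    push_cast
    conv_lhs => rw [← Rat.num_div_den a, ← Rat.num_div_den b]
    have := a.den_ne_zero
    have := b.den_ne_zero
    field_simp
  rw [h]
  have h1 : a.den * b.den ≤ 2 ^ (p + q) := by rw [pow_add]; exact Nat.mul_le_mul ha.2 hb.2
  refine fitsBits_div_int _ _ (by simp) ?_ ?_
  · refine (Int.natAbs_add_le _ _).trans ?_
    rw [Int.natAbs_mul, Int.natAbs_mul, Int.natAbs_natCast, Int.natAbs_natCast, pow_succ, pow_add]
    have h2 := Nat.mul_le_mul ha.1 hb.2
    have h3 := Nat.mul_le_mul hb.1 ha.2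
    rw [mul_comm (2 ^ q)] at h3
    omega
  · rw [Int.natAbs_mul, Int.natAbs_natCast, Int.natAbs_natCast]
    exact h1.trans (Nat.pow_le_pow_right two_pos (by omega))

lemma FitsBits.mul {p q : ℕ} {a b : ℚ} (ha : FitsBits p a) (hb : FitsBits q b) :
    FitsBits (p + q) (a * b) := by
  have h : a * b = ((a.num * b.num : ℤ) : ℚ) / ((a.den * b.den : ℤ) : ℚ) := by
    push_cast
    conv_lhs => rw [← Rat.num_div_den a, ← Rat.num_div_den b]
    field_simp
  rw [h]
  refine fitsBits_div_int _ _ (by simp) ?_ ?_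
  · rw [Int.natAbs_mul, pow_add]; exact Nat.mul_le_mul ha.1 hb.1
  · rw [Int.natAbs_mul, Int.natAbs_natCast, Int.natAbs_natCast, pow_add]
    exact Nat.mul_le_mul ha.2 hb.2

lemma FitsBits.inv {p : ℕ} {a : ℚ} (ha : FitsBits p a) : FitsBits p a⁻¹ := by
  rcases eq_or_ne a 0 with rfl | h0
  · simpa using ha
  · have h : a⁻¹ = ((a.den : ℤ) : ℚ) / ((a.num : ℤ) : ℚ) := by
      conv_lhs => rw [← Rat.num_div_den a]
      simp
    rw [h]
    exact fitsBits_div_int _ _ (Rat.num_ne_zero.2 h0) (by simpa using ha.2) ha.1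

lemma FitsBits.div {p q : ℕ} {a b : ℚ} (ha : FitsBits p a) (hb : FitsBits q b) :
    FitsBits (p + q) (a / b) := by
  rw [div_eq_mul_inv]; exact ha.mul hb.inv

lemma FitsBits.neg {p : ℕ} {a : ℚ} (ha : FitsBits p a) : FitsBits p (-a) := by
  simpa [FitsBits] using ha

lemma FitsBits.abs {p : ℕ} {a : ℚ} (ha : FitsBits p a) : FitsBits p |a| := by
  rcases abs_choice a with h | h <;> rw [h]
  · exact ha
  · exact ha.neg

lemma FitsBits.list_sum {p q : ℕ} {l : List ℚ} (hl : ∀ a ∈ l, FitsBits p a) {b : ℚ}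
    (hb : FitsBits q b) : FitsBits (q + l.length * (p + 1)) (b + l.sum) := by
  induction l generalizing b q with
  | nil => simpa using hb
  | cons a l ih =>
    have := ih (fun c hc => hl c (List.mem_cons_of_mem _ hc))
      (hb.add (hl a List.mem_cons_self))
    rw [List.sum_cons, ← add_assoc]
    exact this.mono (by rw [List.length_cons, Nat.succ_mul]; omega)

lemma FitsBits.bitLen_le {p : ℕ} {a : ℚ} (ha : FitsBits p a) : bitLen a ≤ 2 * p + 3 := by
  have h1 : Nat.size a.num.natAbs ≤ p + 1 := Nat.size_le.2 (ha.1.trans_lt (by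
    rw [pow_succ]; have := Nat.two_pow_pos p; omega))
  have h2 : Nat.size a.den ≤ p + 1 := Nat.size_le.2 (ha.2.trans_lt (by
    rw [pow_succ]; have := Nat.two_pow_pos p; omega))
  unfold bitLen
  omega

lemma FitsBits.abs_le {p : ℕ} {a : ℚ} (ha : FitsBits p a) : |a| ≤ 2 ^ p := by
  rw [← Rat.num_div_den a, abs_div, Nat.abs_cast]
  have h1 : |(a.num : ℚ)| ≤ 2 ^ p := by
    rw [← Int.cast_abs, Int.abs_eq_natAbs]; exact_mod_cast ha.1
  have h2 : (1 : ℚ) ≤ a.den := by exact_mod_cast a.pos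
  exact (div_le_self (abs_nonneg _) h2).trans h1

lemma fitsBits_value {n : ℕ} (C : AmpCircuit n) (x : BitStr n) : FitsBits C.size (C.value x) := by
  have key : ∀ l : List (Fin C.wires),
      Nat.ofDigits 2 (l.map fun i => (C.circ.eval x i).toNat) ≤ 2 ^ l.length := by
    intro l
    have := Nat.ofDigits_lt_base_pow_length (b := 2)
      (l := l.map fun i => (C.circ.eval x i).toNat) (by norm_num) (by
        intro a ha
        obtain ⟨i, -, rfl⟩ := List.mem_map.1 ha
        exact Bool.toNat_lt _)
    simpa using this.le
  have hmono : ∀ l : List (Fin C.wires), l.length ≤ C.size →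
      Nat.ofDigits 2 (l.map fun i => (C.circ.eval x i).toNat) ≤ 2 ^ C.size :=
    fun l hl => (key l).trans (Nat.pow_le_pow_right two_pos hl)
  have hs : FitsBits 0 (if C.circ.eval x C.sign then (-1 : ℚ) else 1) := by
    split_ifs <;> constructor <;> simp
  have hnum := fitsBits_natCast (hmono C.num (by unfold AmpCircuit.size; omega))
  have hden := hmono C.den (by unfold AmpCircuit.size; omega)
  have hcast : ∀ l : List ℕ, Nat.ofDigits (2 : ℚ) l = (Nat.ofDigits 2 l : ℕ) := by
    intro l; simp [Nat.coe_ofDigits]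
  simp only [AmpCircuit.value]
  rw [mul_div_assoc, hcast, hcast]
  refine (hs.mul (q := C.size) ?_).mono (by omega)
  generalize Nat.ofDigits 2 (C.den.map fun i => (C.circ.eval x i).toNat) = b at hden
  generalize ha : Nat.ofDigits 2 (C.num.map fun i => (C.circ.eval x i).toNat) = a at hnum
  rcases eq_or_ne b 0 with rfl | hb
  · simpa using fitsBits_zero _
  · exact fitsBits_div_int (a : ℤ) (b : ℤ) (by exact_mod_cast hb)
      (by simpa [ha] using hmono C.num (by unfold AmpCircuit.size; omega)) (by simpa using hden)

/-! ### Step counts of the deterministic part -/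

section Costs

variable {n k m : ℕ}

/-- A bound for the cost of one arithmetic operation on `b`-bit numbers. -/
def opCost (b : ℕ) : ℕ := (4 * b + 6) ^ 3

lemma opCost_bound {b : ℕ} {x y : ℚ} (hx : FitsBits b x) (hy : FitsBits b y) :
    (bitLen x + bitLen y) ^ 3 ≤ opCost b := by
  have h1 := hx.bitLen_le
  have h2 := hy.bitLen_le
  exact Nat.pow_le_pow_left (by omega) 3

lemma bitLen_le_opCost {b : ℕ} {x : ℚ} (hx : FitsBits b x) : bitLen x ≤ opCost b := by
  have h1 := hx.bitLen_le
  have h2 : 4 * b + 6 ≤ (4 * b + 6) ^ 3 := Nat.le_self_pow (by norm_num) _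
  unfold opCost
  omega

lemma LocalTerm.fitsBits_entry {A : LocalTerm n k} {p : ℕ} (hA : ∀ a b, FitsBits p (A.mat a b))
    (x y : BitStr n) : FitsBits p (A.entry x y) := by
  unfold LocalTerm.entry
  split_ifs
  · exact hA _ _
  · exact fitsBits_zero _

/-- A bound for the cost of one entry of a local term. -/
def localEntryCost (n k p : ℕ) : ℕ := (n + 1) * (k + 1) + 4 ^ k * (2 * k + 1) + (2 * p + 3)

/-- A bound for the cost of one entry of the Hamiltonian. -/
def entryCost (n k m p b : ℕ) : ℕ :=
  m * (1 + localEntryCost n k p + opCost b) + 1 + (n + 1) + 2 * opCost b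

lemma sumTermsT_steps {H : Hamiltonian n k m} {p : ℕ} (hH : H.FitsBits p) (x y : BitStr n) {b : ℕ}
    (js : List (Fin m)) (q : ℕ) (hq : q + js.length * (p + 1) ≤ b) (acc : ℚ)
    (hacc : FitsBits q acc) :
    (sumTermsT H x y js acc).steps ≤ js.length * (1 + localEntryCost n k p + opCost b) + 1 := by
  induction js generalizing acc q with
  | nil => simp [sumTermsT]
  | cons j js ih =>
    rw [List.length_cons, Nat.succ_mul] at hq
    have he := LocalTerm.fitsBits_entry (hH.1 j) x y
    have h1 : (bitLen acc + bitLen ((H.terms j).entry x y)) ^ 3 ≤ opCost b :=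
      opCost_bound (hacc.mono (by omega)) (he.mono (by omega))
    have h2 := ih (q + p + 1) (by omega) _ (hacc.add he)
    have h3 := he.bitLen_le
    rw [List.length_cons, Nat.succ_mul js.length]
    simp only [sumTermsT, Timed.steps_bind, charge_steps, LocalTerm.entryT, addT] at h2 ⊢
    unfold localEntryCost at h2 ⊢
    omega

lemma Hamiltonian.FitsBits.matrix {H : Hamiltonian n k m} {p : ℕ} (hH : H.FitsBits p)
    (x y : BitStr n) : FixedNodeMC.FitsBits ((m + 1) * (p + 1)) (H.matrix x y) := by
  have h1 : FixedNodeMC.FitsBits (m * (p + 1)) (∑ j, (H.terms j).entry x y) := by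
    have := FixedNodeMC.FitsBits.list_sum (p := p) (q := 0)
      (l := (List.finRange m).map fun j => (H.terms j).entry x y) (by
        intro a ha
        obtain ⟨j, -, rfl⟩ := List.mem_map.1 ha
        exact LocalTerm.fitsBits_entry (hH.1 j) x y) (fitsBits_zero 0)
    simpa [Fin.sum_univ_def] using this
  have h2 : FixedNodeMC.FitsBits p (-(if x = y then H.shift else 0)) := by
    split_ifs
    · exact hH.2.neg
    · simpa using fitsBits_zero p
  rw [Hamiltonian.matrix, sub_eq_add_neg]
  exact (h1.add h2).mono (by rw [Nat.succ_mul]; omega)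

lemma entryT_steps {H : Hamiltonian n k m} {p : ℕ} (hH : H.FitsBits p) (x y : BitStr n) {b : ℕ}
    (hb : (m + 1) * (p + 1) ≤ b) : (entryT H x y).steps ≤ entryCost n k m p b := by
  rw [Nat.succ_mul] at hb
  have h1 := sumTermsT_steps hH x y (b := b) (List.finRange m) 0
    (by rw [List.length_finRange]; omega) 0 (fitsBits_zero 0)
  rw [List.length_finRange] at h1
  have h2 : (bitLen H.shift) ≤ opCost b := bitLen_le_opCost (hH.2.mono (by omega))
  have h3 : FixedNodeMC.FitsBits b (∑ j, (H.terms j).entry x y) := by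
    have := FixedNodeMC.FitsBits.list_sum (p := p) (q := 0)
      (l := (List.finRange m).map fun j => (H.terms j).entry x y) (by
        intro a ha
        obtain ⟨j, -, rfl⟩ := List.mem_map.1 ha
        exact LocalTerm.fitsBits_entry (hH.1 j) x y) (fitsBits_zero 0)
    rw [zero_add, zero_add, List.length_map, List.length_finRange] at this
    rw [Fin.sum_univ_def]
    exact this.mono (by omega)
  have h4 := opCost_bound h3 ((hH.2.mono (show p ≤ b by omega)).neg)
  unfold entryCost
  by_cases hxy : x = y
  · simp only [entryT, Timed.steps_bind, eqStrT, hxy, decide_true, if_true, negT, addT,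
      sumTermsT_val, zero_add] at h1 h4 ⊢
    rw [← Fin.sum_univ_def]
    omega
  · simp only [entryT, Timed.steps_bind, eqStrT, hxy, decide_false, Bool.false_eq_true, if_false,
      Timed.steps_pure]
    omega

/-- The summand `3 * (n + 1)` makes the induction go through. -/
lemma flipsT_steps (L : List (Fin n)) (x : BitStr n) :
    (flipsT L x).steps + 3 * (n + 1) ≤ 4 ^ (L.length + 1) * (n + 1) := by
  induction L generalizing x with
  | nil => simp [flipsT]; omega
  | cons i L ih =>
    have h1 := ih (Function.update x i false)
    have h2 := ih (Function.update x i true)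
    simp only [flipsT, Timed.steps_bind, charge_steps, Timed.steps_pure, length_flipsT,
      List.length_cons]
    have h3 : 2 ^ L.length ≤ 4 ^ (L.length + 1) :=
      (Nat.pow_le_pow_left (by norm_num) _).trans (Nat.pow_le_pow_right (by norm_num) (by omega))
    have h4 := Nat.mul_le_mul_right (n + 1) h3
    rw [pow_succ 4 (L.length + 1), Nat.add_mul, one_mul]
    generalize 4 ^ (L.length + 1) = u at *
    have h5 : u * 4 * (n + 1) = 4 * (u * (n + 1)) := by ring
    rw [h5]
    omega

lemma memT_steps (y : BitStr n) (l : List (BitStr n)) :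
    (memT y l).steps ≤ l.length * (n + 1) + 1 := by
  induction l with
  | nil => simp [memT]
  | cons z l ih =>
    by_cases h : y = z
    · simp [memT, eqStrT, h, Nat.succ_mul]; omega
    · simp [memT, eqStrT, h, Nat.succ_mul]; omega

/-- A bound for the cost of inserting one string into a list of length at most `A`. -/
def insertCost (n A : ℕ) : ℕ := (A + 1) * (n + 1) + 1 + (n + 1)

lemma insertAllT_steps (x : BitStr n) (ys acc : List (BitStr n)) {A : ℕ}
    (hA : acc.length + ys.length ≤ A) :
    (insertAllT x ys acc).steps ≤ ys.length * insertCost n A + 1 := by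
  induction ys generalizing acc with
  | nil => simp [insertAllT]
  | cons y ys ih =>
    rw [List.length_cons] at hA
    have h1 := memT_steps y (x :: acc)
    rw [List.length_cons] at h1
    have h2 : (acc.length + 1) * (n + 1) ≤ (A + 1) * (n + 1) := Nat.mul_le_mul_right _ (by omega)
    have h3 := ih (if (memT y (x :: acc)).val then acc else y :: acc) (by
      split_ifs
      · omega
      · rw [List.length_cons]; omega)
    rw [List.length_cons, Nat.succ_mul ys.length]
    simp only [insertAllT, Timed.steps_bind, charge_steps]
    unfold insertCost at h3 ⊢
    omega

/-- A bound for the cost of listing the neighbours along one local term. -/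
def termNeighbourCost (n k A : ℕ) : ℕ :=
  (k + 1) * (n + 1) + 4 ^ (k + 1) * (n + 1) + 2 ^ k * insertCost n A + 1

lemma neighboursT_steps (H : Hamiltonian n k m) (x : BitStr n) (js : List (Fin m))
    (acc : List (BitStr n)) {A : ℕ} (hA : acc.length + js.length * 2 ^ k ≤ A) :
    (neighboursT H x js acc).steps ≤ js.length * termNeighbourCost n k A + 1 := by
  induction js generalizing acc with
  | nil => simp [neighboursT]
  | cons j js ih =>
    rw [List.length_cons, Nat.succ_mul] at hA
    have h0 := flipsT_steps ((List.finRange k).map (H.terms j).qubits) x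
    have hl := length_flipsT ((List.finRange k).map (H.terms j).qubits) x
    rw [List.length_map, List.length_finRange] at h0 hl
    have h1 := insertAllT_steps x
      (flipsT ((List.finRange k).map (H.terms j).qubits) x).val acc (A := A) (by omega)
    have h2 := length_insertAllT x
      (flipsT ((List.finRange k).map (H.terms j).qubits) x).val acc
    have h3 := ih _ (show (insertAllT x
      (flipsT ((List.finRange k).map (H.terms j).qubits) x).val acc).val.length + _ ≤ A by omega)
    rw [List.length_cons, Nat.succ_mul js.length]
    simp only [neighboursT, Timed.steps_bind, charge_steps]
    rw [hl] at h1
    unfold termNeighbourCost at h3 ⊢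
    omega

/-- A bound for the cost of evaluating a circuit of size `s`. -/
def valueCost (s : ℕ) : ℕ := (s + 1) * (s + 1) + (s + 1) ^ 3

lemma valueT_steps (C : AmpCircuit n) (x : BitStr n) {s : ℕ} (hs : C.size ≤ s) :
    (C.valueT x).steps ≤ valueCost s := by
  unfold AmpCircuit.valueT valueCost AmpCircuit.size at *
  refine Nat.add_le_add (Nat.mul_le_mul (by omega) (by omega)) (Nat.pow_le_pow_left (by omega) 3)

/-- A bound for the cost of handling one neighbour. -/
def loopCost (n k m p s b : ℕ) : ℕ :=
  1 + valueCost s + entryCost n k m p b + 8 * opCost b + (n + 1)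

lemma columnLoopT_steps {H : Hamiltonian n k m} {p : ℕ} (hH : H.FitsBits p) (C : AmpCircuit n)
    {s : ℕ} (hs : C.size ≤ s) (x : BitStr n) {b : ℕ} (hb : (m + 1) * (p + 1) + 2 * s ≤ b)
    (ys : List (BitStr n)) (q : ℕ) (hq : q + ys.length * ((m + 1) * (p + 1) + 2 * s + 1) ≤ b)
    (d : ℚ) (hd : FitsBits q d) (l : List (BitStr n × ℚ)) :
    (columnLoopT H C x (C.value x) ys d l).steps ≤ ys.length * loopCost n k m p s b + 1 := by
  have hv : ∀ z, FitsBits s (C.value z) := fun z => (fitsBits_value C z).mono hs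
  induction ys generalizing d l q with
  | nil => simp [columnLoopT]
  | cons y ys ih =>
    rw [List.length_cons, Nat.succ_mul] at hq
    have hE := entryT_steps hH x y (b := b) (by omega)
    have hM := hH.matrix x y
    have hV := valueT_steps C y hs
    have c1 := bitLen_le_opCost ((hv y).mono (show s ≤ b by omega))
    have f1 := (hv x).mul hM
    have f2 := f1.mul (hv y)
    have f3 := (hv y).div (hv x)
    have f4 := hM.mul f3
    have c2 := opCost_bound ((hv x).mono (show s ≤ b by omega)) (hM.mono (show _ ≤ b by omega))
    have c3 := opCost_bound (f1.mono (show _ ≤ b by omega)) ((hv y).mono (show s ≤ b by omega))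
    have c4 := opCost_bound (fitsBits_zero b) (f2.mono (show _ ≤ b by omega))
    have c5 := opCost_bound ((hv y).mono (show s ≤ b by omega)) ((hv x).mono (show s ≤ b by omega))
    have c6 := opCost_bound (hM.mono (show _ ≤ b by omega)) (f3.mono (show _ ≤ b by omega))
    have c7 := opCost_bound (hd.mono (show _ ≤ b by omega)) (f4.mono (show _ ≤ b by omega))
    have c8 := bitLen_le_opCost (f4.mono (show _ ≤ b by omega))
    have g1 := hd.add f4
    rw [List.length_cons, Nat.succ_mul]
    by_cases hy : C.value y = 0
    · have := ih q (by omega) d hd l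
      have hV' := hV
      simp only [AmpCircuit.valueT] at hV'
      simp only [columnLoopT, Timed.steps_bind, AmpCircuit.valueT, isZeroT, hy, decide_true,
        if_true]
      rw [hy] at c1
      unfold loopCost at this ⊢
      omega
    · have hV' := hV
      simp only [AmpCircuit.valueT] at hV'
      by_cases hp : 0 < C.value x * H.matrix x y * C.value y
      · have := ih _ (by omega) _ g1 l
        simp only [columnLoopT, Timed.steps_bind, AmpCircuit.valueT, isZeroT, hy, decide_false,
          Bool.false_eq_true, if_false, mulT, ltT, divT, addT, entryT_val, hp, decide_true, if_true]
        unfold loopCost at this ⊢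
        omega
      · have := ih q (by omega) d hd ((y, -(H.matrix x y * (C.value y / C.value x))) :: l)
        simp only [columnLoopT, Timed.steps_bind, AmpCircuit.valueT, isZeroT, hy, decide_false,
          Bool.false_eq_true, if_false, mulT, ltT, divT, negT, entryT_val, hp, charge_steps]
        unfold loopCost at this ⊢
        omega

/-- The bit size of the off-diagonal rates. -/
def weightBits (m p s : ℕ) : ℕ := (m + 1) * (p + 1) + 2 * s

/-- The bit size of the diagonal rates. -/
def diagBits (k m p s : ℕ) : ℕ := (m + 1) * (p + 1) + m * 2 ^ k * (weightBits m p s + 1)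

/-- The bit size of all the numbers that occur in the deterministic part of the loop body. -/
def workBits (k m p s : ℕ) : ℕ :=
  diagBits k m p s + m * 2 ^ k * (weightBits m p s + 1) + (weightBits m p s + diagBits k m p s)

/-- A bound for the cost of computing a column of the generator. -/
def columnCost (n k m p s b : ℕ) : ℕ :=
  m * termNeighbourCost n k (m * 2 ^ k) + 1 + entryCost n k m p b +
    (m * 2 ^ k * loopCost n k m p s b + 1) + opCost b

lemma length_columnList (H : Hamiltonian n k m) (φ : BitStr n → ℚ) (x : BitStr n) :
    (columnList H φ x).length ≤ m * 2 ^ k := by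
  rw [columnList, List.length_reverse, List.length_map]
  exact (List.length_filter_le _ _).trans (length_neighbours H x)

variable {H : Hamiltonian n k m} {p s : ℕ} {C : AmpCircuit n}

lemma fitsBits_matrix_mul_ratio (hH : H.FitsBits p) (hs : C.size ≤ s) (x y : BitStr n) :
    FitsBits (weightBits m p s) (H.matrix x y * (C.value y / C.value x)) :=
  ((hH.matrix x y).mul (((fitsBits_value C y).mono hs).div ((fitsBits_value C x).mono hs))).mono
    (by unfold weightBits; omega)

lemma fitsBits_rate (hH : H.FitsBits p) (hs : C.size ≤ s) (x y : BitStr n) :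
    FitsBits (weightBits m p s) (rate H C.value x y) := by
  unfold rate
  split_ifs
  · exact fitsBits_zero _
  · exact (fitsBits_matrix_mul_ratio hH hs x y).neg

lemma fitsBits_columnList (hH : H.FitsBits p) (hs : C.size ≤ s) (x : BitStr n) :
    ∀ e ∈ columnList H C.value x, FitsBits (weightBits m p s) e.2 := by
  intro e he
  simp only [columnList, List.mem_reverse, List.mem_map] at he
  obtain ⟨y, -, rfl⟩ := he
  exact fitsBits_rate hH hs x y

lemma fitsBits_suppGenerator_self (hH : H.FitsBits p) (hs : C.size ≤ s) (x : Supp C.value) :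
    FitsBits (diagBits k m p s) (suppGenerator H C.value x x) := by
  rw [suppGenerator_self]
  refine FitsBits.neg ((FitsBits.list_sum (p := weightBits m p s) ?_ (hH.matrix x.1 x.1)).mono ?_)
  · intro a ha
    obtain ⟨y, -, rfl⟩ := List.mem_map.1 ha
    split_ifs
    · exact fitsBits_matrix_mul_ratio hH hs x.1 y
    · exact fitsBits_zero _
  · rw [List.length_map]
    exact Nat.add_le_add_left (Nat.mul_le_mul_right _ (length_neighbours H x.1)) _

lemma columnT_steps (hH : H.FitsBits p) (hs : C.size ≤ s) (x : Supp C.value) {b : ℕ}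
    (hb : workBits k m p s ≤ b) :
    (columnT H C x.1 (C.value x.1)).steps ≤ columnCost n k m p s b := by
  unfold workBits diagBits at hb
  have h1 := neighboursT_steps H x.1 (List.finRange m) [] (A := m * 2 ^ k) (by simp)
  have h2 := entryT_steps hH x.1 x.1 (b := b) (by omega)
  have hl : (neighbours H x.1).length * (weightBits m p s + 1) ≤
    m * 2 ^ k * (weightBits m p s + 1) := Nat.mul_le_mul_right _ (length_neighbours H x.1)
  have hl' : (neighbours H x.1).length * loopCost n k m p s b ≤
    m * 2 ^ k * loopCost n k m p s b := Nat.mul_le_mul_right _ (length_neighbours H x.1)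
  have hw : weightBits m p s = (m + 1) * (p + 1) + 2 * s := rfl
  have h3 := columnLoopT_steps hH C hs x.1 (b := b) (by omega) (neighbours H x.1)
    ((m + 1) * (p + 1)) (by rw [← hw]; omega) (H.matrix x.1 x.1) (hH.matrix x.1 x.1) []
  have h4 := congrArg Prod.fst (columnT_val H C x)
  simp only [columnT, Timed.val_bind, Timed.val_pure, negT, entryT_val] at h4
  have h5 := fitsBits_suppGenerator_self hH hs x
  rw [← h4] at h5
  have h6 := bitLen_le_opCost (h5.neg.mono (show _ ≤ b by unfold diagBits; omega))
  rw [neg_neg] at h6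
  simp only [columnT, Timed.steps_bind, negT, Timed.steps_pure, entryT_val]
  rw [List.length_finRange] at h1
  unfold neighbours at *
  unfold columnCost
  omega

lemma sumWeightsT_steps {w b : ℕ} (l : List (BitStr n × ℚ)) (hl : ∀ e ∈ l, FitsBits w e.2)
    (q : ℕ) (hq : q + l.length * (w + 1) ≤ b) (acc : ℚ) (hacc : FitsBits q acc) :
    (sumWeightsT l acc).steps ≤ l.length * opCost b + 1 := by
  induction l generalizing acc q with
  | nil => simp [sumWeightsT]
  | cons e l ih =>
    rw [List.length_cons, Nat.succ_mul] at hq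
    have he := hl e List.mem_cons_self
    have h1 := ih (fun e he => hl e (List.mem_cons_of_mem _ he)) _ (by omega) _ (hacc.add he)
    have h2 := opCost_bound (hacc.mono (show q ≤ b by omega)) (he.mono (show w ≤ b by omega))
    rw [List.length_cons, Nat.succ_mul l.length]
    simp only [sumWeightsT, Timed.steps_bind, addT] at h1 ⊢
    omega

lemma anyNegT_steps {b : ℕ} (l : List (BitStr n × ℚ)) (hl : ∀ e ∈ l, FitsBits b e.2) :
    (anyNegT l).steps ≤ l.length * opCost b + 1 := by
  induction l with
  | nil => simp [anyNegT]
  | cons e l ih =>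
    have h1 := ih (fun e he => hl e (List.mem_cons_of_mem _ he))
    have h2 := opCost_bound (hl e List.mem_cons_self) (fitsBits_zero b)
    rw [List.length_cons, Nat.succ_mul l.length]
    by_cases h : e.2 < 0
    · simp only [anyNegT, Timed.steps_bind, ltT, h, decide_true, if_true, Timed.steps_pure]
      omega
    · simp only [anyNegT, Timed.steps_bind, ltT, h, decide_false, Bool.false_eq_true, if_false]
      omega

lemma scaleT_steps {b : ℕ} {u : ℚ} (hu : FitsBits b u) (l : List (BitStr n × ℚ))
    (hl : ∀ e ∈ l, FitsBits b e.2) :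
    (scaleT u l).steps ≤ l.length * (opCost b + (n + 1)) + 1 := by
  induction l with
  | nil => simp [scaleT]
  | cons e l ih =>
    have h1 := ih (fun e he => hl e (List.mem_cons_of_mem _ he))
    have h2 := opCost_bound (hl e List.mem_cons_self) hu
    rw [List.length_cons, Nat.succ_mul l.length]
    simp only [scaleT, Timed.steps_bind, divT, charge_steps, Timed.steps_pure]
    omega

lemma listLen_jumpList (hH : H.FitsBits p) (hs : C.size ≤ s) (x : Supp C.value) {b : ℕ}
    (hb : workBits k m p s ≤ b) :
    listLen (jumpList H C.value x) ≤ m * 2 ^ k * (n + 1 + (2 * b + 3)) := by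
  have h1 : ∀ e ∈ jumpList H C.value x, n + 1 + bitLen e.2 ≤ n + 1 + (2 * b + 3) := by
    intro e he
    obtain ⟨e', he', rfl⟩ := List.mem_map.1 he
    have := (fitsBits_columnList hH hs x.1 e' he').div (fitsBits_suppGenerator_self hH hs x).abs
    exact Nat.add_le_add_left (this.mono (by unfold workBits at hb; omega)).bitLen_le _
  have h2 := List.sum_le_card_nsmul ((jumpList H C.value x).map fun e => n + 1 + bitLen e.2)
    (n + 1 + (2 * b + 3)) (by
      intro a ha
      obtain ⟨e, he, rfl⟩ := List.mem_map.1 ha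
      exact h1 e he)
  refine h2.trans ?_
  rw [smul_eq_mul, List.length_map, jumpList, List.length_map]
  exact Nat.mul_le_mul_right _ (length_columnList H C.value x.1)

/-- A bound for the cost of the deterministic part of the loop body. -/
def examineCost (n k m p s b Mc : ℕ) : ℕ :=
  1 + 4 * opCost b + valueCost s + (2 * s + p + 4) + columnCost n k m p s b +
    3 * (m * 2 ^ k * (opCost b + (n + 1)) + 1) + (2 * Mc + 1)

lemma examineT_steps (hH : H.FitsBits p) (hs : C.size ≤ s) {t Mc c b : ℕ} (hc : c ≤ Mc)
    (x : Supp C.value) (hb : workBits k m p s ≤ b) (ht : FitsBits b (t : ℚ)) {τ : ℚ}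
    (hτ : FitsBits b τ) : (examineT p t Mc H C c x.1 τ).steps ≤ examineCost n k m p s b Mc := by
  have hb' := hb
  unfold workBits at hb'
  have hcol := fitsBits_columnList hH hs x.1
  have hg := fitsBits_suppGenerator_self hH hs x
  have e1 := opCost_bound hτ ht
  have e2 := valueT_steps C x.1 hs
  have e3 := ((fitsBits_value C x.1).mono hs).bitLen_le
  have e4 := columnT_steps hH hs x hb
  have hlen : (columnList H C.value x.1).length * (weightBits m p s + 1) ≤
    m * 2 ^ k * (weightBits m p s + 1) := Nat.mul_le_mul_right _ (length_columnList _ _ _)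
  have e5 := sumWeightsT_steps (b := b) _ hcol _ (by omega) _ hg
  have e6 := bitLen_le_opCost ((FitsBits.list_sum
    (l := (columnList H C.value x.1).map Prod.snd) (p := weightBits m p s) (by
      intro a ha
      obtain ⟨e, he, rfl⟩ := List.mem_map.1 ha
      exact hcol e he) hg).mono (show _ ≤ b by rw [List.length_map]; omega))
  have e7 := anyNegT_steps (b := b) _ (fun e he => (hcol e he).mono (by omega))
  have e8 := Nat.size_le_size hc
  have e8' : Nat.size Mc ≤ Mc := Nat.size_le.2 Nat.lt_two_pow_self
  have e9 := bitLen_le_opCost (hg.mono (show _ ≤ b by omega))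
  have e10 := scaleT_steps (b := b) (hg.abs.mono (by omega)) _
    (fun e he => (hcol e he).mono (by omega))
  have l1 : (columnList H C.value x.1).length * (opCost b + (n + 1)) ≤
    m * 2 ^ k * (opCost b + (n + 1)) := Nat.mul_le_mul_right _ (length_columnList _ _ _)
  have l2 : (columnList H C.value x.1).length * opCost b ≤
    (columnList H C.value x.1).length * (opCost b + (n + 1)) := Nat.mul_le_mul_left _ (by omega)
  unfold examineCost
  simp only [AmpCircuit.valueT] at e2
  simp only [examineT, Timed.steps_bind, charge_steps, ltT, AmpCircuit.valueT, fitsT, natLeT,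
    absT, isZeroT, columnT_val, sumWeightsT_val, apply_ite Timed.steps, Timed.steps_pure]
  split_ifs <;> omega

end Costs

/-! ### The step-counted program implements the protocol -/

section Simulation

lemma bind_congr_support {α β : Type*} (μ : PMF α) {f g : α → PMF β}
    (h : ∀ a ∈ μ.support, f a = g a) : μ.bind f = μ.bind g := by
  ext b
  rw [PMF.bind_apply, PMF.bind_apply]
  refine tsum_congr fun a => ?_
  by_cases ha : μ a = 0
  · simp [ha]
  · rw [h a ((PMF.mem_support_iff _ _).2 ha)]

lemma waitingTime_abs (p' t : ℕ) (g : ℚ) : waitingTime p' t |g| = waitingTime p' t g := by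
  unfold waitingTime
  congr 1
  push_cast
  exact abs_abs _

variable {n k m : ℕ}

/-- The configuration of the program that corresponds to a configuration of the protocol: the current
string is only remembered as a string. -/
def Config.embed {φ : BitStr n → ℚ} : Config (Supp φ) → Config (BitStr n)
  | .run c x τ => .run c x.1 τ
  | .halt b => .halt b

lemma Config.embed_injective {φ : BitStr n → ℚ} :
    Function.Injective (Config.embed : Config (Supp φ) → Config (BitStr n)) := by
  intro a b h
  cases a <;> cases b <;> simp_all [Config.embed, Subtype.ext_iff]

lemma Config.embed_eq_halt {φ : BitStr n → ℚ} {c : Config (Supp φ)} {b : Bool} :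
    c.embed = .halt b ↔ c = .halt b := by
  cases c <;> simp [Config.embed]

lemma weighted_map_val {φ : BitStr n → ℚ} (g : BitStr n → ℚ) (w : Supp φ → ℚ)
    (hg : ∀ y, φ y = 0 → g y = 0) (hw : ∀ y : Supp φ, w y = g y.1) (x : Supp φ) :
    weighted g x.1 = (weighted w x).map Subtype.val := by
  classical
  have hsum : ∑ y, ENNReal.ofReal (w y) = ∑ y, ENNReal.ofReal (g y) := by
    rw [← sum_supp (φ := φ) fun y hy => by simp [hg y hy]]
    exact Finset.sum_congr rfl fun y _ => by rw [hw y]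
  unfold weighted
  by_cases h : ∑ y, ENNReal.ofReal (g y) = 1
  · rw [dif_pos h, dif_pos (hsum.trans h)]
    ext y
    rw [PMF.map_apply, tsum_fintype]
    simp only [PMF.ofFintype_apply]
    by_cases hy : φ y = 0
    · rw [hg y hy, Finset.sum_eq_zero]
      · simp
      · intro z _
        rw [if_neg]
        rintro rfl
        exact z.2 hy
    · rw [Finset.sum_eq_single (⟨y, hy⟩ : Supp φ)]
      · simp [hw]
      · intro z _ hz
        rw [if_neg]
        rintro rfl
        exact hz rfl
      · simp
  · rw [dif_neg h, dif_neg (hsum ▸ h), PMF.pure_map]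

variable (r : Polynomial ℕ) (p p' t : ℕ) (H : Hamiltonian n k m) (C : AmpCircuit n)

/-- The distribution of the jump, read off from the list computed by the program. -/
lemma weighted_jumpList (x : Supp C.value) :
    weighted (listWeight (jumpList H C.value x)) x.1 =
      (weighted (fun y => if y = x then 0 else
        suppGenerator H C.value y x / |suppGenerator H C.value x x|) x).map Subtype.val := by
  refine weighted_map_val _ _ (fun y hy => ?_) (fun y => ?_) x
  · simp [listWeight_jumpList, rate, hy]
  · rw [listWeight_jumpList]
    by_cases h : y = x
    · simp [h]
    · rw [if_neg h, if_neg (fun h' => h (Subtype.ext h')), suppGenerator_of_ne H _ h]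

/-- One pass through the loop of the program is, up to the step count, one pass through the loop of
the protocol. -/
lemma timedStep_map_fst (c : Config (Supp C.value)) (s : ℕ) :
    (timedStep r p p' t ⌈maxTransitions H t⌉₊ H C (c.embed, s)).map Prod.fst =
      (checkStep p p' t H C.value c).map Config.embed := by
  cases c with
  | halt b => simp [Config.embed, timedStep, checkStep, PMF.pure_map]
  | run c x τ =>
    simp only [Config.embed, timedStep, checkStep, examineT_val, Nat.ceil_le]
    by_cases h1 : ¬ τ < t
    · rw [if_pos h1, if_pos h1]
      simp [PMF.pure_map, Config.embed]
    rw [if_neg h1, if_neg h1]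
    by_cases h2 : ¬ FitsBits p (C.value x.1)
    · rw [if_pos h2, if_pos h2]
      simp [PMF.pure_map, Config.embed]
    rw [if_neg h2, if_neg h2]
    by_cases h3 : ∑ z, suppGenerator H C.value z x ≠ 0 ∨
          ∃ y, y ≠ x ∧ suppGenerator H C.value y x < 0
    · rw [if_pos h3, if_pos h3]
      simp [PMF.pure_map, Config.embed]
    rw [if_neg h3, if_neg h3]
    by_cases h4 : maxTransitions H t ≤ c
    · rw [if_pos h4, if_pos h4]
      simp [PMF.pure_map, Config.embed]
    rw [if_neg h4, if_neg h4]
    by_cases h5 : |suppGenerator H C.value x x| = 0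
    · rw [if_pos h5, if_pos h5]
      simp [PMF.pure_map, Config.embed]
    rw [if_neg h5, if_neg h5]
    simp only [waitingTime_abs, PMF.map_bind, PMF.pure_map, weighted_jumpList, PMF.bind_map,
      Config.embed, Function.comp_def, mulT, addT, Timed.val_bind]

lemma iterPMF_map_fst (N : ℕ) (c : Config (Supp C.value)) (s : ℕ) :
    (iterPMF (timedStep r p p' t ⌈maxTransitions H t⌉₊ H C) N (c.embed, s)).map Prod.fst =
      (iterPMF (checkStep p p' t H C.value) N c).map Config.embed := by
  induction N generalizing c s with
  | zero => simp [iterPMF, PMF.pure_map]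
  | succ N ih =>
    have : Nonempty (Config (Supp C.value)) := ⟨.halt true⟩
    let g : Config (BitStr n) → Config (Supp C.value) := Function.invFun Config.embed
    have hg : ∀ c, g (Config.embed c) = c := Function.leftInverse_invFun Config.embed_injective
    have key := timedStep_map_fst r p p' t H C c s
    simp only [iterPMF, PMF.map_bind]
    have h1 : (timedStep r p p' t ⌈maxTransitions H t⌉₊ H C (c.embed, s)).bind (fun o =>
        (iterPMF (timedStep r p p' t ⌈maxTransitions H t⌉₊ H C) N o).map Prod.fst) =
        (timedStep r p p' t ⌈maxTransitions H t⌉₊ H C (c.embed, s)).bind (fun o =>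
          (iterPMF (checkStep p p' t H C.value) N (g o.1)).map Config.embed) := by
      refine bind_congr_support _ fun o ho => ?_
      have ho' : o.1 ∈ ((timedStep r p p' t ⌈maxTransitions H t⌉₊ H C
          (c.embed, s)).map Prod.fst).support := (PMF.mem_support_map_iff _ _ _).2 ⟨o, ho, rfl⟩
      rw [key, PMF.mem_support_map_iff] at ho'
      obtain ⟨c', -, hc'⟩ := ho'
      rw [← hc', hg, ← ih c' o.2, hc']
    have h2 := PMF.bind_map (timedStep r p p' t ⌈maxTransitions H t⌉₊ H C (c.embed, s)) Prod.fst
      (fun d => (iterPMF (checkStep p p' t H C.value) N (g d)).map Config.embed)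
    have h3 := PMF.bind_map (checkStep p p' t H C.value c) Config.embed
      (fun d => (iterPMF (checkStep p p' t H C.value) N (g d)).map Config.embed)
    rw [h1]
    simp only [Function.comp_def, hg] at h2 h3
    rw [← h2, key, h3]

lemma timedInit_fst (Mc : ℕ) (xin : BitStr n) :
    (timedInit p' t Mc C xin).1 = (checkInit C.value xin).embed := by
  by_cases h : C.value xin = 0
  · simp [timedInit, checkInit, AmpCircuit.valueT, isZeroT, h, Config.embed]
  · simp [timedInit, checkInit, AmpCircuit.valueT, isZeroT, h, Config.embed]

lemma timedRun_map_fst (xin : BitStr n) (N : ℕ) :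
    (timedRun r p p' t ⌈maxTransitions H t⌉₊ H C xin N).map Prod.fst =
      (iterPMF (checkStep p p' t H C.value) N (checkInit C.value xin)).map Config.embed := by
  rw [← iterPMF_map_fst r p p' t H C N _ (timedInit p' t ⌈maxTransitions H t⌉₊ C xin).2,
    ← timedInit_fst p' t C ⌈maxTransitions H t⌉₊]
  rfl

lemma timedRun_verdict (xin : BitStr n) (N : ℕ) (b : Bool) :
    (timedRun r p p' t ⌈maxTransitions H t⌉₊ H C xin N).toOuterMeasure {o | o.1 = .halt b} =
      iterPMF (checkStep p p' t H C.value) N (checkInit C.value xin) (.halt b) := by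
  have h1 : {o : Config (BitStr n) × ℕ | o.1 = .halt b} = Prod.fst ⁻¹' {.halt b} := rfl
  have h2 : Config.embed ⁻¹' {.halt b} = ({.halt b} : Set (Config (Supp C.value))) := by
    ext c; simp [Config.embed_eq_halt]
  rw [h1, ← PMF.toOuterMeasure_map_apply, timedRun_map_fst, PMF.toOuterMeasure_map_apply, h2,
    PMF.toOuterMeasure_apply_singleton]

end Simulation

/-! ### The protocol halts -/

section Halting

variable {n k m : ℕ} (p p' t : ℕ) (H : Hamiltonian n k m)

lemma truncK_eq : truncK p' t = 2 * t * 2 ^ (200 * p' * t) := by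
  unfold truncK delta
  have : 2 * (t : ℚ) / (1 / 2) ^ (200 * p' * t) = ((2 * t * 2 ^ (200 * p' * t) : ℕ) : ℚ) := by
    rw [one_div, inv_pow, div_inv_eq_mul]
    push_cast
    ring
  rw [this, Nat.ceil_natCast]

lemma truncK_mul_delta : (truncK p' t : ℚ) * delta p' t = 2 * t := by
  rw [truncK_eq, delta]
  push_cast
  rw [mul_assoc, ← mul_pow]
  norm_num

lemma delta_pos : 0 < delta p' t := by unfold delta; positivity

/-- An invariant of the configurations after `N` passes through the loop: as long as the loop is
running, every pass has made a transition, except possibly one which has set the time to `t`; the time is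
a multiple of `δ` and at most `3 t`. -/
def OnTrack {α : Type} (Mc N : ℕ) : Config α → Prop
  | .halt _ => True
  | .run c _ τ => c ≤ Mc ∧ (c = N ∨ (c + 1 = N ∧ ¬ τ < t)) ∧
      ∃ i : ℕ, τ = i * delta p' t ∧ τ ≤ 3 * t

variable {p p' t H}

lemma OnTrack.step {φ : BitStr n → ℚ} {N : ℕ} {c c' : Config (Supp φ)}
    (hc : OnTrack p' t ⌈maxTransitions H t⌉₊ N c) (hc' : c' ∈ (checkStep p p' t H φ c).support) :
    OnTrack p' t ⌈maxTransitions H t⌉₊ (N + 1) c' := by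
  cases c with
  | halt b =>
    simp only [checkStep, PMF.support_pure, Set.mem_singleton_iff] at hc'
    subst hc'; trivial
  | run c x τ =>
    obtain ⟨hcM, hcN, i, hi, hi3⟩ := hc
    simp only [checkStep] at hc'
    by_cases h1 : ¬ τ < t
    · rw [if_pos h1, PMF.support_pure, Set.mem_singleton_iff] at hc'
      subst hc'; trivial
    rw [if_neg h1] at hc'
    by_cases h2 : ¬ FitsBits p (φ x.1)
    · rw [if_pos h2, PMF.support_pure, Set.mem_singleton_iff] at hc'
      subst hc'; trivial
    rw [if_neg h2] at hc'
    by_cases h3 : ∑ z, suppGenerator H φ z x ≠ 0 ∨ ∃ y, y ≠ x ∧ suppGenerator H φ y x < 0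
    · rw [if_pos h3, PMF.support_pure, Set.mem_singleton_iff] at hc'
      subst hc'; trivial
    rw [if_neg h3] at hc'
    by_cases h4 : maxTransitions H t ≤ c
    · rw [if_pos h4, PMF.support_pure, Set.mem_singleton_iff] at hc'
      subst hc'; trivial
    rw [if_neg h4] at hc'
    have hcN' : c = N := by tauto
    by_cases h5 : |suppGenerator H φ x x| = 0
    · rw [if_pos h5, PMF.support_pure, Set.mem_singleton_iff] at hc'
      subst hc'
      refine ⟨hcM, Or.inr ⟨by omega, lt_irrefl _⟩, t * 2 ^ (200 * p' * t), ?_, ?_⟩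
      · unfold delta
        push_cast
        rw [mul_assoc, ← mul_pow]
        norm_num
      · have : (0 : ℚ) ≤ t := Nat.cast_nonneg t
        linarith
    rw [if_neg h5] at hc'
    simp only [PMF.mem_support_bind_iff, PMF.support_pure, Set.mem_singleton_iff] at hc'
    obtain ⟨j, -, y, -, rfl⟩ := hc'
    refine ⟨?_, Or.inl (by omega), i + j, ?_, ?_⟩
    · rw [← Nat.ceil_le, not_le] at h4; exact h4
    · push_cast; rw [hi]; ring
    · have hj : ((j : ℕ) : ℚ) ≤ truncK p' t := by exact_mod_cast Nat.lt_succ_iff.1 j.2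
      have := mul_le_mul_of_nonneg_right hj (delta_pos p' t).le
      rw [truncK_mul_delta] at this
      rw [not_not] at h1
      linarith

lemma onTrack_checkInit (φ : BitStr n → ℚ) (xin : BitStr n) (Mc : ℕ) :
    OnTrack p' t Mc 0 (checkInit φ xin) := by
  unfold checkInit
  split_ifs
  · exact ⟨Nat.zero_le _, Or.inl rfl, 0, by simp, by positivity⟩
  · trivial

lemma OnTrack.halted {α : Type} {Mc N : ℕ} {c : Config α} (hc : OnTrack p' t Mc N c)
    (hN : Mc + 2 ≤ N) : ∃ b, c = .halt b := by
  cases c with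
  | halt b => exact ⟨b, rfl⟩
  | run c x τ =>
    obtain ⟨h1, h2, -⟩ := hc
    omega

lemma OnTrack.iter {φ : BitStr n → ℚ} (N : ℕ) {N₀ : ℕ} {c c' : Config (Supp φ)}
    (hc : OnTrack p' t ⌈maxTransitions H t⌉₊ N₀ c)
    (hc' : c' ∈ (iterPMF (checkStep p p' t H φ) N c).support) :
    OnTrack p' t ⌈maxTransitions H t⌉₊ (N₀ + N) c' := by
  induction N generalizing c N₀ with
  | zero =>
    simp only [iterPMF, PMF.support_pure, Set.mem_singleton_iff] at hc'
    subst hc'; exact hc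
  | succ N ih =>
    simp only [iterPMF, PMF.mem_support_bind_iff] at hc'
    obtain ⟨d, hd, hc'⟩ := hc'
    have := ih (hc.step hd) hc'
    rwa [show N₀ + 1 + N = N₀ + (N + 1) by omega] at this

variable (p p' t H)

/-- The verdict probabilities add up to one once the loop must have ended. -/
lemma iter_accept_add_reject (φ : BitStr n → ℚ) (xin : BitStr n) {N : ℕ}
    (hN : ⌈maxTransitions H t⌉₊ + 2 ≤ N) :
    iterPMF (checkStep p p' t H φ) N (checkInit φ xin) (.halt true) +
      iterPMF (checkStep p p' t H φ) N (checkInit φ xin) (.halt false) = 1 := by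
  classical
  set μ := iterPMF (checkStep p p' t H φ) N (checkInit φ xin) with hμ
  have h1 : ∀ c ∉ ({.halt true, .halt false} : Finset (Config (Supp φ))), μ c = 0 := by
    intro c hc
    by_contra h
    have h2 : c ∈ μ.support := (PMF.mem_support_iff _ _).2 h
    obtain ⟨b, rfl⟩ := ((onTrack_checkInit (p' := p') (t := t) φ xin
      ⌈maxTransitions H t⌉₊).iter N h2).halted (by omega)
    cases b <;> simp at hc
  have h3 := μ.tsum_coe
  rw [tsum_eq_sum h1, Finset.sum_pair (by simp)] at h3
  exact h3

/-- A bound on the probability of one verdict bounds the probability of the other one from below. -/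
lemma le_checkProb_of_forall_iter_le (φ : BitStr n → ℚ) (xin : BitStr n) (b : Bool) {q : ℝ≥0∞}
    (h : ∀ N, iterPMF (checkStep p p' t H φ) N (checkInit φ xin) (.halt !b) ≤ q) :
    1 - q ≤ checkProb p p' t H φ xin b := by
  have h1 := iter_accept_add_reject p p' t H φ xin (le_refl (⌈maxTransitions H t⌉₊ + 2))
  refine le_trans ?_ (le_iSup (fun N => iterPMF (checkStep p p' t H φ) N (checkInit φ xin)
    (.halt b)) (⌈maxTransitions H t⌉₊ + 2))
  rw [tsub_le_iff_right, ← h1]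
  have h2 := h (⌈maxTransitions H t⌉₊ + 2)
  cases b
  · rw [add_comm]; gcongr; exact h2
  · gcongr; exact h2

end Halting

/-! ### The running time -/

section RunningTime

variable {n k m : ℕ}

lemma eval_mono_nat (r : Polynomial ℕ) {a b : ℕ} (h : a ≤ b) : r.eval a ≤ r.eval b := by
  rw [Polynomial.eval_eq_sum, Polynomial.eval_eq_sum]
  exact Finset.sum_le_sum fun i _ => Nat.mul_le_mul_left _ (Nat.pow_le_pow_left h i)

/-- The bit size of the times and of the time samples. -/
def timeBits (p' t : ℕ) : ℕ := 200 * p' * t + 3 * t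

lemma fitsBits_mul_delta {p' t i : ℕ} (hi : (i : ℚ) * delta p' t ≤ 3 * t) :
    FitsBits (timeBits p' t) (i * delta p' t) := by
  have h2 : (0 : ℚ) < 2 ^ (200 * p' * t) := by positivity
  have h : (i : ℚ) * delta p' t = ((i : ℤ) : ℚ) / (((2 ^ (200 * p' * t) : ℕ) : ℤ) : ℚ) := by
    unfold delta
    push_cast
    rw [one_div, inv_pow, div_eq_mul_inv]
  have hi' : i ≤ 3 * t * 2 ^ (200 * p' * t) := by
    rw [h, div_le_iff₀ (by push_cast; positivity)] at hi
    exact_mod_cast hi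
  have h3 : 3 * t ≤ 2 ^ (3 * t) := Nat.lt_two_pow_self.le
  rw [h]
  refine fitsBits_div_int _ _ (by simp) ?_ ?_
  · rw [Int.natAbs_natCast, timeBits, pow_add, mul_comm (2 ^ _)]
    exact hi'.trans (Nat.mul_le_mul_right _ h3)
  · rw [Int.natAbs_natCast]
    exact Nat.pow_le_pow_right two_pos (by unfold timeBits; omega)

lemma truncK_le (p' t : ℕ) : truncK p' t ≤ 2 ^ timeBits p' t := by
  rw [truncK_eq, timeBits, pow_add, mul_comm (2 ^ _)]
  refine Nat.mul_le_mul_right _ ?_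
  have : 3 * t < 2 ^ (3 * t) := Nat.lt_two_pow_self
  omega

lemma fitsBits_delta (p' t : ℕ) : FitsBits (timeBits p' t) (delta p' t) := by
  have h : delta p' t = ((1 : ℤ) : ℚ) / (((2 ^ (200 * p' * t) : ℕ) : ℤ) : ℚ) := by
    unfold delta; push_cast; rw [div_pow, one_pow]
  rw [h]
  refine fitsBits_div_int _ _ (by simp) (by simpa using Nat.one_le_two_pow) ?_
  rw [Int.natAbs_natCast]
  exact Nat.pow_le_pow_right two_pos (by unfold timeBits; omega)

/-- A bound for the cost of one pass through the loop. -/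
def stepCost (r : Polynomial ℕ) (n k m p s b Mc : ℕ) : ℕ :=
  examineCost n k m p s b Mc + 3 * opCost b + r.eval (n + (2 * b + 3)) +
    r.eval (n + m * 2 ^ k * (n + 1 + (2 * b + 3))) + (n + 1 + Mc + 1)

/-- A bound for the cost of the initialization. -/
def initCost (n s t b Mc : ℕ) : ℕ :=
  t + Mc + (b + 1) + (2 * b + 3) + n + 1 + valueCost s + (2 * s + 3)

variable {r : Polynomial ℕ} {p p' t s b : ℕ} {H : Hamiltonian n k m} {C : AmpCircuit n}

lemma timedStep_steps (hH : H.FitsBits p) (hs : C.size ≤ s) (hb : workBits k m p s ≤ b)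
    (hbt : timeBits p' t ≤ b) {N : ℕ} {c : Config (Supp C.value)} {Mc : ℕ}
    (hc : OnTrack p' t Mc N c) {σ : ℕ} {o : Config (BitStr n) × ℕ}
    (ho : o ∈ (timedStep r p p' t Mc H C (c.embed, σ)).support) :
    o.2 ≤ σ + stepCost r n k m p s b Mc ∧ (∀ v, c = .halt v → o.2 = σ) := by
  cases c with
  | halt v =>
    simp only [Config.embed, timedStep, PMF.support_pure, Set.mem_singleton_iff] at ho
    subst ho
    simp
  | run c x τ =>
    refine ⟨?_, by simp⟩
    obtain ⟨hcM, -, i, hi, hi3⟩ := hc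
    have ht : FitsBits b (t : ℚ) := fitsBits_natCast (Nat.lt_two_pow_self.le.trans
      (Nat.pow_le_pow_right two_pos (by unfold timeBits at hbt; omega)))
    have hτ : FitsBits b τ := by
      rw [hi] at hi3 ⊢
      exact (fitsBits_mul_delta hi3).mono hbt
    have hex := examineT_steps hH hs (t := t) hcM x hb ht hτ
    simp only [Config.embed, timedStep] at ho
    rw [examineT_val] at ho
    unfold stepCost
    have htl := bitLen_le_opCost ht
    split_ifs at ho
    case neg =>
      simp only [PMF.mem_support_bind_iff, PMF.support_pure, Set.mem_singleton_iff] at ho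
      obtain ⟨j, -, y, -, rfl⟩ := ho
      have hjK : (j : ℕ) ≤ truncK p' t := Nat.lt_succ_iff.1 j.2
      have hj : FitsBits b (((j : ℕ)) : ℚ) :=
        (fitsBits_natCast (hjK.trans (truncK_le p' t))).mono hbt
      have hjd : FitsBits b (((j : ℕ) : ℚ) * delta p' t) := by
        refine (fitsBits_mul_delta ?_).mono hbt
        have h1 : ((j : ℕ) : ℚ) ≤ truncK p' t := by exact_mod_cast hjK
        have h2 := mul_le_mul_of_nonneg_right h1 (delta_pos p' t).le
        rw [truncK_mul_delta] at h2
        have : (0 : ℚ) ≤ t := Nat.cast_nonneg t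
        linarith
      have e1 := opCost_bound hj ((fitsBits_delta p' t).mono hbt)
      have e2 := opCost_bound hτ hjd
      have e3 : Nat.size c ≤ Mc :=
        (Nat.size_le_size hcM).trans (Nat.size_le.2 Nat.lt_two_pow_self)
      have e4 := eval_mono_nat r (Nat.add_le_add_left ((fitsBits_suppGenerator_self hH hs
        x).abs.mono (show diagBits k m p s ≤ b by unfold workBits at hb; omega)).bitLen_le n)
      have e5 := eval_mono_nat r (Nat.add_le_add_left (listLen_jumpList hH hs x hb) n)
      simp only [mulT, addT, Timed.steps_bind, charge_steps]
      omega
    all_goals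
      simp only [PMF.support_pure, Set.mem_singleton_iff] at ho
      subst ho
      dsimp only
      omega

lemma timedInit_steps (hs : C.size ≤ s) (hbt : timeBits p' t ≤ b) (Mc : ℕ) (xin : BitStr n) :
    (timedInit p' t Mc C xin).2 ≤ initCost n s t b Mc := by
  have e1 := valueT_steps C xin hs
  have e2 := ((fitsBits_value C xin).mono hs).bitLen_le
  have e3 := ((fitsBits_delta p' t).mono hbt).bitLen_le
  have e4 : Nat.size (truncK p' t) ≤ b + 1 := Nat.size_le.2 (by
    refine (truncK_le p' t).trans_lt ?_
    exact Nat.pow_lt_pow_right (by norm_num) (by omega))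
  have e5 : Nat.size t ≤ t := Nat.size_le.2 Nat.lt_two_pow_self
  have e6 : Nat.size Mc ≤ Mc := Nat.size_le.2 Nat.lt_two_pow_self
  simp only [AmpCircuit.valueT] at e1
  simp only [timedInit, Timed.steps_bind, charge_steps, AmpCircuit.valueT, isZeroT]
  unfold initCost
  omega

lemma timedIter_steps (hH : H.FitsBits p) (hs : C.size ≤ s) (hb : workBits k m p s ≤ b)
    (hbt : timeBits p' t ≤ b) (N : ℕ) {N₀ : ℕ} {c : Config (Supp C.value)} {Mc : ℕ}
    (hMc : Mc = ⌈maxTransitions H t⌉₊) (hc : OnTrack p' t Mc N₀ c) {σ : ℕ}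
    {o : Config (BitStr n) × ℕ}
    (ho : o ∈ (iterPMF (timedStep r p p' t Mc H C) N (c.embed, σ)).support) :
    (∃ c' : Config (Supp C.value), o.1 = c'.embed ∧ OnTrack p' t Mc (N₀ + N) c') ∧
      o.2 + min N₀ (Mc + 2) * stepCost r n k m p s b Mc ≤
        σ + min (N₀ + N) (Mc + 2) * stepCost r n k m p s b Mc := by
  induction N generalizing c N₀ σ with
  | zero =>
    simp only [iterPMF, PMF.support_pure, Set.mem_singleton_iff] at ho
    subst ho
    exact ⟨⟨c, rfl, hc⟩, le_rfl⟩
  | succ N ih =>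
    simp only [iterPMF, PMF.mem_support_bind_iff] at ho
    obtain ⟨d, hd, ho⟩ := ho
    have h1 := timedStep_steps hH hs hb hbt hc hd
    have h2 : d.1 ∈ ((timedStep r p p' t Mc H C (c.embed, σ)).map Prod.fst).support :=
      (PMF.mem_support_map_iff _ _ _).2 ⟨d, hd, rfl⟩
    rw [hMc, timedStep_map_fst, PMF.mem_support_map_iff] at h2
    obtain ⟨c', hc', hcd⟩ := h2
    have h3 : OnTrack p' t Mc (N₀ + 1) c' := by rw [hMc] at hc ⊢; exact hc.step hc'
    obtain ⟨h4, h5⟩ := ih (σ := d.2) h3 (by rw [hcd]; exact ho)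
    rw [show N₀ + 1 + N = N₀ + (N + 1) by omega] at h4 h5
    refine ⟨h4, ?_⟩
    rcases lt_or_ge N₀ (Mc + 2) with h | h
    · rw [min_eq_left (show N₀ + 1 ≤ Mc + 2 by omega), Nat.succ_mul] at h5
      rw [min_eq_left h.le]
      omega
    · obtain ⟨v, hv⟩ := hc.halted h
      have := h1.2 v hv
      rw [min_eq_right (show Mc + 2 ≤ N₀ + 1 by omega)] at h5
      rw [min_eq_right h]
      omega

lemma runsWithin_of_le (hH : H.FitsBits p) (hs : C.size ≤ s) (hb : workBits k m p s ≤ b)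
    (hbt : timeBits p' t ≤ b) (xin : BitStr n) {T Mc : ℕ} (hMc : Mc = ⌈maxTransitions H t⌉₊)
    (hT : initCost n s t b Mc + (Mc + 2) * stepCost r n k m p s b Mc + (Mc + 2) ≤ T) :
    RunsWithin T r p p' t H C xin := by
  refine ⟨fun v => iSup_congr fun N => timedRun_verdict r p p' t H C xin N v, fun N o ho => ?_⟩
  rw [← hMc] at ho
  have h0 := timedInit_fst p' t C Mc xin
  have ho' : o ∈ (iterPMF (timedStep r p p' t Mc H C) N
      ((checkInit C.value xin).embed, (timedInit p' t Mc C xin).2)).support := by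
    rw [← h0]; exact ho
  obtain ⟨⟨c', hc', hc''⟩, h2⟩ := timedIter_steps hH hs hb hbt N hMc
    (onTrack_checkInit C.value xin Mc) ho'
  have h3 := timedInit_steps hs hbt Mc xin
  constructor
  · have h4 : min (0 + N) (Mc + 2) * stepCost r n k m p s b Mc ≤
        (Mc + 2) * stepCost r n k m p s b Mc := Nat.mul_le_mul_right _ (min_le_right _ _)
    omega
  · intro hN
    obtain ⟨v, rfl⟩ := hc''.halted (show Mc + 2 ≤ 0 + N by omega)
    exact ⟨v, hc'⟩

lemma maxTransitions_le {μ B : ℕ} (hm : m ≤ μ) (hB : H.opNorm ≤ B) (t : ℕ) :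
    maxTransitions H t ≤ ((2 ^ k * μ * n ^ 3 * t * B : ℕ) : ℝ) := by
  unfold maxTransitions
  have h0 : 0 ≤ H.opNorm := norm_nonneg _
  have hm' : (m : ℝ) ≤ μ := by exact_mod_cast hm
  push_cast
  gcongr

/-- A function that is bounded by a polynomial. -/
def PolyBounded (f : ℕ → ℕ) : Prop := ∃ P : Polynomial ℕ, ∀ n, f n ≤ P.eval n

namespace PolyBounded

variable {f g : ℕ → ℕ}

lemma const (c : ℕ) : PolyBounded fun _ => c := ⟨Polynomial.C c, by simp⟩

lemma eval (P : Polynomial ℕ) : PolyBounded fun n => P.eval n := ⟨P, fun _ => le_rfl⟩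

lemma self : PolyBounded fun n => n := ⟨Polynomial.X, by simp⟩

lemma add (hf : PolyBounded f) (hg : PolyBounded g) : PolyBounded fun n => f n + g n := by
  obtain ⟨P, hP⟩ := hf
  obtain ⟨Q, hQ⟩ := hg
  exact ⟨P + Q, fun n => by rw [Polynomial.eval_add]; exact Nat.add_le_add (hP n) (hQ n)⟩

lemma mul (hf : PolyBounded f) (hg : PolyBounded g) : PolyBounded fun n => f n * g n := by
  obtain ⟨P, hP⟩ := hf
  obtain ⟨Q, hQ⟩ := hg
  exact ⟨P * Q, fun n => by rw [Polynomial.eval_mul]; exact Nat.mul_le_mul (hP n) (hQ n)⟩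

lemma pow (hf : PolyBounded f) (d : ℕ) : PolyBounded fun n => f n ^ d := by
  obtain ⟨P, hP⟩ := hf
  exact ⟨P ^ d, fun n => by rw [Polynomial.eval_pow]; exact Nat.pow_le_pow_left (hP n) d⟩

lemma comp (r : Polynomial ℕ) (hf : PolyBounded f) : PolyBounded fun n => r.eval (f n) := by
  obtain ⟨P, hP⟩ := hf
  exact ⟨r.comp P, fun n => by rw [Polynomial.eval_comp]; exact eval_mono_nat r (hP n)⟩

end PolyBounded

/-- The bound for the running time in terms of the bounds for all the parameters. -/
def totalCost (r : Polynomial ℕ) (n k m p p' t s B : ℕ) : ℕ :=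
  let b := workBits k m p s + timeBits p' t
  let Mc := 2 ^ k * m * n ^ 3 * t * B
  initCost n s t b Mc + (Mc + 2) * stepCost r n k m p s b Mc + (Mc + 2)

lemma polyBounded_totalCost (r : Polynomial ℕ) (k : ℕ) (m p p' t s B : Polynomial ℕ) :
    PolyBounded fun n => totalCost r n k (m.eval n) (p.eval n) (p'.eval n) (t.eval n) (s.eval n)
      (B.eval n) := by
  simp only [totalCost, initCost, stepCost, examineCost, columnCost, loopCost, entryCost, opCost,
    valueCost, termNeighbourCost, insertCost, localEntryCost, workBits, timeBits, diagBits,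
    weightBits]
  repeat' with_reducible first
    | exact PolyBounded.const _
    | exact PolyBounded.eval _
    | exact PolyBounded.self
    | apply PolyBounded.add
    | apply PolyBounded.mul
    | apply PolyBounded.pow
    | apply PolyBounded.comp

lemma stepCost_mono {μ Mc Mc' : ℕ} (hm : m ≤ μ) (hMc : Mc ≤ Mc') :
    stepCost r n k m p s b Mc ≤ stepCost r n k μ p s b Mc' := by
  unfold stepCost examineCost columnCost loopCost entryCost termNeighbourCost insertCost
  have h := eval_mono_nat r (show n + m * 2 ^ k * (n + 1 + (2 * b + 3)) ≤
    n + μ * 2 ^ k * (n + 1 + (2 * b + 3)) by gcongr)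
  gcongr

lemma workBits_mono {μ : ℕ} (hm : m ≤ μ) : workBits k m p s ≤ workBits k μ p s := by
  unfold workBits diagBits weightBits
  gcongr

lemma runsWithin_totalCost {μ B : ℕ} (hm : m ≤ μ) (hH : H.FitsBits p) (hs : C.size ≤ s)
    (hB : H.opNorm ≤ B) (xin : BitStr n) {T : ℕ} (hT : totalCost r n k μ p p' t s B ≤ T) :
    RunsWithin T r p p' t H C xin := by
  refine runsWithin_of_le (b := workBits k μ p s + timeBits p' t) hH hs
    ((workBits_mono hm).trans (Nat.le_add_right _ _)) (Nat.le_add_left _ _) xin rfl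
    (le_trans ?_ hT)
  have hMc : ⌈maxTransitions H t⌉₊ ≤ 2 ^ k * μ * n ^ 3 * t * B :=
    Nat.ceil_le.2 (maxTransitions_le hm hB t)
  have h := stepCost_mono (r := r) (n := n) (k := k) (p := p) (s := s)
    (b := workBits k μ p s + timeBits p' t) hm hMc
  unfold totalCost initCost
  dsimp only
  gcongr

end RunningTime

/-! ### Supermartingales -/

section Expectation

variable {α β σ : Type}

/-- The expectation of a function with values in `[0, ∞]`. -/
noncomputable def expect (μ : PMF α) (V : α → ℝ≥0∞) : ℝ≥0∞ := ∑' a, μ a * V a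

lemma expect_pure (a : α) (V : α → ℝ≥0∞) : expect (PMF.pure a) V = V a := by
  classical
  unfold expect
  rw [tsum_eq_single a]
  · simp
  · intro b hb
    simp [PMF.pure_apply, hb]

lemma expect_bind (μ : PMF α) (κ : α → PMF β) (V : β → ℝ≥0∞) :
    expect (μ.bind κ) V = expect μ fun a => expect (κ a) V := by
  unfold expect
  simp only [PMF.bind_apply, ← ENNReal.tsum_mul_right, ← ENNReal.tsum_mul_left]
  rw [ENNReal.tsum_comm]
  simp only [mul_assoc]

lemma expect_mono (μ : PMF α) {V W : α → ℝ≥0∞} (h : ∀ a, V a ≤ W a) : expect μ V ≤ expect μ W :=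
  ENNReal.tsum_le_tsum fun a => mul_le_mul_right (h a) _

lemma expect_iterPMF_le {step : σ → PMF σ} {V : σ → ℝ≥0∞} (hV : ∀ c, expect (step c) V ≤ V c)
    (N : ℕ) (c : σ) : expect (iterPMF step N c) V ≤ V c := by
  induction N generalizing c with
  | zero => simp [iterPMF, expect_pure]
  | succ N ih =>
    rw [iterPMF, expect_bind]
    exact (expect_mono _ ih).trans (hV c)

/-- A nonnegative supermartingale that is at least `1` at `d` bounds the probability of being at `d`. -/
lemma iterPMF_apply_le {step : σ → PMF σ} {V : σ → ℝ≥0∞} (hV : ∀ c, expect (step c) V ≤ V c)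
    {d : σ} (hd : 1 ≤ V d) (N : ℕ) (c : σ) : iterPMF step N c d ≤ V c := by
  refine le_trans ?_ (expect_iterPMF_le hV N c)
  refine le_trans ?_ (ENNReal.le_tsum d)
  simpa using mul_le_mul_right hd (iterPMF step N c d)

end Expectation

/-! ### Discounted waiting times -/

section WaitingTimes

lemma exp_mul_le {θ y : ℝ} (h0 : 0 ≤ θ) (h1 : θ ≤ 1) :
    Real.exp (θ * y) ≤ θ * Real.exp y + (1 - θ) := by
  have := convexOn_exp.2 (Set.mem_univ y) (Set.mem_univ 0) h0 (sub_nonneg.2 h1) (by ring)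
  simpa using this

/-- Flooring an exponential waiting time `τ` of rate `l` to multiples of `δ` does not increase the expectation
of `exp (s τ)`: the left factor over the right factor is at most `l / (l - s)`. -/
lemma one_sub_exp_mul_le {s l δ : ℝ} (hs : 0 ≤ s) (hl : s < l) :
    (1 - Real.exp (-(l * δ))) * (l - s) ≤ l * (1 - Real.exp (-((l - s) * δ))) := by
  have hl0 : 0 < l := hs.trans_lt hl
  have h := exp_mul_le (θ := (l - s) / l) (y := -(l * δ)) (div_nonneg (by linarith) hl0.le)
    ((div_le_one hl0).2 (by linarith))
  rw [show (l - s) / l * -(l * δ) = -((l - s) * δ) by field_simp] at h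
  have h2 := mul_le_mul_of_nonneg_left h hl0.le
  have h3 : l * ((l - s) / l * Real.exp (-(l * δ)) + (1 - (l - s) / l)) =
      (l - s) * Real.exp (-(l * δ)) + s := by field_simp; ring
  rw [h3] at h2
  linarith

/-- The counterpart of `one_sub_exp_mul_le` for the expectation of `exp (-s τ)`, where flooring to multiples
of `δ` costs a factor `exp (s δ)`. -/
lemma one_sub_exp_mul_le' {s l δ : ℝ} (hs : 0 ≤ s) (hl : 0 < l) :
    (1 - Real.exp (-(l * δ))) * (l + s) ≤
      l * (Real.exp (s * δ) * (1 - Real.exp (-((l + s) * δ)))) := by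
  have hl0 : 0 < l + s := by linarith
  have h := exp_mul_le (θ := l / (l + s)) (y := (l + s) * δ) (div_nonneg hl.le hl0.le)
    ((div_le_one hl0).2 (by linarith))
  rw [show l / (l + s) * ((l + s) * δ) = l * δ by field_simp] at h
  have h2 := mul_le_mul_of_nonneg_left h hl0.le
  have h3 : (l + s) * (l / (l + s) * Real.exp ((l + s) * δ) + (1 - l / (l + s))) =
      l * Real.exp ((l + s) * δ) + s := by field_simp; ring
  rw [h3] at h2
  have h4 := mul_le_mul_of_nonneg_left h2 (Real.exp_pos (-(l * δ))).le
  have e1 : Real.exp (-(l * δ)) * Real.exp (l * δ) = 1 := by rw [← Real.exp_add]; simp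
  have e2 : Real.exp (-(l * δ)) * Real.exp ((l + s) * δ) = Real.exp (s * δ) := by
    rw [← Real.exp_add]; congr 1; ring
  have e3 : Real.exp (s * δ) * Real.exp (-((l + s) * δ)) = Real.exp (-(l * δ)) := by
    rw [← Real.exp_add]; congr 1; ring
  have h5 : Real.exp (-(l * δ)) * ((l + s) * Real.exp (l * δ)) = l + s := by
    rw [mul_left_comm, e1, mul_one]
  have h6 : Real.exp (-(l * δ)) * (l * Real.exp ((l + s) * δ) + s) =
      l * Real.exp (s * δ) + s * Real.exp (-(l * δ)) := by
    rw [mul_add, mul_left_comm, e2]; ring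
  rw [h5, h6] at h4
  rw [mul_sub (Real.exp (s * δ)), e3]
  linarith

/-- The expected discounted value after a sample of `D_{K,δ,l}`, when the remaining time is `u`: the
value is `a` if the sample exceeds `u`, and is `exp (-s (u - jδ)) * v` otherwise. -/
lemma truncExp_discount_le {K : ℕ} {δ l s a f u v : ℝ} (hu : 0 < u) (hδ : 0 ≤ δ)
    (hK : u ≤ K * δ)
    (hv : (1 - Real.exp (-(l * δ))) * v ≤ f * (1 - Real.exp (-((l - s) * δ))))
    (ha : ∀ d, 0 ≤ d → a ≤ f * Real.exp (s * d)) :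
    ∑ j : Fin (K + 1), (if (j : ℕ) < K then
        Real.exp (-(l * (j : ℕ) * δ)) - Real.exp (-(l * ((j : ℕ) + 1) * δ))
        else Real.exp (-(l * (j : ℕ) * δ))) *
        (if u ≤ (j : ℕ) * δ then a else Real.exp (-(s * (u - (j : ℕ) * δ))) * v) ≤
      Real.exp (-(s * u)) * f := by
  set w : ℕ → ℝ := fun j => Real.exp (-(l * j * δ)) with hw
  -- the bound for the contribution of the samples from `j δ` on
  set B : ℕ → ℝ := fun j => if u ≤ j * δ then a * w j else
    Real.exp (-(s * u)) * f * Real.exp (-((l - s) * j * δ)) with hB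
  have key : ∀ i : ℕ, (w i - w (i + 1)) *
      (if u ≤ i * δ then a else Real.exp (-(s * (u - i * δ))) * v) ≤ B i - B (i + 1) := by
    intro i
    by_cases h1 : u ≤ i * δ
    · have h2 : u ≤ ((i + 1 : ℕ) : ℝ) * δ := by push_cast; linarith
      simp only [hB, if_pos h1, if_pos h2]
      exact le_of_eq (by ring)
    · have h3 : (w i - w (i + 1)) * (Real.exp (-(s * (u - i * δ))) * v) ≤
          Real.exp (-(s * u)) * f * Real.exp (-((l - s) * i * δ)) -
          Real.exp (-(s * u)) * f * Real.exp (-((l - s) * (i + 1 : ℕ) * δ)) := by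
        have e1 : w (i + 1) = w i * Real.exp (-(l * δ)) := by
          simp only [hw]; rw [← Real.exp_add]; congr 1; push_cast; ring
        have e2 : Real.exp (-((l - s) * (i + 1 : ℕ) * δ)) =
            Real.exp (-((l - s) * i * δ)) * Real.exp (-((l - s) * δ)) := by
          rw [← Real.exp_add]; congr 1; push_cast; ring
        have e3 : w i * Real.exp (-(s * (u - i * δ))) =
            Real.exp (-(s * u)) * Real.exp (-((l - s) * i * δ)) := by
          simp only [hw]; rw [← Real.exp_add, ← Real.exp_add]; congr 1; ring
        rw [e1, e2]
        have := mul_le_mul_of_nonneg_left hv (show 0 ≤ w i * Real.exp (-(s * (u - i * δ))) by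
          simp only [hw]; positivity)
        calc _ = w i * Real.exp (-(s * (u - i * δ))) * ((1 - Real.exp (-(l * δ))) * v) := by ring
          _ ≤ _ := this
          _ = _ := by rw [e3]; ring
      have h4 : B (i + 1) ≤
          Real.exp (-(s * u)) * f * Real.exp (-((l - s) * (i + 1 : ℕ) * δ)) := by
        simp only [hB]
        split_ifs with h2
        · have h5 := mul_le_mul_of_nonneg_right (ha _ (sub_nonneg.2 h2))
            (show 0 ≤ w (i + 1) by simp only [hw]; positivity)
          refine h5.trans (le_of_eq ?_)
          simp only [hw]
          rw [mul_assoc f, mul_comm (Real.exp (-(s * u))) f, mul_assoc f, ← Real.exp_add,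
            ← Real.exp_add]
          congr 2; ring
        · exact le_rfl
      have h5 : B i = Real.exp (-(s * u)) * f * Real.exp (-((l - s) * i * δ)) := by
        simp only [hB, if_neg h1]
      rw [if_neg h1, h5]
      linarith
  have hsum := Finset.sum_le_sum fun i (_ : i ∈ Finset.range K) => key i
  rw [Finset.sum_range_sub'] at hsum
  have hB0 : B 0 = Real.exp (-(s * u)) * f := by
    simp only [hB]
    rw [if_neg (by simpa using hu)]
    simp
  have hBK : B K = a * w K := by simp only [hB, if_pos hK]
  rw [Fin.sum_univ_castSucc]
  simp only [Fin.val_castSucc, Fin.is_lt, if_true, Fin.val_last, lt_irrefl, if_false, if_pos hK]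
  rw [Fin.sum_univ_eq_sum_range (fun i => (Real.exp (-(l * (i : ℕ) * δ)) -
    Real.exp (-(l * ((i : ℕ) + 1) * δ))) *
      (if u ≤ (i : ℕ) * δ then a else Real.exp (-(s * (u - (i : ℕ) * δ))) * v)) K]
  simp only [hw, Nat.cast_add, Nat.cast_one] at hsum hBK
  rw [hB0, hBK] at hsum
  linarith

/-- The expectation of a function of the configuration after a jump, when the function is bounded by
`a` after time `t` and by a discounted function of the new string before. -/
lemma expect_jump_le {α : Type} [Fintype α] {p' t : ℕ} {g : ℚ} {w : α → ℚ} (hw : ∀ y, 0 ≤ w y)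
    (hw1 : ∑ y, w y = 1) (x : α) (c : ℕ) (τ : ℚ) (V : Config α → ℝ≥0∞) {s a f u : ℝ}
    (hu : 0 < u) (hut : u ≤ 2 * t) {v : α → ℝ} (hv0 : ∀ y, 0 ≤ v y)
    (hV : ∀ (j : ℕ) (y : α), V (.run c y (τ + j * delta p' t)) ≤
      if u ≤ j * ((delta p' t : ℚ) : ℝ) then ENNReal.ofReal a
      else ENNReal.ofReal (Real.exp (-(s * (u - j * ((delta p' t : ℚ) : ℝ)))) * v y))
    (hv : (1 - Real.exp (-(|(g : ℝ)| * ((delta p' t : ℚ) : ℝ)))) * ∑ y, (w y : ℝ) * v y ≤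
      f * (1 - Real.exp (-((|(g : ℝ)| - s) * ((delta p' t : ℚ) : ℝ)))))
    (ha0 : 0 ≤ a) (ha : ∀ d, 0 ≤ d → a ≤ f * Real.exp (s * d)) :
    expect ((waitingTime p' t g).bind fun j => (weighted w x).bind fun y =>
      PMF.pure (.run c y (τ + (j : ℕ) * delta p' t))) V ≤
      ENNReal.ofReal (Real.exp (-(s * u)) * f) := by
  have hδ := delta_nonneg p' t
  have hweight : ∀ y, weighted w x y = ENNReal.ofReal (w y) := by
    intro y
    have h1 : ∑ y, ENNReal.ofReal (w y) = 1 := by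
      rw [← ENNReal.ofReal_sum_of_nonneg fun y _ => by exact_mod_cast hw y]
      rw [← Rat.cast_sum, hw1]
      simp
    rw [weighted, dif_pos h1]
    rfl
  have hexp : ∀ z : ℝ, 0 ≤ z → ∀ j : ℕ, Real.exp (-(z * (j + 1) * ((delta p' t : ℚ) : ℝ))) ≤
      Real.exp (-(z * j * ((delta p' t : ℚ) : ℝ))) := by
    intro z hz j
    rw [Real.exp_le_exp]
    nlinarith [mul_nonneg hz hδ]
  refine le_trans ?_ (ENNReal.ofReal_le_ofReal (truncExp_discount_le (K := truncK p' t)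
    (l := |(g : ℝ)|) (v := ∑ y, (w y : ℝ) * v y) hu hδ (hut.trans ?_) hv ha))
  · rw [ENNReal.ofReal_sum_of_nonneg]
    · rw [expect_bind, expect, tsum_fintype]
      refine Finset.sum_le_sum fun j _ => ?_
      rw [expect_bind, expect, tsum_fintype, ENNReal.ofReal_mul]
      · refine mul_le_mul' le_rfl ?_
        simp only [expect_pure, hweight]
        split_ifs with h
        · refine (Finset.sum_le_sum fun y _ => mul_le_mul' le_rfl ((hV j y).trans
            (if_pos h).le)).trans ?_
          rw [← Finset.sum_mul, ← ENNReal.ofReal_sum_of_nonneg fun y _ => by exact_mod_cast hw y,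
            ← Rat.cast_sum, hw1]
          simp
        · refine (Finset.sum_le_sum fun y _ => mul_le_mul' le_rfl ((hV j y).trans
            (if_neg h).le)).trans ?_
          rw [Finset.mul_sum, ENNReal.ofReal_sum_of_nonneg]
          · refine Finset.sum_le_sum fun y _ => ?_
            rw [← ENNReal.ofReal_mul (by exact_mod_cast hw y)]
            exact le_of_eq (by congr 1; ring)
          · intro y _
            have : (0 : ℝ) ≤ w y := by exact_mod_cast hw y
            have := hv0 y
            positivity
      · split_ifs
        · exact sub_nonneg.2 (hexp _ (abs_nonneg _) _)
        · positivity
    · intro j _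
      refine mul_nonneg ?_ ?_
      · split_ifs
        · exact sub_nonneg.2 (hexp _ (abs_nonneg _) _)
        · positivity
      · split_ifs
        · exact ha0
        · refine mul_nonneg (Real.exp_nonneg _) (Finset.sum_nonneg fun y _ => mul_nonneg ?_ (hv0 y))
          exact_mod_cast hw y
  · have := truncK_mul_delta p' t
    have h2 : ((truncK p' t : ℚ) * delta p' t : ℚ) = ((2 * t : ℚ)) := this
    have h3 : (truncK p' t : ℝ) * ((delta p' t : ℚ) : ℝ) = 2 * t := by exact_mod_cast h2
    rw [h3]

end WaitingTimes

/-! ### The quadratic form of the generator -/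

section QuadraticForm

variable {n k m : ℕ} (H : Hamiltonian n k m) (φ : BitStr n → ℚ)

/-- The entries `⟨φ|x⟩⟨x|H|y⟩⟨y|φ⟩` that are removed by the fixed node construction. -/
def removedPart (x y : Supp φ) : ℚ :=
  if x = y then 0 else max (φ x.1 * H.matrix x.1 y.1 * φ y.1) 0

lemma removedPart_comm (x y : Supp φ) : removedPart H φ x y = removedPart H φ y x := by
  unfold removedPart
  rw [H.matrix_symm x.1 y.1, show φ x.1 * H.matrix y.1 x.1 * φ y.1 =
    φ y.1 * H.matrix y.1 x.1 * φ x.1 by ring]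
  simp only [eq_comm]

lemma removedPart_nonneg (x y : Supp φ) : 0 ≤ removedPart H φ x y := by
  unfold removedPart
  split_ifs
  · exact le_rfl
  · exact le_max_right _ _

lemma sq_mul_suppGenerator (x y : Supp φ) :
    φ x.1 ^ 2 * suppGenerator H φ y x =
      removedPart H φ x y - φ x.1 * H.matrix x.1 y.1 * φ y.1 -
        if x = y then ∑ z, removedPart H φ x z else 0 := by
  have hx := x.2
  by_cases hxy : x = y
  · subst hxy
    have h1 : ∀ z : Supp φ, removedPart H φ x z = if SPlus (H.matrix.submatrix
        (Subtype.val : Supp φ → _) Subtype.val) (fun x => φ x.1) x z then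
        φ x.1 ^ 2 * (H.matrix x.1 z.1 * (φ z.1 / φ x.1)) else 0 := by
      intro z
      have h2 : φ x.1 ^ 2 * (H.matrix x.1 z.1 * (φ z.1 / φ x.1)) =
        φ x.1 * H.matrix x.1 z.1 * φ z.1 := by field_simp
      rw [h2]
      simp only [SPlus, Matrix.submatrix_apply, removedPart]
      by_cases hxz : x = z
      · simp [hxz]
      · simp only [hxz, if_false, ne_eq, not_false_eq_true, true_and]
        split_ifs with h
        · exact max_eq_left h.le
        · exact max_eq_right (not_lt.1 h)
    simp only [suppGenerator, generator, fixedNode, if_true, Matrix.submatrix_apply, div_self hx,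
      mul_one]
    rw [Finset.sum_congr rfl fun z _ => h1 z, ← Finset.sum_filter, ← Finset.mul_sum]
    simp only [removedPart, if_true]
    ring
  · rw [suppGenerator_of_ne H φ (Ne.symm hxy), rate, if_neg hxy, removedPart, if_neg hxy]
    split_ifs with h
    · rw [max_eq_left h.le]; ring
    · rw [max_eq_right (not_lt.1 h)]
      field_simp
      ring

/-- Detailed balance with respect to `φ ^ 2`. -/
lemma sq_mul_suppGenerator_comm (x y : Supp φ) :
    φ x.1 ^ 2 * suppGenerator H φ y x = φ y.1 ^ 2 * suppGenerator H φ x y := by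
  rw [sq_mul_suppGenerator, sq_mul_suppGenerator, removedPart_comm, H.matrix_symm x.1 y.1]
  by_cases h : x = y
  · subst h; rfl
  · rw [if_neg h, if_neg (Ne.symm h)]; ring

/-- The total rate out of `x`, up to a factor, is the residual `⟨x|H|φ⟩`. -/
lemma sq_mul_sum_suppGenerator (x : Supp φ) :
    φ x.1 ^ 2 * ∑ y, suppGenerator H φ y x = -(φ x.1 * ∑ y, H.matrix x.1 y * φ y) := by
  rw [Finset.mul_sum, Finset.sum_congr rfl fun y _ => sq_mul_suppGenerator H φ x y]
  rw [Finset.sum_sub_distrib, Finset.sum_sub_distrib, Finset.sum_ite_eq, if_pos (Finset.mem_univ _),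
    sub_sub_cancel_left, Finset.mul_sum,
    sum_supp (φ := φ) (f := fun y => φ x.1 * H.matrix x.1 y * φ y) fun y hy => by simp [hy]]
  simp only [mul_assoc]

variable {H φ}

/-- The quadratic form of the fixed node Hamiltonian dominates that of `H`. -/
lemma quadraticForm_suppGenerator_ge {ε : ℝ}
    (hH : ∀ v : BitStr n → ℝ, ε * ∑ x, v x ^ 2 ≤ ∑ x, ∑ y, v x * (H.matrix x y : ℝ) * v y)
    (f : Supp φ → ℝ) :
    ε * ∑ x : Supp φ, (φ x.1 : ℝ) ^ 2 * f x ^ 2 ≤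
      ∑ x, ∑ y, -((φ x.1 : ℝ) ^ 2 * (suppGenerator H φ y x : ℝ)) * f x * f y := by
  classical
  have hq : ∀ x y : Supp φ, ((φ x.1 : ℝ) ^ 2 * (suppGenerator H φ y x : ℝ)) =
      (removedPart H φ x y : ℝ) - (φ x.1 : ℝ) * (H.matrix x.1 y.1 : ℝ) * (φ y.1 : ℝ) -
        if x = y then ∑ z, (removedPart H φ x z : ℝ) else 0 := by
    intro x y
    have := congrArg (fun q : ℚ => (q : ℝ)) (sq_mul_suppGenerator H φ x y)
    by_cases hxy : x = y
    · simp only [if_pos hxy] at this ⊢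
      push_cast at this
      exact this
    · simp only [if_neg hxy, sub_zero] at this ⊢
      push_cast at this
      exact this
  let v : BitStr n → ℝ := fun x => if h : φ x ≠ 0 then φ x * f ⟨x, h⟩ else 0
  have hv : ∀ x : Supp φ, v x.1 = φ x.1 * f x := fun x => by simp only [v]; rw [dif_pos x.2]
  have hv0 : ∀ x, φ x = 0 → v x = 0 := fun x hx => by simp only [v]; rw [dif_neg (not_not.2 hx)]
  have h1 := hH v
  rw [← sum_supp (φ := φ) (f := fun x => v x ^ 2) fun x hx => by simp [hv0 x hx],
    ← sum_supp (φ := φ) (f := fun x => ∑ y, v x * (H.matrix x y : ℝ) * v y)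
      fun x hx => by simp [hv0 x hx]] at h1
  have h2 : ∀ x : Supp φ, ∑ y, v x.1 * (H.matrix x.1 y : ℝ) * v y =
      ∑ y : Supp φ, v x.1 * (H.matrix x.1 y.1 : ℝ) * v y.1 := fun x =>
    (sum_supp (φ := φ) (f := fun y => v x.1 * (H.matrix x.1 y : ℝ) * v y)
      fun y hy => by simp [hv0 y hy]).symm
  rw [Finset.sum_congr rfl fun x _ => h2 x] at h1
  simp only [hv, mul_pow] at h1
  refine h1.trans ?_
  -- the difference of the two forms is half of a sum of squares
  have h3 : 0 ≤ ∑ x, ∑ y, (removedPart H φ x y : ℝ) * (f x - f y) ^ 2 :=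
    Finset.sum_nonneg fun x _ => Finset.sum_nonneg fun y _ =>
      mul_nonneg (by exact_mod_cast removedPart_nonneg H φ x y) (sq_nonneg _)
  have h4 : ∑ x, ∑ y, (removedPart H φ x y : ℝ) * f y ^ 2 =
      ∑ x, ∑ y, (removedPart H φ x y : ℝ) * f x ^ 2 := by
    rw [Finset.sum_comm]
    refine Finset.sum_congr rfl fun x _ => Finset.sum_congr rfl fun y _ => ?_
    rw [removedPart_comm]
  have h5 : ∑ x, ∑ y, (removedPart H φ x y : ℝ) * (f x - f y) ^ 2 =
      2 * (∑ x, ∑ y, (removedPart H φ x y : ℝ) * f x ^ 2 -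
        ∑ x, ∑ y, (removedPart H φ x y : ℝ) * (f x * f y)) := by
    rw [mul_sub, two_mul, ← h4]
    nth_rewrite 2 [h4]
    simp only [Finset.mul_sum, ← Finset.sum_add_distrib, ← Finset.sum_sub_distrib]
    refine Finset.sum_congr rfl fun x _ => Finset.sum_congr rfl fun y _ => ?_
    ring
  have h6 : ∑ x, ∑ y, -((φ x.1 : ℝ) ^ 2 * (suppGenerator H φ y x : ℝ)) * f x * f y =
      ∑ x, ∑ y : Supp φ, φ x.1 * f x * (H.matrix x.1 y.1 : ℝ) * (φ y.1 * f y) +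
      (∑ x, ∑ y, (removedPart H φ x y : ℝ) * f x ^ 2 -
        ∑ x, ∑ y, (removedPart H φ x y : ℝ) * (f x * f y)) := by
    simp only [← Finset.sum_add_distrib, ← Finset.sum_sub_distrib]
    refine Finset.sum_congr rfl fun x _ => ?_
    have : ∀ y, -((φ x.1 : ℝ) ^ 2 * (suppGenerator H φ y x : ℝ)) * f x * f y =
        φ x.1 * f x * (H.matrix x.1 y.1 : ℝ) * (φ y.1 * f y) -
        (removedPart H φ x y : ℝ) * (f x * f y) +
        if x = y then (∑ z, (removedPart H φ x z : ℝ)) * f x * f y else 0 := by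
      intro y
      rw [hq]
      split_ifs <;> ring
    simp only [this, Finset.sum_add_distrib, Finset.sum_sub_distrib, Finset.sum_ite_eq,
      Finset.mem_univ, if_true]
    rw [← Finset.sum_mul]
    ring
  rw [h6]
  linarith

/-- The least eigenvalue bounds the quadratic form from below. -/
lemma mul_sum_sq_le_of_le_groundEnergy {ι : Type*} [Fintype ι] [DecidableEq ι] {A : Matrix ι ι ℝ}
    (hA : ∀ x y, A x y = A y x) {ε : ℝ} (hε : ε ≤ groundEnergy A) (v : ι → ℝ) :
    ε * ∑ x, v x ^ 2 ≤ ∑ x, ∑ y, v x * A x y * v y := by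
  have hB : (A - ε • (1 : Matrix ι ι ℝ)).IsHermitian := by
    ext x y
    simp only [Matrix.conjTranspose_apply, Matrix.sub_apply, Matrix.smul_apply, star_trivial, hA y x,
      Matrix.one_apply, eq_comm]
  have hpsd : (A - ε • (1 : Matrix ι ι ℝ)).PosSemidef := by
    rw [hB.posSemidef_iff_eigenvalues_nonneg]
    intro j
    have h1 := hB.mulVec_eigenvectorBasis j
    have h2 : Module.End.HasEigenvalue (Matrix.toLin' A) (hB.eigenvalues j + ε) := by
      refine Module.End.hasEigenvalue_of_hasEigenvector
        (x := (hB.eigenvectorBasis j).ofLp) ⟨?_, ?_⟩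
      · rw [Module.End.mem_eigenspace_iff, Matrix.toLin'_apply]
        rw [Matrix.sub_mulVec, Matrix.smul_mulVec, Matrix.one_mulVec, sub_eq_iff_eq_add] at h1
        rw [h1, add_smul]
      · intro h0
        have h3 := hB.eigenvectorBasis.orthonormal.ne_zero j
        exact h3 (by ext i; exact congrFun h0 i)
    have h3 : groundEnergy A ≤ hB.eigenvalues j + ε :=
      csInf_le (Set.Finite.bddBelow (Module.End.finite_hasEigenvalue _)) h2
    simp only [Pi.zero_apply]
    linarith
  have h := hpsd.dotProduct_mulVec_nonneg v
  rw [Matrix.sub_mulVec, Matrix.smul_mulVec, Matrix.one_mulVec, dotProduct_sub, dotProduct_smul,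
    sub_nonneg] at h
  simp only [star_trivial, dotProduct, Matrix.mulVec, smul_eq_mul, Finset.mul_sum] at h
  rw [Finset.mul_sum]
  simpa only [pow_two, mul_assoc] using h

end QuadraticForm

/-! ### A superharmonic function -/

section Potential

/-- A matrix with nonpositive off-diagonal entries and positive definite quadratic form has a
nonnegative inverse. -/
lemma exists_nonneg_mulVec_eq {ι : Type*} [Fintype ι] {M : Matrix ι ι ℝ}
    (hoff : ∀ x y, x ≠ y → M x y ≤ 0)
    (hpos : ∀ v : ι → ℝ, v ≠ 0 → 0 < ∑ x, ∑ y, v x * M x y * v y) {b : ι → ℝ} (hb : ∀ x, 0 ≤ b x) :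
    ∃ h : ι → ℝ, (∀ x, 0 ≤ h x) ∧ ∀ x, ∑ y, M x y * h y = b x := by
  have hinj : Function.Injective M.mulVecLin := by
    rw [injective_iff_map_eq_zero]
    intro v hv
    by_contra hne
    have h1 := hpos v hne
    have h2 : ∀ x, ∑ y, v x * M x y * v y = v x * (M.mulVec v) x := by
      intro x; simp [Matrix.mulVec, dotProduct, Finset.mul_sum, mul_assoc]
    rw [Matrix.mulVecLin_apply] at hv
    simp [h2, hv] at h1
  obtain ⟨h, hh⟩ := LinearMap.injective_iff_surjective.1 hinj b
  have hh' : ∀ x, ∑ y, M x y * h y = b x := fun x => congrFun hh x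
  refine ⟨h, ?_, hh'⟩
  -- test the equation with the negative part of the solution
  by_contra hneg
  push Not at hneg
  obtain ⟨x₀, hx₀⟩ := hneg
  have h1 := hpos (fun x => max (-h x) 0) (fun h0 => by
    have := congrFun h0 x₀
    simp only [Pi.zero_apply, max_eq_right_iff] at this
    linarith)
  have h2 : 0 ≤ ∑ x, ∑ y, max (-h x) 0 * M x y * h y := by
    refine Finset.sum_nonneg fun x _ => ?_
    simp only [mul_assoc]
    rw [← Finset.mul_sum, hh']
    exact mul_nonneg (le_max_right _ _) (hb x)
  have h3 : ∑ x, ∑ y, max (-h x) 0 * M x y * max (-h y) 0 + ∑ x, ∑ y, max (-h x) 0 * M x y * h y =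
      ∑ x, ∑ y, max (-h x) 0 * M x y * max (h y) 0 := by
    simp only [← Finset.sum_add_distrib]
    refine Finset.sum_congr rfl fun x _ => Finset.sum_congr rfl fun y _ => ?_
    have : max (h y) 0 = max (-h y) 0 + h y := by
      rcases le_total 0 (h y) with h | h
      · rw [max_eq_left h, max_eq_right (by linarith)]; ring
      · rw [max_eq_right h, max_eq_left (by linarith)]; ring
    rw [this]; ring
  have h4 : ∑ x, ∑ y, max (-h x) 0 * M x y * max (h y) 0 ≤ 0 := by
    refine Finset.sum_nonpos fun x _ => Finset.sum_nonpos fun y _ => ?_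
    by_cases hxy : x = y
    · subst hxy
      rcases le_total 0 (h x) with h | h
      · rw [max_eq_right (by linarith)]; simp
      · rw [max_eq_right h]; simp
    · exact mul_nonpos_of_nonpos_of_nonneg
        (mul_nonpos_of_nonneg_of_nonpos (le_max_right _ _) (hoff x y hxy)) (le_max_right _ _)
  linarith

variable {n k m : ℕ} {H : Hamiltonian n k m} {φ : BitStr n → ℚ}

open Classical in
/-- A function on the set `A` that decreases at rate `ε / 2` under the chain killed outside of `A`. It is
obtained by adding to the indicator of `A` the solution of a linear system. -/
lemma exists_superharmonic {ε : ℝ} (hε : 0 < ε)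
    (hH : ∀ v : BitStr n → ℝ, ε * ∑ x, v x ^ 2 ≤ ∑ x, ∑ y, v x * (H.matrix x y : ℝ) * v y)
    (A : Set (Supp φ)) (hA : ∀ x ∈ A, ∑ z, suppGenerator H φ z x = 0) {B : ℝ} (hB0 : 0 ≤ B)
    (hB : ∀ x ∈ A, (φ x.1 : ℝ) ^ 2 ≤ B) :
    ∃ f : Supp φ → ℝ, (∀ x ∈ A, 1 ≤ f x) ∧ (∀ x ∉ A, f x = 0) ∧
      (∀ x ∈ A, ∑ y, (suppGenerator H φ y x : ℝ) * f y ≤ -(ε / 2) * f x) ∧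
      ∀ x ∈ A, (φ x.1 : ℝ) ^ 2 * (f x - 1) ^ 2 ≤ 2 ^ n * B := by
  set Q : Supp φ → Supp φ → ℝ := fun x y => -((φ x.1 : ℝ) ^ 2 * (suppGenerator H φ y x : ℝ)) with hQ
  set a : Supp φ → ℝ := fun x => if x ∈ A then 1 else 0 with ha
  have ha0 : ∀ x, 0 ≤ a x := fun x => by simp only [ha]; split_ifs <;> norm_num
  have ha1 : ∀ x, a x ≤ 1 := fun x => by simp only [ha]; split_ifs <;> norm_num
  have haA : ∀ x ∈ A, a x = 1 := fun x hx => by simp only [ha, if_pos hx]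
  have haA' : ∀ x ∉ A, a x = 0 := fun x hx => by simp only [ha, if_neg hx]
  have haa : ∀ x, a x * a x = a x := fun x => by simp only [ha]; split_ifs <;> norm_num
  have hφ : ∀ x : Supp φ, 0 < (φ x.1 : ℝ) ^ 2 := fun x => by
    have : (φ x.1 : ℝ) ≠ 0 := by exact_mod_cast x.2
    positivity
  have hQoff : ∀ x y, x ≠ y → Q x y ≤ 0 := by
    intro x y hxy
    have : (0 : ℝ) ≤ suppGenerator H φ y x := by
      exact_mod_cast suppGenerator_nonneg H φ (Ne.symm hxy)
    have := mul_nonneg (hφ x).le this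
    simp only [hQ]; linarith
  -- on `A`, the form of the killed chain shifted by `ε / 2`; the identity outside of `A`
  let M : Matrix (Supp φ) (Supp φ) ℝ := fun x y => a x * Q x y * a y +
    if x = y then (1 - a x) - ε / 2 * (a x * (φ x.1 : ℝ) ^ 2) else 0
  have hMform : ∀ v : Supp φ → ℝ, ∑ x, ∑ y, v x * M x y * v y =
      ∑ x, ∑ y, Q x y * (a x * v x) * (a y * v y) + ∑ x, (1 - a x) * v x ^ 2 -
        ε / 2 * ∑ x, (φ x.1 : ℝ) ^ 2 * (a x * v x) ^ 2 := by
    intro v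
    rw [Finset.mul_sum, ← Finset.sum_add_distrib, ← Finset.sum_sub_distrib]
    refine Finset.sum_congr rfl fun x _ => ?_
    have : ∀ y, v x * M x y * v y = Q x y * (a x * v x) * (a y * v y) +
        if x = y then v x * ((1 - a x) - ε / 2 * (a x * (φ x.1 : ℝ) ^ 2)) * v y else 0 := by
      intro y; simp only [M]; split_ifs <;> ring
    simp only [this, Finset.sum_add_distrib, Finset.sum_ite_eq, Finset.mem_univ, if_true]
    linear_combination (-(ε / 2) * (φ x.1 : ℝ) ^ 2 * v x ^ 2) * (haa x).symm
  have hMge : ∀ v : Supp φ → ℝ, ε / 2 * ∑ x, (φ x.1 : ℝ) ^ 2 * (a x * v x) ^ 2 +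
      ∑ x, (1 - a x) * v x ^ 2 ≤ ∑ x, ∑ y, v x * M x y * v y := by
    intro v
    have h1 := quadraticForm_suppGenerator_ge hH (fun x => a x * v x)
    rw [hMform]
    simp only [hQ] at h1 ⊢
    linarith
  have hMpos : ∀ v : Supp φ → ℝ, v ≠ 0 → 0 < ∑ x, ∑ y, v x * M x y * v y := by
    intro v hv
    refine lt_of_lt_of_le ?_ (hMge v)
    rw [Finset.mul_sum, ← Finset.sum_add_distrib]
    obtain ⟨x₀, hx₀⟩ := Function.ne_iff.1 hv
    have hx₀' : 0 < v x₀ ^ 2 := by have : v x₀ ≠ 0 := hx₀; positivity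
    refine Finset.sum_pos' (fun x _ => ?_) ⟨x₀, Finset.mem_univ _, ?_⟩
    · have := sub_nonneg.2 (ha1 x)
      positivity
    · by_cases hx : x₀ ∈ A
      · have := hφ x₀
        rw [haA x₀ hx, one_mul, sub_self, zero_mul, add_zero]
        positivity
      · rw [haA' x₀ hx]; simpa using hx₀'
  obtain ⟨h, hh0, hh⟩ := exists_nonneg_mulVec_eq (M := M) (fun x y hxy => by
      simp only [M, if_neg hxy, add_zero]
      have := mul_nonneg (mul_nonneg (ha0 x) (ha0 y)) (neg_nonneg.2 (hQoff x y hxy))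
      linarith) hMpos (b := fun x => ε / 2 * (a x * (φ x.1 : ℝ) ^ 2)) (fun x => by
        have := ha0 x; positivity)
  have hrow : ∀ x, ∑ y, M x y * h y = a x * ∑ y, Q x y * (a y * h y) +
      ((1 - a x) - ε / 2 * (a x * (φ x.1 : ℝ) ^ 2)) * h x := by
    intro x
    have : ∀ y, M x y * h y = a x * (Q x y * (a y * h y)) +
        if x = y then ((1 - a x) - ε / 2 * (a x * (φ x.1 : ℝ) ^ 2)) * h y else 0 := by
      intro y; simp only [M]; split_ifs <;> ring
    simp only [this, Finset.sum_add_distrib, Finset.sum_ite_eq, Finset.mem_univ, if_true,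
      Finset.mul_sum]
  have hoffA : ∀ x ∉ A, h x = 0 := by
    intro x hx
    have := hh x
    rw [hrow, haA' x hx] at this
    simpa using this
  have hah : ∀ x, a x * h x = h x := by
    intro x
    by_cases hx : x ∈ A
    · rw [haA x hx, one_mul]
    · rw [hoffA x hx, mul_zero]
  refine ⟨fun x => a x + h x, fun x hx => ?_, fun x hx => ?_, fun x hx => ?_, fun x hx => ?_⟩
  · simp only [haA x hx]; linarith [hh0 x]
  · simp only [haA' x hx, hoffA x hx, add_zero]
  · have h1 := hh x
    rw [hrow, haA x hx] at h1
    simp only [hah, one_mul, sub_self, zero_sub] at h1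
    have h2 : ∑ y, Q x y = 0 := by
      have := hA x hx
      have h3 : ∑ z, (suppGenerator H φ z x : ℝ) = 0 := by exact_mod_cast this
      simp only [hQ, Finset.sum_neg_distrib, ← Finset.mul_sum, h3, mul_zero, neg_zero]
    have h3 : ∑ y, Q x y ≤ ∑ y, Q x y * a y := by
      refine Finset.sum_le_sum fun y _ => ?_
      by_cases hxy : x = y
      · subst hxy; rw [haA x hx, mul_one]
      · nlinarith [hQoff x y hxy, ha1 y]
    have h4 : ∑ y, Q x y * (a y + h y) =
        -((φ x.1 : ℝ) ^ 2 * ∑ y, (suppGenerator H φ y x : ℝ) * (a y + h y)) := by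
      simp only [hQ, Finset.mul_sum, ← Finset.sum_neg_distrib]
      exact Finset.sum_congr rfl fun y _ => by ring
    have h5 : ∑ y, Q x y * (a y + h y) = ∑ y, Q x y * a y + ∑ y, Q x y * h y := by
      simp only [mul_add, Finset.sum_add_distrib]
    have h6 : (φ x.1 : ℝ) ^ 2 * ∑ y, (suppGenerator H φ y x : ℝ) * (a y + h y) ≤
        (φ x.1 : ℝ) ^ 2 * (-(ε / 2) * (a x + h x)) := by
      rw [haA x hx]
      nlinarith
    exact le_of_mul_le_mul_left h6 (hφ x)
  · have h1 := hMge h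
    have h2 : ∑ x, ∑ y, h x * M x y * h y = ε / 2 * ∑ x, (φ x.1 : ℝ) ^ 2 * h x := by
      rw [Finset.mul_sum]
      refine Finset.sum_congr rfl fun x _ => ?_
      simp only [mul_assoc, ← Finset.mul_sum]
      rw [hh]
      linear_combination (ε / 2 * (φ x.1 : ℝ) ^ 2) * hah x
    have h3 : 0 ≤ ∑ x, (1 - a x) * h x ^ 2 := Finset.sum_nonneg fun x _ =>
      mul_nonneg (sub_nonneg.2 (ha1 x)) (sq_nonneg _)
    simp only [hah] at h1
    rw [h2] at h1
    have h4 : ∑ x : Supp φ, (φ x.1 : ℝ) ^ 2 * h x ^ 2 ≤ ∑ x : Supp φ, (φ x.1 : ℝ) ^ 2 * h x := by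
      refine le_of_mul_le_mul_left ?_ (half_pos hε)
      linarith
    -- AM-GM
    have h5 : ∑ x : Supp φ, (φ x.1 : ℝ) ^ 2 * h x ≤
        (∑ x : Supp φ, (φ x.1 : ℝ) ^ 2 * h x ^ 2 + ∑ x : Supp φ, a x * (φ x.1 : ℝ) ^ 2) / 2 := by
      rw [← Finset.sum_add_distrib, Finset.sum_div]
      refine Finset.sum_le_sum fun x _ => ?_
      have h6 : 0 ≤ (φ x.1 : ℝ) ^ 2 * (h x - a x) ^ 2 := by positivity
      have h7 : (φ x.1 : ℝ) ^ 2 * (h x - a x) ^ 2 =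
          (φ x.1 : ℝ) ^ 2 * h x ^ 2 + a x * (φ x.1 : ℝ) ^ 2 - 2 * ((φ x.1 : ℝ) ^ 2 * h x) := by
        linear_combination (-2 * (φ x.1 : ℝ) ^ 2) * hah x + (φ x.1 : ℝ) ^ 2 * haa x
      linarith
    have h6 : ∑ x : Supp φ, a x * (φ x.1 : ℝ) ^ 2 ≤ 2 ^ n * B := by
      have h7 : ∀ x ∈ (Finset.univ : Finset (Supp φ)), a x * (φ x.1 : ℝ) ^ 2 ≤ B := by
        intro x _
        by_cases hx : x ∈ A
        · rw [haA x hx, one_mul]; exact hB x hx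
        · rw [haA' x hx, zero_mul]; exact hB0
      refine (Finset.sum_le_card_nsmul _ _ _ h7).trans ?_
      rw [nsmul_eq_mul]
      refine mul_le_mul_of_nonneg_right ?_ hB0
      have h8 : Fintype.card (Supp φ) ≤ 2 ^ n := by
        refine (Fintype.card_subtype_le _).trans ?_
        simp
      rw [Finset.card_univ]
      exact_mod_cast h8
    have h7 : (φ x.1 : ℝ) ^ 2 * h x ^ 2 ≤ ∑ x : Supp φ, (φ x.1 : ℝ) ^ 2 * h x ^ 2 :=
      Finset.single_le_sum (f := fun x : Supp φ => (φ x.1 : ℝ) ^ 2 * h x ^ 2)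
        (fun x _ => by positivity) (Finset.mem_univ x)
    simp only [haA x hx, add_sub_cancel_left]
    linarith

end Potential

/-! ### One pass through the loop -/

section OnePass

variable {n k m : ℕ} (H : Hamiltonian n k m) (φ : BitStr n → ℚ)

/-- The probability of jumping from `x` to `y`. -/
def jumpProb (x y : Supp φ) : ℚ :=
  if y = x then 0 else suppGenerator H φ y x / |suppGenerator H φ x x|

lemma jumpProb_nonneg (x y : Supp φ) : 0 ≤ jumpProb H φ x y := by
  unfold jumpProb
  split_ifs with h
  · exact le_rfl
  · exact div_nonneg (suppGenerator_nonneg H φ h) (abs_nonneg _)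

variable {H φ}

lemma suppGenerator_self_nonpos {x : Supp φ} (hx : ∑ z, suppGenerator H φ z x = 0) :
    suppGenerator H φ x x ≤ 0 := by
  rw [← Finset.add_sum_erase _ _ (Finset.mem_univ x)] at hx
  have : 0 ≤ ∑ z ∈ Finset.univ.erase x, suppGenerator H φ z x :=
    Finset.sum_nonneg fun z hz => suppGenerator_nonneg H φ (Finset.ne_of_mem_erase hz)
  linarith

lemma abs_mul_sum_jumpProb {x : Supp φ} (hx : ∑ z, suppGenerator H φ z x = 0)
    (hG : suppGenerator H φ x x ≠ 0) (v : Supp φ → ℝ) :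
    |(suppGenerator H φ x x : ℝ)| * ∑ y, (jumpProb H φ x y : ℝ) * v y =
      ∑ y, (suppGenerator H φ y x : ℝ) * v y + |(suppGenerator H φ x x : ℝ)| * v x := by
  have h1 : |(suppGenerator H φ x x : ℝ)| = -(suppGenerator H φ x x : ℝ) :=
    abs_of_nonpos (by exact_mod_cast suppGenerator_self_nonpos hx)
  have hG' : (suppGenerator H φ x x : ℝ) ≠ 0 := by exact_mod_cast hG
  have h2 : ∀ y, |(suppGenerator H φ x x : ℝ)| * ((jumpProb H φ x y : ℝ) * v y) =
      (suppGenerator H φ y x : ℝ) * v y +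
        if y = x then |(suppGenerator H φ x x : ℝ)| * v y else 0 := by
    intro y
    unfold jumpProb
    split_ifs with h
    · subst h; rw [h1]; push_cast; ring
    · push_cast
      have : |(suppGenerator H φ x x : ℝ)| ≠ 0 := abs_ne_zero.2 hG'
      field_simp
      ring
  rw [Finset.mul_sum, Finset.sum_congr rfl fun y _ => h2 y, Finset.sum_add_distrib,
    Finset.sum_ite_eq', if_pos (Finset.mem_univ _)]

lemma sum_jumpProb {x : Supp φ} (hx : ∑ z, suppGenerator H φ z x = 0)
    (hG : suppGenerator H φ x x ≠ 0) : ∑ y, jumpProb H φ x y = 1 := by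
  have h1 := abs_mul_sum_jumpProb hx hG fun _ => 1
  have hx' : ∑ z, (suppGenerator H φ z x : ℝ) = 0 := by exact_mod_cast hx
  have hG' : |(suppGenerator H φ x x : ℝ)| ≠ 0 := abs_ne_zero.2 (by exact_mod_cast hG)
  simp only [mul_one, hx', zero_add] at h1
  have h2 : ∑ y, (jumpProb H φ x y : ℝ) = 1 := mul_left_cancel₀ hG' (by rw [h1, mul_one])
  exact_mod_cast h2

/-- The distribution of the configuration after a jump from `x`. -/
noncomputable def jumpStep (p' t : ℕ) (H : Hamiltonian n k m) (φ : BitStr n → ℚ) (c : ℕ)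
    (x : Supp φ) (τ : ℚ) : PMF (Config (Supp φ)) :=
  (waitingTime p' t (suppGenerator H φ x x)).bind fun j =>
    (weighted (jumpProb H φ x) x).bind fun y =>
      PMF.pure (.run (c + 1) y (τ + (j : ℕ) * delta p' t))

lemma expect_checkStep_le {p p' t : ℕ} {V : Config (Supp φ) → ℝ≥0∞} {c : ℕ} {x : Supp φ} {τ : ℚ}
    (hτ : τ < t) {b : ℝ≥0∞}
    (hrej : ¬ (FitsBits p (φ x.1) ∧ ∑ z, suppGenerator H φ z x = 0 ∧ ¬ maxTransitions H t ≤ c) →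
      V (.halt false) ≤ b)
    (hidle : FitsBits p (φ x.1) → ∑ z, suppGenerator H φ z x = 0 → ¬ maxTransitions H t ≤ c →
      suppGenerator H φ x x = 0 → V (.run c x t) ≤ b)
    (hjump : FitsBits p (φ x.1) → ∑ z, suppGenerator H φ z x = 0 → ¬ maxTransitions H t ≤ c →
      suppGenerator H φ x x ≠ 0 → expect (jumpStep p' t H φ c x τ) V ≤ b) :
    expect (checkStep p p' t H φ (.run c x τ)) V ≤ b := by
  simp only [checkStep]
  rw [if_neg (not_not.2 hτ)]
  by_cases h1 : FitsBits p (φ x.1)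
  swap
  · rw [if_pos h1, expect_pure]
    exact hrej (by tauto)
  rw [if_neg (not_not.2 h1)]
  by_cases h2 : ∑ z, suppGenerator H φ z x = 0
  swap
  · rw [if_pos (Or.inl h2), expect_pure]
    exact hrej (by tauto)
  rw [if_neg (by
    rintro (h | ⟨y, hy, h⟩)
    · exact h h2
    · exact absurd (suppGenerator_nonneg H φ hy) (not_le.2 h))]
  by_cases h3 : maxTransitions H t ≤ c
  · rw [if_pos h3, expect_pure]
    exact hrej (by tauto)
  rw [if_neg h3]
  by_cases h4 : suppGenerator H φ x x = 0
  · rw [if_pos (abs_eq_zero.2 h4), expect_pure]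
    exact hidle h1 h2 h3 h4
  · rw [if_neg (abs_ne_zero.2 h4)]
    exact hjump h1 h2 h3 h4

/-- A time sample exceeds the remaining time if and only if the loop ends. -/
lemma remaining_le_iff {p' t : ℕ} (τ : ℚ) (j : ℕ) :
    (t : ℝ) - (τ : ℝ) ≤ j * ((delta p' t : ℚ) : ℝ) ↔ ¬ τ + j * delta p' t < t := by
  rw [not_lt, sub_le_iff_le_add']
  exact_mod_cast Iff.rfl

end OnePass

/-! ### Soundness -/

section Soundness

variable {n k m : ℕ} {H : Hamiltonian n k m} {φ : BitStr n → ℚ}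

lemma FitsBits.one_le_two_pow_mul_abs {p : ℕ} {q : ℚ} (h : FitsBits p q) (hq : q ≠ 0) :
    1 ≤ 2 ^ p * |(q : ℝ)| := by
  have h1 := (h.inv).abs_le
  rw [abs_inv] at h1
  have h2 : (1 : ℚ) ≤ 2 ^ p * |q| := by
    have h3 : 0 < |q| := abs_pos.2 hq
    have := mul_le_mul_of_nonneg_right h1 h3.le
    rwa [inv_mul_cancel₀ h3.ne'] at this
  exact_mod_cast h2

open Classical in
/-- An upper bound for the probability of acceptance from a configuration, when the test function `f`
decreases at rate `s` along the killed chain. -/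
noncomputable def acceptBound (t : ℕ) (s : ℝ) (f : Supp φ → ℝ) : Config (Supp φ) → ℝ≥0∞
  | .halt b => if b then 1 else 0
  | .run _ x τ => if τ < 0 then ⊤ else if τ < t then
      ENNReal.ofReal (Real.exp (-(s * ((t : ℝ) - τ))) * f x) else 1

lemma expect_acceptBound_le {p p' t : ℕ} {ε : ℝ} (hε : 0 < ε)
    (hH : ∀ v : BitStr n → ℝ, ε * ∑ x, v x ^ 2 ≤ ∑ x, ∑ y, v x * (H.matrix x y : ℝ) * v y)
    {f : Supp φ → ℝ}
    (hf1 : ∀ x : Supp φ, FitsBits p (φ x.1) → ∑ z, suppGenerator H φ z x = 0 → 1 ≤ f x)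
    (hf0 : ∀ x, 0 ≤ f x)
    (hf : ∀ x : Supp φ, FitsBits p (φ x.1) → ∑ z, suppGenerator H φ z x = 0 →
      ∑ y, (suppGenerator H φ y x : ℝ) * f y ≤ -(ε / 2) * f x) (c : Config (Supp φ)) :
    expect (checkStep p p' t H φ c) (acceptBound t (ε / 2) f) ≤ acceptBound t (ε / 2) f c := by
  cases c with
  | halt b => simp only [checkStep, expect_pure, le_refl]
  | run c x τ =>
    by_cases hτ0 : τ < 0
    · simp [acceptBound, hτ0]
    by_cases hτ : τ < t
    swap
    · simp [checkStep, hτ, expect_pure, acceptBound, hτ0]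
    refine expect_checkStep_le hτ (fun _ => by simp [acceptBound]) ?_ ?_
    all_goals intro h1 h2 h3 h4
    all_goals
      -- the diagonal rate is at least `ε`
      have hdiag : ε ≤ |(suppGenerator H φ x x : ℝ)| := by
        have h5 := quadraticForm_suppGenerator_ge hH (fun y : Supp φ => if y = x then 1 else 0)
        have hx : 0 < (φ x.1 : ℝ) ^ 2 := by
          have : (φ x.1 : ℝ) ≠ 0 := by exact_mod_cast x.2
          positivity
        simp only [ite_pow, one_pow, zero_pow two_ne_zero, mul_ite, mul_one, mul_zero,
          Finset.sum_ite_eq', Finset.mem_univ, if_true] at h5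
        refine le_trans ?_ (neg_le_abs _)
        refine le_of_mul_le_mul_left ?_ hx
        linarith
    · rw [h4] at hdiag
      simp at hdiag
      linarith
    · have hδ : 0 ≤ ((delta p' t : ℚ) : ℝ) := delta_nonneg p' t
      have hl0 : 0 < |(suppGenerator H φ x x : ℝ)| := hε.trans_le hdiag
      have hτ' : (τ : ℝ) < t := by exact_mod_cast hτ
      have hτ0' : (0 : ℝ) ≤ τ := by exact_mod_cast not_lt.1 hτ0
      have ht0 : (0 : ℝ) ≤ t := Nat.cast_nonneg t
      simp only [acceptBound, if_neg hτ0, if_pos hτ]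
      refine expect_jump_le (a := 1) (v := f) (jumpProb_nonneg H φ x) (sum_jumpProb h2 h4) x (c + 1)
        τ _ (by linarith) (by linarith) hf0 ?_ ?_ zero_le_one ?_
      · intro j y
        have h6 : ¬ τ + j * delta p' t < 0 := by
          rw [not_lt]
          have := mul_nonneg (Nat.cast_nonneg (α := ℚ) j) (delta_pos p' t).le
          linarith [not_lt.1 hτ0]
        simp only [acceptBound, if_neg h6, remaining_le_iff]
        by_cases h7 : τ + j * delta p' t < t
        · rw [if_pos h7, if_neg (not_not.2 h7)]
          refine le_of_eq ?_
          congr 3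
          push_cast
          ring
        · rw [if_neg h7, if_pos h7]; simp
      · have h5 := hf x h1 h2
        have h6 := abs_mul_sum_jumpProb h2 h4 f
        have h7 := one_sub_exp_mul_le (δ := ((delta p' t : ℚ) : ℝ)) (half_pos hε).le
          (show ε / 2 < |(suppGenerator H φ x x : ℝ)| by linarith)
        have h8 : 0 ≤ 1 - Real.exp (-(|(suppGenerator H φ x x : ℝ)| *
            ((delta p' t : ℚ) : ℝ))) := by
          rw [sub_nonneg, Real.exp_le_one_iff, neg_nonpos]
          positivity
        have h9 := mul_le_mul_of_nonneg_right h7 (hf0 x)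
        have h10 : |(suppGenerator H φ x x : ℝ)| * ∑ y, (jumpProb H φ x y : ℝ) * f y ≤
            (|(suppGenerator H φ x x : ℝ)| - ε / 2) * f x := by rw [h6]; linarith
        have h11 := mul_le_mul_of_nonneg_left h10 h8
        refine le_of_mul_le_mul_left ?_ hl0
        linarith
      · intro d hd
        have h5 : 1 ≤ Real.exp (ε / 2 * d) := Real.one_le_exp (by positivity)
        nlinarith [hf1 x h1 h2]

lemma exp_neg_natCast_le (N : ℕ) : Real.exp (-(N : ℝ)) ≤ (1 / 2) ^ N := by
  have h : Real.exp (-1) ≤ 1 / 2 := by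
    rw [Real.exp_neg, one_div]
    exact inv_anti₀ two_pos (by linarith [Real.add_one_le_exp 1])
  calc Real.exp (-(N : ℝ)) = Real.exp (-1) ^ N := by rw [← Real.exp_nat_mul]; ring_nf
    _ ≤ (1 / 2) ^ N := pow_le_pow_left₀ (Real.exp_pos _).le h N

/-- If the least eigenvalue is at least `ε` and the time is long compared with `1 / ε`, then every
witness is rejected with high probability. -/
theorem soundness {p p' t : ℕ} (ht : 1 ≤ t) {ε : ℝ} (hε : 0 < ε)
    (hεt : (2 * n + 2 * p + 1 : ℕ) ≤ ε / 2 * t) (hNo : H.IsNo ε) (φ : BitStr n → ℚ)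
    (xin : BitStr n) : 1 - 2⁻¹ ^ n ≤ checkProb p p' t H φ xin false := by
  have hH : ∀ v : BitStr n → ℝ, ε * ∑ x, v x ^ 2 ≤ ∑ x, ∑ y, v x * (H.matrix x y : ℝ) * v y :=
    fun v => mul_sum_sq_le_of_le_groundEnergy (A := H.realMatrix)
      (fun x y => by simp only [Hamiltonian.realMatrix, Matrix.map_apply, H.matrix_symm x y]) hNo v
  obtain ⟨f, hf1, hf0, hf, hfB⟩ := exists_superharmonic hε hH
    {x : Supp φ | FitsBits p (φ x.1) ∧ ∑ z, suppGenerator H φ z x = 0} (fun x hx => hx.2)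
    (B := (2 ^ p) ^ 2) (by positivity) (fun x hx => by
      rw [sq_le_sq, abs_of_pos (show (0 : ℝ) < 2 ^ p by positivity)]
      exact_mod_cast hx.1.abs_le)
  refine le_checkProb_of_forall_iter_le p p' t H φ xin false fun N => ?_
  have hfnn : ∀ x, 0 ≤ f x := fun x => by
    by_cases hx : x ∈ {x : Supp φ | FitsBits p (φ x.1) ∧ ∑ z, suppGenerator H φ z x = 0}
    · exact zero_le_one.trans (hf1 x hx)
    · rw [hf0 x hx]
  refine (iterPMF_apply_le (V := acceptBound t (ε / 2) f) (expect_acceptBound_le hε hH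
    (fun x h1 h2 => hf1 x ⟨h1, h2⟩) hfnn (fun x h1 h2 => hf x ⟨h1, h2⟩))
    (by simp [acceptBound]) N _).trans ?_
  by_cases hxin : φ xin = 0
  · simp [checkInit, hxin, acceptBound]
  have ht' : (0 : ℚ) < t := by exact_mod_cast ht
  simp only [checkInit, ne_eq, hxin, not_false_eq_true, dif_pos, acceptBound, lt_irrefl, if_false,
    ht', if_true]
  have hq : (2⁻¹ ^ n : ℝ≥0∞) = ENNReal.ofReal ((1 / 2) ^ n) := by
    rw [ENNReal.ofReal_pow (by norm_num), one_div, ENNReal.ofReal_inv_of_pos two_pos]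
    simp
  rw [hq]
  refine ENNReal.ofReal_le_ofReal ?_
  have hexp : Real.exp (-(ε / 2 * ((t : ℝ) - ((0 : ℚ) : ℝ)))) ≤ (1 / 2) ^ (2 * n + 2 * p + 1) := by
    refine le_trans ?_ (exp_neg_natCast_le _)
    rw [Real.exp_le_exp]
    push_cast at hεt ⊢
    linarith
  have hfx : f ⟨xin, hxin⟩ ≤ 2 ^ (n + 2 * p + 1) := by
    by_cases hx : (⟨xin, hxin⟩ : Supp φ) ∈
        {x : Supp φ | FitsBits p (φ x.1) ∧ ∑ z, suppGenerator H φ z x = 0}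
    · have h1 := hfB _ hx
      have h2 := hx.1.one_le_two_pow_mul_abs hxin
      dsimp only at h1 h2
      set y := f ⟨xin, hxin⟩ - 1 with hy
      have h3 : (2 ^ p * |(φ xin : ℝ)|) ^ 2 * y ^ 2 ≤ 2 ^ n * ((2 ^ p) ^ 2) ^ 2 := by
        rw [mul_pow, sq_abs]
        calc _ = (2 ^ p) ^ 2 * ((φ xin : ℝ) ^ 2 * y ^ 2) := by ring
          _ ≤ (2 ^ p) ^ 2 * (2 ^ n * (2 ^ p) ^ 2) := by gcongr
          _ = _ := by ring
      have h4 : y ^ 2 ≤ (2 ^ (n + 2 * p)) ^ 2 := by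
        have h5 : 1 * y ^ 2 ≤ (2 ^ p * |(φ xin : ℝ)|) ^ 2 * y ^ 2 :=
          mul_le_mul_of_nonneg_right (one_le_pow₀ h2) (sq_nonneg _)
        have h6 : (2 : ℝ) ^ n * ((2 ^ p) ^ 2) ^ 2 ≤ (2 ^ (n + 2 * p)) ^ 2 := by
          have h7 : ((2 : ℝ) ^ (n + 2 * p)) ^ 2 = 2 ^ n * (2 ^ n * ((2 ^ p) ^ 2) ^ 2) := by
            rw [pow_add, pow_mul']; ring
          have h8 : (1 : ℝ) ≤ 2 ^ n := one_le_pow₀ one_le_two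
          have h9 : 0 ≤ (2 : ℝ) ^ n * ((2 ^ p) ^ 2) ^ 2 := by positivity
          rw [h7]; nlinarith
        linarith
      have h5 : y ≤ 2 ^ (n + 2 * p) := le_of_sq_le_sq h4 (by positivity)
      have h6 : (1 : ℝ) ≤ 2 ^ (n + 2 * p) := one_le_pow₀ one_le_two
      rw [pow_succ]
      linarith
    · rw [hf0 _ hx]; positivity
  calc _ ≤ (1 / 2 : ℝ) ^ (2 * n + 2 * p + 1) * 2 ^ (n + 2 * p + 1) :=
        mul_le_mul hexp hfx (hfnn _) (by positivity)
    _ = (1 / 2) ^ n * ((1 / 2) ^ (n + 2 * p + 1) * 2 ^ (n + 2 * p + 1)) := by ring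
    _ = (1 / 2) ^ n := by rw [← mul_pow]; norm_num

end Soundness

/-! ### Completeness -/

section Completeness

variable {n k m : ℕ} {H : Hamiltonian n k m} {φ : BitStr n → ℚ}

lemma abs_matrix_le_opNorm (H : Hamiltonian n k m) (x y : BitStr n) :
    |(H.matrix x y : ℝ)| ≤ H.opNorm := by
  have h1 := (Matrix.toEuclideanCLM (𝕜 := ℝ) H.realMatrix).le_opNorm (EuclideanSpace.single y 1)
  have h2 := PiLp.norm_apply_le (Matrix.toEuclideanCLM (𝕜 := ℝ) H.realMatrix
    (EuclideanSpace.single y 1)) x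
  rw [PiLp.norm_single, norm_one, mul_one] at h1
  refine le_trans (le_of_eq ?_) (h2.trans h1)
  rw [Matrix.ofLp_toEuclideanCLM, ← Real.norm_eq_abs]
  simp [Hamiltonian.realMatrix]

lemma sum_abs_matrix_le (H : Hamiltonian n k m) (x : Supp φ) :
    ∑ y : Supp φ, (if y = x then 0 else |(H.matrix x.1 y.1 : ℝ)|) ≤ 2 ^ k * m * H.opNorm := by
  have h0 : 0 ≤ H.opNorm := norm_nonneg _
  let g : BitStr n → ℝ := fun y => if y = x.1 then 0 else |(H.matrix x.1 y : ℝ)|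
  have h1 : ∑ y : Supp φ, (if y = x then 0 else |(H.matrix x.1 y.1 : ℝ)|) ≤ ∑ y, g y := by
    have h2 : ∑ y : Supp φ, (if y = x then 0 else |(H.matrix x.1 y.1 : ℝ)|) =
        ∑ y : Supp φ, if φ y.1 ≠ 0 then g y.1 else 0 := by
      refine Finset.sum_congr rfl fun y _ => ?_
      rw [if_pos y.2]
      simp only [g, Subtype.ext_iff]
    rw [h2, sum_supp (φ := φ) (f := fun y => if φ y ≠ 0 then g y else 0) fun y hy => by simp [hy]]
    refine Finset.sum_le_sum fun y _ => ?_
    have : 0 ≤ g y := by simp only [g]; split_ifs <;> positivity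
    split_ifs <;> linarith
  refine h1.trans ?_
  rw [← Finset.sum_subset (Finset.subset_univ (neighbours H x.1).toFinset)]
  · refine (Finset.sum_le_card_nsmul _ _ H.opNorm fun y _ => ?_).trans ?_
    · simp only [g]
      split_ifs
      · exact h0
      · exact abs_matrix_le_opNorm H x.1 y
    · rw [nsmul_eq_mul]
      refine mul_le_mul_of_nonneg_right ?_ h0
      have := (List.toFinset_card_le _).trans (length_neighbours H x.1)
      rw [mul_comm]
      exact_mod_cast this
  · intro y _ hy
    simp only [g]
    split_ifs with h
    · rfl
    · rw [matrix_eq_zero_of_notMem_neighbours H h (by simpa using hy)]; simp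

/-- The jump rates out of `x`, without the diagonal. -/
noncomputable def offRate (H : Hamiltonian n k m) (φ : BitStr n → ℚ) (x y : Supp φ) : ℝ :=
  if y = x then 0 else (suppGenerator H φ y x : ℝ)

lemma offRate_nonneg (x y : Supp φ) : 0 ≤ offRate H φ x y := by
  unfold offRate
  split_ifs with h
  · exact le_rfl
  · exact_mod_cast suppGenerator_nonneg H φ h

lemma sum_offRate_mul (hx : ∀ x : Supp φ, ∑ z, suppGenerator H φ z x = 0) (x : Supp φ)
    (v : Supp φ → ℝ) : ∑ y, offRate H φ x y * v y =
      ∑ y, (suppGenerator H φ y x : ℝ) * v y + |(suppGenerator H φ x x : ℝ)| * v x := by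
  have h1 : |(suppGenerator H φ x x : ℝ)| = -(suppGenerator H φ x x : ℝ) :=
    abs_of_nonpos (by exact_mod_cast suppGenerator_self_nonpos (hx x))
  have h2 : ∀ y, offRate H φ x y * v y = (suppGenerator H φ y x : ℝ) * v y +
        if y = x then |(suppGenerator H φ x x : ℝ)| * v y else 0 := by
    intro y
    unfold offRate
    split_ifs with h
    · subst h; rw [h1]; ring
    · ring
  rw [Finset.sum_congr rfl fun y _ => h2 y, Finset.sum_add_distrib,
    Finset.sum_ite_eq', if_pos (Finset.mem_univ _)]

lemma sum_offRate (hx : ∀ x : Supp φ, ∑ z, suppGenerator H φ z x = 0) (x : Supp φ) :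
    ∑ y, offRate H φ x y = |(suppGenerator H φ x x : ℝ)| := by
  have h := sum_offRate_mul hx x fun _ => 1
  have hx' : ∑ z, (suppGenerator H φ z x : ℝ) = 0 := by exact_mod_cast hx x
  simpa [hx'] using h

/-- The Laplace transform of the time of the `i`-th jump of the continuous-time chain started from `x`,
evaluated at `s`. -/
noncomputable def laplace (H : Hamiltonian n k m) (φ : BitStr n → ℚ) (s : ℝ) : ℕ → Supp φ → ℝ
  | 0, _ => 1
  | i + 1, x => (∑ y, offRate H φ x y * laplace H φ s i y) / (|(suppGenerator H φ x x : ℝ)| + s)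

lemma laplace_nonneg {s : ℝ} (hs : 0 < s) (i : ℕ) (x : Supp φ) : 0 ≤ laplace H φ s i x := by
  induction i generalizing x with
  | zero => exact zero_le_one
  | succ i ih =>
    rw [laplace]
    exact div_nonneg (Finset.sum_nonneg fun y _ => mul_nonneg (offRate_nonneg _ _) (ih y))
      (by positivity)

lemma laplace_antitone {s : ℝ} (hs : 0 < s) (hx : ∀ x : Supp φ, ∑ z, suppGenerator H φ z x = 0)
    (x : Supp φ) : Antitone fun i => laplace H φ s i x := by
  refine antitone_nat_of_succ_le fun i => ?_
  induction i generalizing x with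
  | zero =>
    simp only [laplace, mul_one, sum_offRate hx]
    have := abs_nonneg (suppGenerator H φ x x : ℝ)
    rw [div_le_one (by linarith)]
    linarith
  | succ i ih =>
    rw [laplace, laplace]
    have := abs_nonneg (suppGenerator H φ x x : ℝ)
    gcongr with y
    · exact offRate_nonneg _ _
    · exact ih y

/-- In the stationary distribution the `N`-th jump is unlikely to happen early: the expected discounted
number of jumps is the mean jump rate divided by `s`. -/
lemma mul_sum_laplace_le {s : ℝ} (hs : 0 < s)
    (hx : ∀ x : Supp φ, ∑ z, suppGenerator H φ z x = 0) (N : ℕ) :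
    s * (N * ∑ x : Supp φ, (φ x.1 : ℝ) ^ 2 * laplace H φ s N x) ≤
      ∑ x : Supp φ, (φ x.1 : ℝ) ^ 2 * |(suppGenerator H φ x x : ℝ)| := by
  have hstat : ∀ v : Supp φ → ℝ,
      ∑ x : Supp φ, (φ x.1 : ℝ) ^ 2 * ∑ y, (suppGenerator H φ y x : ℝ) * v y = 0 := by
    intro v
    simp only [Finset.mul_sum]
    rw [Finset.sum_comm]
    refine Finset.sum_eq_zero fun y _ => ?_
    have h1 : ∀ x : Supp φ, (φ x.1 : ℝ) ^ 2 * ((suppGenerator H φ y x : ℝ) * v y) =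
        (φ y.1 : ℝ) ^ 2 * v y * (suppGenerator H φ x y : ℝ) := by
      intro x
      have h2 : (φ x.1 : ℝ) ^ 2 * (suppGenerator H φ y x : ℝ) =
        (φ y.1 : ℝ) ^ 2 * (suppGenerator H φ x y : ℝ) := by
        exact_mod_cast sq_mul_suppGenerator_comm H φ x y
      linear_combination v y * h2
    have h3 : ∑ z, (suppGenerator H φ z y : ℝ) = 0 := by exact_mod_cast hx y
    rw [Finset.sum_congr rfl fun x _ => h1 x, ← Finset.mul_sum, h3, mul_zero]
  have hstep : ∀ i, s * ∑ x : Supp φ, (φ x.1 : ℝ) ^ 2 * laplace H φ s (i + 1) x =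
      ∑ x : Supp φ, (φ x.1 : ℝ) ^ 2 * |(suppGenerator H φ x x : ℝ)| * laplace H φ s i x -
      ∑ x : Supp φ, (φ x.1 : ℝ) ^ 2 * |(suppGenerator H φ x x : ℝ)| * laplace H φ s (i + 1) x := by
    intro i
    have h1 : ∀ x : Supp φ, (φ x.1 : ℝ) ^ 2 * ∑ y, (suppGenerator H φ y x : ℝ) * laplace H φ s i y =
        s * ((φ x.1 : ℝ) ^ 2 * laplace H φ s (i + 1) x) -
        ((φ x.1 : ℝ) ^ 2 * |(suppGenerator H φ x x : ℝ)| * laplace H φ s i x -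
        (φ x.1 : ℝ) ^ 2 * |(suppGenerator H φ x x : ℝ)| * laplace H φ s (i + 1) x) := by
      intro x
      have h2 : (|(suppGenerator H φ x x : ℝ)| + s) * laplace H φ s (i + 1) x =
          ∑ y, offRate H φ x y * laplace H φ s i y := by
        rw [laplace, mul_div_cancel₀]
        have := abs_nonneg (suppGenerator H φ x x : ℝ)
        linarith
      rw [sum_offRate_mul hx] at h2
      linear_combination (-(φ x.1 : ℝ) ^ 2) * h2
    have h3 := hstat (laplace H φ s i)
    rw [Finset.sum_congr rfl fun x _ => h1 x, Finset.sum_sub_distrib, Finset.sum_sub_distrib,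
      ← Finset.mul_sum] at h3
    linarith
  have hsum : s * ∑ i ∈ Finset.range N, ∑ x : Supp φ, (φ x.1 : ℝ) ^ 2 * laplace H φ s (i + 1) x ≤
      ∑ x : Supp φ, (φ x.1 : ℝ) ^ 2 * |(suppGenerator H φ x x : ℝ)| := by
    rw [Finset.mul_sum, Finset.sum_congr rfl fun i _ => hstep i, Finset.sum_range_sub'
      (fun i => ∑ x : Supp φ, (φ x.1 : ℝ) ^ 2 * |(suppGenerator H φ x x : ℝ)| * laplace H φ s i x)]
    have h1 : 0 ≤ ∑ x : Supp φ, (φ x.1 : ℝ) ^ 2 * |(suppGenerator H φ x x : ℝ)| *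
        laplace H φ s N x := Finset.sum_nonneg fun x _ => by
      have := laplace_nonneg (H := H) hs N x
      positivity
    simp only [laplace, mul_one]
    linarith
  refine le_trans (mul_le_mul_of_nonneg_left ?_ hs.le) hsum
  rw [← nsmul_eq_mul, ← Finset.card_range N, ← Finset.sum_const, Finset.card_range]
  refine Finset.sum_le_sum fun i hi => ?_
  refine Finset.sum_le_sum fun x _ => mul_le_mul_of_nonneg_left ?_ (sq_nonneg _)
  exact laplace_antitone hs hx x (Finset.mem_range.1 hi)

/-- The mean jump rate in the stationary distribution. -/
lemma sum_sq_mul_abs_suppGenerator_le (hx : ∀ x : Supp φ, ∑ z, suppGenerator H φ z x = 0) :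
    ∑ x : Supp φ, (φ x.1 : ℝ) ^ 2 * |(suppGenerator H φ x x : ℝ)| ≤
      2 ^ k * m * H.opNorm * ∑ x : Supp φ, (φ x.1 : ℝ) ^ 2 := by
  have h1 : ∀ x y : Supp φ, (φ x.1 : ℝ) ^ 2 * offRate H φ x y ≤
      (if y = x then 0 else |(H.matrix x.1 y.1 : ℝ)|) *
        (((φ x.1 : ℝ) ^ 2 + (φ y.1 : ℝ) ^ 2) / 2) := by
    intro x y
    unfold offRate
    split_ifs with h
    · simp
    · have h2 := sq_mul_suppGenerator H φ x y
      rw [if_neg (Ne.symm h), removedPart, if_neg (Ne.symm h), sub_zero] at h2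
      have h3 : φ x.1 ^ 2 * suppGenerator H φ y x ≤ |H.matrix x.1 y.1| * (|φ x.1| * |φ y.1|) := by
        have h4 : |H.matrix x.1 y.1| * (|φ x.1| * |φ y.1|) = |φ x.1 * H.matrix x.1 y.1 * φ y.1| := by
          rw [abs_mul, abs_mul]; ring
        rw [h2, h4]
        rcases le_total (φ x.1 * H.matrix x.1 y.1 * φ y.1) 0 with h5 | h5
        · rw [max_eq_right h5, abs_of_nonpos h5, zero_sub]
        · rw [max_eq_left h5, sub_self]; positivity
      have h4 : (φ x.1 : ℝ) ^ 2 * (suppGenerator H φ y x : ℝ) ≤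
          |(H.matrix x.1 y.1 : ℝ)| * (|(φ x.1 : ℝ)| * |(φ y.1 : ℝ)|) := by exact_mod_cast h3
      refine h4.trans (mul_le_mul_of_nonneg_left ?_ (abs_nonneg _))
      have := two_mul_le_add_sq |(φ x.1 : ℝ)| |(φ y.1 : ℝ)|
      rw [sq_abs, sq_abs] at this
      linarith
  have hsym : ∑ x : Supp φ, ∑ y : Supp φ,
      (if y = x then 0 else |(H.matrix x.1 y.1 : ℝ)|) * (φ y.1 : ℝ) ^ 2 =
      ∑ x : Supp φ, ∑ y : Supp φ,
        (if y = x then 0 else |(H.matrix x.1 y.1 : ℝ)|) * (φ x.1 : ℝ) ^ 2 := by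
    rw [Finset.sum_comm]
    refine Finset.sum_congr rfl fun x _ => Finset.sum_congr rfl fun y _ => ?_
    rw [H.matrix_symm]
    simp only [eq_comm]
  calc ∑ x : Supp φ, (φ x.1 : ℝ) ^ 2 * |(suppGenerator H φ x x : ℝ)|
      = ∑ x : Supp φ, ∑ y, (φ x.1 : ℝ) ^ 2 * offRate H φ x y := by
        refine Finset.sum_congr rfl fun x _ => ?_
        rw [← Finset.mul_sum, sum_offRate hx]
    _ ≤ ∑ x : Supp φ, ∑ y : Supp φ, (if y = x then 0 else |(H.matrix x.1 y.1 : ℝ)|) *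
        (((φ x.1 : ℝ) ^ 2 + (φ y.1 : ℝ) ^ 2) / 2) :=
        Finset.sum_le_sum fun x _ => Finset.sum_le_sum fun y _ => h1 x y
    _ = (∑ x : Supp φ, ∑ y : Supp φ, (if y = x then 0 else |(H.matrix x.1 y.1 : ℝ)|) *
          (φ x.1 : ℝ) ^ 2 +
        ∑ x : Supp φ, ∑ y : Supp φ, (if y = x then 0 else |(H.matrix x.1 y.1 : ℝ)|) *
          (φ y.1 : ℝ) ^ 2) / 2 := by
        simp only [← Finset.sum_add_distrib, Finset.sum_div]
        refine Finset.sum_congr rfl fun x _ => Finset.sum_congr rfl fun y _ => ?_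
        ring
    _ = ∑ x : Supp φ, (∑ y : Supp φ, (if y = x then 0 else |(H.matrix x.1 y.1 : ℝ)|)) *
          (φ x.1 : ℝ) ^ 2 := by
        rw [hsym, add_self_div_two]
        simp only [Finset.sum_mul]
    _ ≤ _ := by
        rw [Finset.mul_sum]
        exact Finset.sum_le_sum fun x _ =>
          mul_le_mul_of_nonneg_right (sum_abs_matrix_le H x) (sq_nonneg _)

/-- An upper bound for the probability of rejection from a configuration with `c` transitions made and
`N - c` transitions left. -/
noncomputable def rejectBound (H : Hamiltonian n k m) (φ : BitStr n → ℚ) (p' t N : ℕ) (s : ℝ) :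
    Config (Supp φ) → ℝ≥0∞
  | .halt b => if b then 0 else 1
  | .run c x τ => if τ < 0 ∨ N < c then ⊤ else if τ < t then
      ENNReal.ofReal (Real.exp (s * ((t : ℝ) - τ)) *
        (Real.exp (s * ((delta p' t : ℚ) : ℝ)) ^ (N - c) * laplace H φ s (N - c) x)) else 0

lemma expect_rejectBound_le {p p' t : ℕ} {s : ℝ} (hs : 0 < s)
    (hx : ∀ x : Supp φ, ∑ z, suppGenerator H φ z x = 0) (hp : ∀ x : Supp φ, FitsBits p (φ x.1))
    (c : Config (Supp φ)) :
    expect (checkStep p p' t H φ c) (rejectBound H φ p' t ⌈maxTransitions H t⌉₊ s) ≤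
      rejectBound H φ p' t ⌈maxTransitions H t⌉₊ s c := by
  set N := ⌈maxTransitions H t⌉₊ with hN
  cases c with
  | halt b => simp only [checkStep, expect_pure, le_refl]
  | run c x τ =>
    by_cases hτ0 : τ < 0 ∨ N < c
    · simp [rejectBound, hτ0]
    by_cases hτ : τ < t
    swap
    · simp [checkStep, hτ, expect_pure, rejectBound]
    have hcN : c ≤ N := by rw [not_or] at hτ0; exact not_lt.1 hτ0.2
    have hτ0' : (0 : ℚ) ≤ τ := by rw [not_or] at hτ0; exact not_lt.1 hτ0.1
    have hτr : (τ : ℝ) < t := by exact_mod_cast hτ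
    have hτ0r : (0 : ℝ) ≤ τ := by exact_mod_cast hτ0'
    have ht0 : (0 : ℝ) ≤ t := Nat.cast_nonneg t
    have hV : rejectBound H φ p' t N s (.run c x τ) = ENNReal.ofReal
        (Real.exp (s * ((t : ℝ) - τ)) *
        (Real.exp (s * ((delta p' t : ℚ) : ℝ)) ^ (N - c) * laplace H φ s (N - c) x)) := by
      simp only [rejectBound, if_neg hτ0, if_pos hτ]
    rw [hV]
    refine expect_checkStep_le hτ (fun h => ?_) (fun _ _ _ _ => ?_) (fun h1 h2 h3 h4 => ?_)
    · have hMc : maxTransitions H t ≤ c := by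
        by_contra h'
        exact h ⟨hp x, hx x, h'⟩
      have hc : c = N := le_antisymm hcN (Nat.ceil_le.2 hMc)
      simp only [rejectBound, Bool.false_eq_true, if_false, hc, Nat.sub_self, pow_zero, laplace,
        mul_one]
      rw [← ENNReal.ofReal_one]
      refine ENNReal.ofReal_le_ofReal (Real.one_le_exp (mul_nonneg hs.le (by linarith)))
    · have : ¬ ((t : ℚ) < 0 ∨ N < c) := by
        rw [not_or]
        exact ⟨not_lt.2 (Nat.cast_nonneg t), not_lt.2 hcN⟩
      simp [rejectBound, this]
    · have hcN' : c < N := by rw [← Nat.ceil_le, not_le] at h3; exact h3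
      obtain ⟨i, hi⟩ : ∃ i, N - c = i + 1 := ⟨N - c - 1, by omega⟩
      have hi' : N - (c + 1) = i := by omega
      set e := Real.exp (s * ((delta p' t : ℚ) : ℝ)) with he
      have he0 : 0 < e := Real.exp_pos _
      have hl0 : 0 < |(suppGenerator H φ x x : ℝ)| := abs_pos.2 (by exact_mod_cast h4)
      have key := expect_jump_le (p' := p') (t := t) (g := suppGenerator H φ x x) (s := -s)
        (a := 0) (u := (t : ℝ) - τ) (f := e ^ (N - c) * laplace H φ s (N - c) x)
        (v := fun y => e ^ i * laplace H φ s i y) (jumpProb_nonneg H φ x)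
        (sum_jumpProb h2 h4) x (c + 1) τ (rejectBound H φ p' t N s) (by linarith) (by linarith)
        (fun y => mul_nonneg (by positivity) (laplace_nonneg hs i y)) ?_ ?_ le_rfl ?_
      · rw [neg_mul, neg_neg] at key
        exact key
      · intro j y
        have h6 : ¬ (τ + j * delta p' t < 0 ∨ N < c + 1) := by
          rw [not_or, not_lt, not_lt]
          refine ⟨?_, hcN'⟩
          have := mul_nonneg (Nat.cast_nonneg (α := ℚ) j) (delta_pos p' t).le
          linarith
        simp only [rejectBound, if_neg h6, remaining_le_iff]
        by_cases h7 : τ + j * delta p' t < t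
        · rw [if_pos h7, if_neg (not_not.2 h7), hi']
          refine le_of_eq ?_
          congr 3
          push_cast
          ring
        · rw [if_neg h7, if_pos h7]; simp
      · have h6 := abs_mul_sum_jumpProb h2 h4 (laplace H φ s i)
        rw [← sum_offRate_mul hx] at h6
        have h7 : (|(suppGenerator H φ x x : ℝ)| + s) * laplace H φ s (i + 1) x =
            ∑ y, offRate H φ x y * laplace H φ s i y := by
          rw [laplace, mul_div_cancel₀]
          linarith
        have h8 := one_sub_exp_mul_le' (δ := ((delta p' t : ℚ) : ℝ)) hs.le hl0
        have h9 : ∑ y, (jumpProb H φ x y : ℝ) * (e ^ i * laplace H φ s i y) =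
            e ^ i * ∑ y, (jumpProb H φ x y : ℝ) * laplace H φ s i y := by
          rw [Finset.mul_sum]
          exact Finset.sum_congr rfl fun y _ => by ring
        rw [h9, hi, sub_neg_eq_add]
        refine le_of_mul_le_mul_left ?_ hl0
        have h10 := mul_le_mul_of_nonneg_right h8
          (mul_nonneg (pow_pos he0 i).le (laplace_nonneg (H := H) hs (i + 1) x))
        rw [← he] at h10
        rw [← h7] at h6
        rw [pow_succ]
        calc _ = (1 - Real.exp (-(|(suppGenerator H φ x x : ℝ)| * ((delta p' t : ℚ) : ℝ)))) *
              e ^ i * (|(suppGenerator H φ x x : ℝ)| *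
                ∑ y, (jumpProb H φ x y : ℝ) * laplace H φ s i y) := by ring
          _ = _ := by rw [h6]; ring
          _ ≤ _ := h10
          _ = _ := by ring
      · intro d _
        exact mul_nonneg (mul_nonneg (by positivity) (laplace_nonneg hs _ x)) (Real.exp_nonneg _)

lemma exp_five_quarters_le : Real.exp (1 + 1 / 4) ≤ 4 := by
  have h1 := Real.exp_one_lt_d9
  have h2 : Real.exp (1 / 4) ≤ 4 / 3 := by
    have h3 := Real.add_one_le_exp (-(1 / 4 : ℝ))
    rw [Real.exp_neg] at h3
    have h4 := Real.exp_pos (1 / 4 : ℝ)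
    have h5 := mul_le_mul_of_nonneg_right h3 h4.le
    rw [inv_mul_cancel₀ h4.ne'] at h5
    linarith
  rw [Real.exp_add]
  nlinarith [Real.exp_pos 1, Real.exp_pos (1 / 4 : ℝ)]

lemma delta_mul_le {p' t N : ℕ} (hN : N ≤ p' * t) : N * ((delta p' t : ℚ) : ℝ) ≤ 1 / 4 := by
  have h1 : (4 * N : ℕ) ≤ 2 ^ (200 * p' * t) := by
    rcases Nat.eq_zero_or_pos N with h | h
    · simp [h]
    · have h2 : N < 2 ^ N := Nat.lt_two_pow_self
      have h3 : 2 ^ (N + 2) ≤ 2 ^ (200 * p' * t) :=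
        Nat.pow_le_pow_right two_pos (by rw [mul_assoc]; omega)
      rw [pow_add] at h3
      omega
  have h2 : (4 * N : ℝ) ≤ 2 ^ (200 * p' * t) := by exact_mod_cast h1
  unfold delta
  push_cast
  rw [one_div, inv_pow, ← div_eq_mul_inv, div_le_iff₀ (by positivity)]
  linarith

/-- A succinct ground state of energy `0` is accepted from a suitable starting string. -/
theorem completeness {p p' t s : ℕ} (hn : 2 ≤ n) (ht : 1 ≤ t)
    (hN : ⌈maxTransitions H t⌉₊ ≤ p' * t) (hYes : H.IsYes p s) :
    ∃ C : AmpCircuit n, C.size ≤ s ∧ ∃ xin : BitStr n,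
      1 / 2 ≤ checkProb p p' t H C.value xin true := by
  obtain ⟨hH0, hE, ψ, hψ1, hψ, C, hCs, ⟨c, hc, hCψ⟩, hCp⟩ := hYes
  refine ⟨C, hCs, ?_⟩
  set φ := C.value with hφ
  -- the eigenvalue equation for the unnormalized state
  have hker : ∀ x, ∑ y, H.matrix x y * φ y = 0 := by
    intro x
    rw [hE, zero_smul] at hψ
    have h1 := congrArg (fun v : EuclideanSpace ℝ (BitStr n) => v x) hψ
    simp only [Matrix.ofLp_toEuclideanCLM, Matrix.mulVec, dotProduct, Hamiltonian.realMatrix,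
      Matrix.map_apply, PiLp.zero_apply] at h1
    have h2 : ∑ y, (H.matrix x y : ℝ) * (φ y : ℝ) = 0 := by
      simp only [hCψ, mul_left_comm _ c, ← Finset.mul_sum, h1, mul_zero]
    exact_mod_cast h2
  have hx : ∀ x : Supp φ, ∑ z, suppGenerator H φ z x = 0 := by
    intro x
    have h1 := sq_mul_sum_suppGenerator H φ x
    rw [hker, mul_zero, neg_zero] at h1
    exact (mul_eq_zero.1 h1).resolve_left (pow_ne_zero 2 x.2)
  obtain ⟨x₀, hx₀⟩ : ∃ x, φ x ≠ 0 := by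
    by_contra! h
    have h1 : ψ = 0 := by
      ext x
      have := hCψ x
      rw [h x] at this
      simpa [hc.ne'] using this.symm
    rw [h1] at hψ1
    simp at hψ1
  have hop : 0 < H.opNorm := by
    refine lt_of_le_of_ne (norm_nonneg _) fun h => hH0 ?_
    ext x y
    have h1 := abs_matrix_le_opNorm H x y
    rw [← h] at h1
    have h2 : (H.matrix x y : ℝ) = 0 := abs_nonpos_iff.1 h1
    exact_mod_cast h2
  -- without local terms, the kernel condition makes the shift vanish
  have hm : 0 < m := by
    rcases Nat.eq_zero_or_pos m with rfl | h
    · exfalso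
      apply hH0
      have h1 := hker x₀
      simp [Hamiltonian.matrix, hx₀] at h1
      ext x y
      simp [Hamiltonian.matrix, h1]
    · exact h
  have htr : (1 : ℝ) ≤ t := by exact_mod_cast ht
  have hs : (0 : ℝ) < 1 / t := by positivity
  set N := ⌈maxTransitions H t⌉₊ with hNdef
  set Λ : ℝ := 2 ^ k * m * H.opNorm with hΛ
  have hΛ0 : 0 < Λ := by have : (0 : ℝ) < m := by exact_mod_cast hm
                         positivity
  set Z := ∑ x : Supp φ, (φ x.1 : ℝ) ^ 2 with hZ
  have h1 := (mul_sum_laplace_le hs hx N).trans (sum_sq_mul_abs_suppGenerator_le hx)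
  rw [← hΛ, ← hZ] at h1
  set S := ∑ x : Supp φ, (φ x.1 : ℝ) ^ 2 * laplace H φ (1 / t) N x with hS
  have hS0 : 0 ≤ S := Finset.sum_nonneg fun x _ =>
    mul_nonneg (sq_nonneg _) (laplace_nonneg hs N x)
  have hNM : Λ * 8 * t ≤ N := by
    refine le_trans ?_ (Nat.le_ceil _)
    have h2 : (8 : ℝ) ≤ n ^ 3 := by
      have : 2 ^ 3 ≤ n ^ 3 := Nat.pow_le_pow_left hn 3
      exact_mod_cast this
    rw [maxTransitions, show (2 : ℝ) ^ k * m * n ^ 3 * t * H.opNorm = Λ * n ^ 3 * t by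
      rw [hΛ]; ring]
    gcongr
  have h2 : S ≤ ∑ x : Supp φ, (φ x.1 : ℝ) ^ 2 * (1 / 8) := by
    rw [← Finset.sum_mul, ← hZ]
    have h3 : Λ * 8 * t * S ≤ N * S := mul_le_mul_of_nonneg_right hNM hS0
    have h4 : N * S ≤ t * (Λ * Z) := by
      have := mul_le_mul_of_nonneg_left h1 (show (0 : ℝ) ≤ t by linarith)
      rwa [← mul_assoc, mul_one_div_cancel (by linarith), one_mul] at this
    refine le_of_mul_le_mul_left ?_ (show 0 < Λ * 8 * t by positivity)
    linarith
  obtain ⟨x, -, hxle⟩ := Finset.exists_le_of_sum_le ⟨⟨x₀, hx₀⟩, Finset.mem_univ _⟩ h2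
  have hxle' : laplace H φ (1 / t) N x ≤ 1 / 8 := by
    have : (φ x.1 : ℝ) ≠ 0 := by exact_mod_cast x.2
    exact le_of_mul_le_mul_left hxle (by positivity)
  refine ⟨x.1, ?_⟩
  have hhalf : (1 / 2 : ℝ≥0∞) = 1 - 1 / 2 := by
    rw [one_div, ENNReal.one_sub_inv_two]
  rw [hhalf]
  refine le_checkProb_of_forall_iter_le p p' t H φ x.1 true fun N' => ?_
  refine (iterPMF_apply_le (V := rejectBound H φ p' t N (1 / t))
    (expect_rejectBound_le hs hx fun x => hCp x.1) (by simp [rejectBound]) N' _).trans ?_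
  have ht' : (0 : ℚ) < t := by exact_mod_cast ht
  simp only [checkInit, ne_eq, x.2, not_false_eq_true, dif_pos, rejectBound, lt_irrefl, false_or,
    Nat.not_lt_zero, if_false, ht', if_true, Nat.sub_zero]
  have hq : (1 / 2 : ℝ≥0∞) = ENNReal.ofReal (1 / 2) := by
    rw [one_div, one_div, ENNReal.ofReal_inv_of_pos two_pos]
    simp
  rw [hq]
  refine ENNReal.ofReal_le_ofReal ?_
  have h3 : Real.exp (1 / t * ((t : ℝ) - ((0 : ℚ) : ℝ))) *
      Real.exp (1 / t * ((delta p' t : ℚ) : ℝ)) ^ N ≤ 4 := by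
    refine le_trans ?_ exp_five_quarters_le
    rw [← Real.exp_nat_mul, ← Real.exp_add, Real.exp_le_exp]
    have h4 := delta_mul_le hN
    have h5 : (N : ℝ) * (1 / t * ((delta p' t : ℚ) : ℝ)) ≤ N * ((delta p' t : ℚ) : ℝ) := by
      have h6 : (1 : ℝ) / t ≤ 1 := by rw [div_le_one (by linarith)]; exact htr
      have h7 : (0 : ℝ) ≤ ((delta p' t : ℚ) : ℝ) := delta_nonneg p' t
      have h8 := mul_le_mul_of_nonneg_right h6 h7
      rw [one_mul] at h8
      exact mul_le_mul_of_nonneg_left h8 (Nat.cast_nonneg N)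
    have h6 : 1 / (t : ℝ) * ((t : ℝ) - ((0 : ℚ) : ℝ)) = 1 := by
      rw [Rat.cast_zero, sub_zero, one_div_mul_cancel (by linarith)]
    rw [h6]
    linarith
  rw [← mul_assoc]
  calc _ ≤ 4 * (1 / 8 : ℝ) := mul_le_mul h3 hxle' (laplace_nonneg hs N x) (by norm_num)
    _ = 1 / 2 := by norm_num

end Completeness

end FixedNodeMC

/-! ### Choice of the polynomials -/

theorem theorem4 (k : ℕ) (mBound normBound gapBound p size : Polynomial ℕ) :
    ∃ p₀ t₀ : Polynomial ℕ, ∀ p' t : Polynomial ℕ,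
      (∀ n, p₀.eval n ≤ p'.eval n) → (∀ n, t₀.eval n ≤ t.eval n) →
      ∀ r : Polynomial ℕ, ∃ T : Polynomial ℕ,
        ∀ n : ℕ, 2 ≤ n → ∀ m : ℕ, m ≤ mBound.eval n → ∀ H : Hamiltonian n k m,
          H.FitsBits (p.eval n) → H.opNorm ≤ (normBound.eval n : ℕ) →
          (∀ C : AmpCircuit n, C.size ≤ size.eval n → ∀ xin : BitStr n,
            RunsWithin (T.eval n) r (p.eval n) (p'.eval n) (t.eval n) H C xin) ∧
          (H.IsYes (p.eval n) (size.eval n) →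
            ∃ C : AmpCircuit n, C.size ≤ size.eval n ∧ ∃ xin : BitStr n,
              1 / 2 ≤ checkProb (p.eval n) (p'.eval n) (t.eval n) H C.value xin true) ∧
          (∀ ε : ℝ, 0 < ε → 1 ≤ ε * (gapBound.eval n : ℕ) → H.IsNo ε →
            ∀ C : AmpCircuit n, ∀ xin : BitStr n,
              1 - 2⁻¹ ^ n ≤ checkProb (p.eval n) (p'.eval n) (t.eval n) H C.value xin false) := by
  refine ⟨Polynomial.C (2 ^ k) * mBound * Polynomial.X ^ 3 * normBound,
    2 * gapBound * (2 * Polynomial.X + 2 * p + 1) + 1, fun p' t hp' ht r => ?_⟩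
  obtain ⟨T, hT⟩ := polyBounded_totalCost r k mBound p p' t size normBound
  refine ⟨T, fun n hn m hm H hH hB => ?_⟩
  have hp'n := hp' n
  have htn := ht n
  simp only [Polynomial.eval_mul, Polynomial.eval_C, Polynomial.eval_pow, Polynomial.eval_X,
    Polynomial.eval_add, Polynomial.eval_one, Polynomial.eval_ofNat] at hp'n htn
  have ht1 : 1 ≤ t.eval n := by omega
  refine ⟨fun C hC xin => runsWithin_totalCost hm hH hC hB xin (hT n), fun hYes => ?_,
    fun ε hε hgap hNo C xin => ?_⟩
  · refine completeness hn ht1 (Nat.ceil_le.2 ((maxTransitions_le hm hB _).trans ?_)) hYes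
    have h := Nat.mul_le_mul_right (t.eval n) hp'n
    rw [mul_right_comm] at h
    exact_mod_cast h
  · refine soundness ht1 hε ?_ hNo C.value xin
    have h1 : ((2 * gapBound.eval n * (2 * n + 2 * p.eval n + 1) + 1 : ℕ) : ℝ) ≤ t.eval n := by
      exact_mod_cast htn
    push_cast at h1 ⊢
    have h2 := mul_le_mul_of_nonneg_left h1 (half_pos hε).le
    have h3 : (0 : ℝ) ≤ 2 * n + 2 * p.eval n + 1 := by positivity
    have h4 := mul_le_mul_of_nonneg_right hgap h3
    linarith
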